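/- Let $(X,g)$ be a (second countable, smooth) Riemannian manifold without boundary, with Riemannian measure $\mathrm dg$. For an open set $U\subset X$ let $H^1_0(U)$ be the closure of $C_c^\infty(U)$ in the energy norm $\|u\|_{H^1(U)}^2=\int_U(|u|^2+|du|_g^2)\,\mathrm dg$ (functions are complex valued), let the Dirichlet energy form of $U$ be $\mathfrak d_U(u,v)=\int_U\langle du,dv\rangle_g\,\mathrm dg$ on $H^1_0(U)$, let $\Delta_U\ge 0$ be the associated operator (the Dirichlet Laplacian), and let $H^2(U)$ be the space of $f\in L^2(U)$ with weak covariant derivatives $\nabla f,\nabla^2 f\in L^2$, with norm $\|f\|_{H^2(U)}^2=\|f\|^2+\|\nabla f\|^2+\|\nabla^2 f\|^2$. **Assumptions.** Let $S\subset X$ and $B_\varepsilon\subset S$ $(0<\varepsilon\le\varepsilon_0)$ be closed, put $X_0=X\setminus S$ and $X_\varepsilon=X\setminus B_\varepsilon$, and assume that $\partial S\setminus B_\varepsilon$ has measure zero. Suppose that $(B_\varepsilon)_\varepsilon$ is *Dirichlet-asymptotically solidifying* towards $S$, i.e. there are Lipschitz functions $\chi_\varepsilon:X\to[0,1]$ such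 that, with $A_\varepsilon:=X_0\cap\operatorname{supp}(d\chi_\varepsilon)$, one has $\chi_\varepsilon=0$ on $S$ and $\chi_\varepsilon=1$ on $X_0\setminus A_\varepsilon$, and there are $\delta'_\varepsilon,\delta''_\varepsilon\ge0$, $\bar\delta_\varepsilon\in\mathbb R$, all tending to $0$ as $\varepsilon\to0$, and a constant $C\ge1$ with the following properties for all $\varepsilon\in(0,\varepsilon_0]$: 1. (non-concentration) $\|u\|_{L^2(A_\varepsilon)}\le\delta'_\varepsilon\|u\|_{H^1(X_\varepsilon)}$ for all $u\in H^1_0(X_\varepsilon)$, and $\|df\|_{L^2(A_\varepsilon)}\le\delta''_\varepsilon\|f\|_{H^2(X_0)}$ for all $f\in H^2(X_0)$; 2. (elliptic regularity) $\operatorname{dom}\Delta_{X_0}\subset H^2(X_0)$ and $\|f\|_{H^2(X_0)}\le C\|(\Delta_{X_0}+1)f\|_{L^2(X_0)}$ for all $f\in\operatorname{dom}\Delta_{X_0}$; 3. (spectral solidification) $\|u\|_{L^2(\operatorname{int}S\setminus B_\varepsilon)}\le\bar\delta_\varepsilon\|u\|_{H^1(X_\varepsilon)}$ for all $u\in H^1_0(X_\varepsilon)$;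 4. (moderate decay) $\delta_\varepsilon^+:=\delta'_\varepsilon\,\delta''_\varepsilon\,\|d\chi_\varepsilon\|_\infty\to0$ as $\varepsilon\to0$. **Conclusion.** For every $\varepsilon\in(0,\varepsilon_0]$ the forms $\mathfrak d=\mathfrak d_{X_0}$ and $\tilde{\mathfrak d}=\mathfrak d_{X_\varepsilon}$ are $\delta_\varepsilon$-quasi-unitarily equivalent of order $2$ with $$\delta_\varepsilon=\max\{\bar\delta_\varepsilon,\ \delta'_\varepsilon,\ C(\delta''_\varepsilon+\delta^+_\varepsilon)\}.$$ That is, with $\delta=\delta_\varepsilon\ge0$ there are bounded linear operators $J:L^2(X_0)\to L^2(X_\varepsilon)$, $J':L^2(X_\varepsilon)\to L^2(X_0)$, $J^1:H^1_0(X_0)\to H^1_0(X_\varepsilon)$, $J'^1:H^1_0(X_\varepsilon)\to H^1_0(X_0)$ such that $\|Jf\|\le(1+\delta)\|f\|$ and $|\langle Jf,u\rangle-\langle f,J'u\rangle|\le\delta\|f\|\|u\|$ for $f\in L^2(X_0)$, $u\in L^2(X_\varepsilon)$; $\|f-J'Jf\|\le\delta\|f\|_{H^1}$, $\|u-JJ'u\|\le\delta\|u\|_{H^1}$,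 $\|J^1f-Jf\|\le\delta\|f\|_{H^1}$, $\|J'^1u-J'u\|\le\delta\|u\|_{H^1}$ for $f\in H^1_0(X_0)$, $u\in H^1_0(X_\varepsilon)$; and $|\tilde{\mathfrak d}(J^1f,u)-\mathfrak d(f,J'^1u)|\le\delta\,\|(\Delta_{X_0}+1)f\|\,\|u\|_{H^1}$ for $f\in\operatorname{dom}\Delta_{X_0}$, $u\in H^1_0(X_\varepsilon)$. -/

import Mathlib

open MeasureTheory Bundle Set Filter
open scoped Manifold ContDiff ENNReal NNReal Topology

noncomputable section

/-! ### Energy forms and quasi-unitary equivalence -/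

section Abstract

/-- A closed non-negative quadratic form in the Hilbert space `H`, presented by its domain `V`,
which is a Hilbert space for the energy norm, `‖f‖_V ^ 2 = ‖ι f‖_H ^ 2 + form f f`, and by the
inclusion `ι` of the domain into `H` (density of the range and injectivity of `ι` are not used in
the definitions below). As in Mathlib, sesquilinear forms are conjugate linear in the first
argument. -/
structure EnergyForm (V H : Type*) [NormedAddCommGroup V] [InnerProductSpace ℂ V]
    [CompleteSpace V] [NormedAddCommGroup H] [InnerProductSpace ℂ H] where
  /-- the inclusion of the form domain -/
  ι : V →L[ℂ] H
  /-- the sesquilinear form -/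
  form : V →L⋆[ℂ] V →L[ℂ] ℂ
  inner_eq : ∀ f g : V, inner ℂ f g = inner ℂ (ι f) (ι g) + form f g
  nonneg : ∀ f : V, 0 ≤ (form f f).re

variable {V H V' H' : Type*}
  [NormedAddCommGroup V] [InnerProductSpace ℂ V] [CompleteSpace V]
  [NormedAddCommGroup H] [InnerProductSpace ℂ H]
  [NormedAddCommGroup V'] [InnerProductSpace ℂ V'] [CompleteSpace V']
  [NormedAddCommGroup H'] [InnerProductSpace ℂ H']

/-- `f` is in the domain of the self-adjoint operator `Δ` associated with the energy form `d`,
and `Δ f = h`. -/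
def EnergyForm.IsOperatorValue (d : EnergyForm V H) (f : V) (h : H) : Prop :=
  ∀ v : V, d.form f v = inner ℂ h (d.ι v)

/-- `δ`-quasi-unitary equivalence of order `2` of two energy forms. The norm of order `1` is the
energy norm, i.e. the norm of the form domain, and the norm of order `2` of `f` in the domain of
`Δ` is `‖(Δ + 1) f‖`. -/
def QuasiUnitarilyEquivalentOfOrderTwo (d : EnergyForm V H) (d' : EnergyForm V' H') (δ : ℝ) :
    Prop :=
  0 ≤ δ ∧
  ∃ (J : H →L[ℂ] H') (J' : H' →L[ℂ] H) (J₁ : V →L[ℂ] V') (J₁' : V' →L[ℂ] V),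
    -- `J` is `δ`-quasi-unitary with `δ`-quasi-adjoint `J'`
    (∀ f : H, ‖J f‖ ≤ (1 + δ) * ‖f‖) ∧
    (∀ (f : H) (u : H'), ‖inner ℂ (J f) u - inner ℂ f (J' u)‖ ≤ δ * ‖f‖ * ‖u‖) ∧
    (∀ f : V, ‖d.ι f - J' (J (d.ι f))‖ ≤ δ * ‖f‖) ∧
    (∀ u : V', ‖d'.ι u - J (J' (d'.ι u))‖ ≤ δ * ‖u‖) ∧
    -- `J₁` and `J₁'` are `δ`-compatible with `J` and `J'`
    (∀ f : V, ‖d'.ι (J₁ f) - J (d.ι f)‖ ≤ δ * ‖f‖) ∧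
    (∀ u : V', ‖d.ι (J₁' u) - J' (d'.ι u)‖ ≤ δ * ‖u‖) ∧
    -- the energy forms are `δ`-close of order `2`
    (∀ (f : V) (h : H), d.IsOperatorValue f h →
      ∀ u : V', ‖d'.form (J₁ f) u - d.form f (J₁' u)‖ ≤ δ * ‖h + d.ι f‖ * ‖u‖)

end Abstract

/-! ### The Riemannian measure and an orthonormal frame

Throughout, `X` is a Riemannian manifold of dimension `m`. -/

section Manifold

set_option linter.unusedSectionVars false

variable (m : ℕ) {X : Type*}

section Charts

variable [TopologicalSpace X] [ChartedSpace (EuclideanSpace ℝ (Fin m)) X]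
  [IsManifold (𝓡 m) ∞ X]

/-- The `i`-th coordinate vector field `∂_i` of the chart centred at `p`, at a point `x` of the
domain of this chart. -/
def coordVec (p x : X) (i : Fin m) : TangentSpace (𝓡 m) x :=
  (trivializationAt (EuclideanSpace ℝ (Fin m)) (TangentSpace (𝓡 m) : X → Type _) p).symmL ℝ x
    (EuclideanSpace.single i 1)

/-- There is a countably valued measurable choice of charts covering the manifold. -/
theorem exists_measurable_chart_choice [SecondCountableTopology X] [MeasurableSpace X]
    [BorelSpace X] :
    ∃ c : X → X, (∀ x, x ∈ (chartAt (EuclideanSpace ℝ (Fin m)) (c x)).source) ∧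
      (range c).Countable ∧ ∀ p, MeasurableSet (c ⁻¹' {p}) := by
  classical
  rcases isEmpty_or_nonempty X with hX | hX
  · exact ⟨id, fun x => (hX.false x).elim, Set.to_countable _, fun p => (hX.false p).elim⟩
  obtain ⟨s, hs, hsU⟩ := TopologicalSpace.countable_cover_nhds
    (fun x : X => chart_source_mem_nhds (EuclideanSpace ℝ (Fin m)) x)
  have hne : s.Nonempty := by
    obtain ⟨x⟩ := hX
    have hx : x ∈ ⋃ p ∈ s, (chartAt (EuclideanSpace ℝ (Fin m)) p).source := by
      rw [hsU]; trivial
    simp only [mem_iUnion] at hx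
    obtain ⟨p, hp, -⟩ := hx
    exact ⟨p, hp⟩
  obtain ⟨q, hq⟩ := hs.exists_eq_range hne
  have hcov : ∀ x, ∃ n, x ∈ (chartAt (EuclideanSpace ℝ (Fin m)) (q n)).source := by
    intro x
    have hx : x ∈ ⋃ p ∈ s, (chartAt (EuclideanSpace ℝ (Fin m)) p).source := by
      rw [hsU]; trivial
    simp only [mem_iUnion] at hx
    obtain ⟨p, hp, hxp⟩ := hx
    rw [hq] at hp
    obtain ⟨n, rfl⟩ := hp
    exact ⟨n, hxp⟩
  refine ⟨fun x => q (Nat.find (hcov x)), fun x => Nat.find_spec (hcov x),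
    (countable_range q).mono ?_, fun p => ?_⟩
  · rintro _ ⟨x, rfl⟩
    exact mem_range_self _
  · have hN : Measurable fun x => Nat.find (hcov x) :=
      measurable_find hcov fun n =>
        (chartAt (EuclideanSpace ℝ (Fin m)) (q n)).open_source.measurableSet
    exact hN (Set.to_countable (q ⁻¹' {p})).measurableSet

/-- A countably valued measurable choice of a chart around each point. -/
def chartChoice [SecondCountableTopology X] [MeasurableSpace X] [BorelSpace X] : X → X :=
  (exists_measurable_chart_choice m (X := X)).choose

variable [RiemannianBundle (fun x : X => TangentSpace (𝓡 m) x)]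

/-- The matrix `g_ij = ⟨∂_i, ∂_j⟩` of the metric in the chart centred at `p`. -/
def metricMatrix (p x : X) : Matrix (Fin m) (Fin m) ℝ :=
  Matrix.of fun i j => inner ℝ (coordVec m p x i) (coordVec m p x j)

/-- The metric matrix as a function of the coordinates. -/
def metricInChart (p : X) (y : EuclideanSpace ℝ (Fin m)) : Matrix (Fin m) (Fin m) ℝ :=
  metricMatrix m p ((chartAt (EuclideanSpace ℝ (Fin m)) p).symm y)

/-- The Riemannian measure of the domain of the chart centred at `p`:
`√(det g_ij) dy` in the coordinates. -/
def chartVolume [MeasurableSpace X] (p : X) : Measure X :=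
  ((volume.restrict (chartAt (EuclideanSpace ℝ (Fin m)) p).target).withDensity
    fun y => ENNReal.ofReal (Real.sqrt (metricInChart m p y).det)).map
      (chartAt (EuclideanSpace ℝ (Fin m)) p).symm

/-- The Riemannian measure of `X`, glued together from its restrictions to the chart domains
(these coincide on overlaps, so that their supremum restricts to each of them). -/
def riemannianVolume [MeasurableSpace X] : Measure X := ⨆ p : X, chartVolume m p

/-- The partial derivative `∂_l g_ij`. -/
def metricPartial (p : X) (l i j : Fin m) (y : EuclideanSpace ℝ (Fin m)) : ℝ :=
  fderiv ℝ (fun z => metricInChart m p z i j) y (EuclideanSpace.single l 1)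

/-- The Christoffel symbols `Γ^k_ij` of the Levi-Civita connection. -/
def christoffel (p : X) (k i j : Fin m) (y : EuclideanSpace ℝ (Fin m)) : ℝ :=
  (1 / 2) * ∑ l, (metricInChart m p y)⁻¹ k l *
    (metricPartial m p i j l y + metricPartial m p j i l y - metricPartial m p l i j y)

variable [SecondCountableTopology X] [MeasurableSpace X] [BorelSpace X]

/-- A measurable orthonormal frame: Gram-Schmidt applied to the coordinate vector fields. -/
def frame (x : X) : Fin m → TangentSpace (𝓡 m) x :=
  InnerProductSpace.gramSchmidtNormed ℝ (coordVec m (chartChoice m x) x)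

/-- The components of a complex covector in the orthonormal frame. Their Euclidean norm is the
norm of the covector with respect to the metric. -/
def covectorComponents (x : X) (w : TangentSpace (𝓡 m) x →L[ℝ] ℂ) : EuclideanSpace ℂ (Fin m) :=
  WithLp.toLp 2 fun i => w (frame m x i)

/-- The components of a complex `2`-tensor in the orthonormal frame. Their Euclidean norm is the
norm of the tensor with respect to the metric. -/
def tensorComponents (x : X) (t : TangentSpace (𝓡 m) x →L[ℝ] TangentSpace (𝓡 m) x →L[ℝ] ℂ) :
    EuclideanSpace ℂ (Fin m × Fin m) :=
  WithLp.toLp 2 fun i => t (frame m x i.1) (frame m x i.2)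

/-- The differential `dφ` of a function. -/
def differential (φ : X → ℂ) (x : X) : TangentSpace (𝓡 m) x →L[ℝ] ℂ :=
  mfderiv (𝓡 m) 𝓘(ℝ, ℂ) φ x

/-- The differential in the orthonormal frame. -/
def differentialComponents (φ : X → ℂ) (x : X) : EuclideanSpace ℂ (Fin m) :=
  covectorComponents m x (differential m φ x)

/-! ### The Dirichlet energy form -/

/-- Smooth functions with compact support in `U`. -/
structure IsTestFunction (U : Set X) (φ : X → ℂ) : Prop where
  smooth : ContMDiff (𝓡 m) 𝓘(ℝ, ℂ) ∞ φ
  compact : HasCompactSupport φ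
  supp : tsupport φ ⊆ U

theorem IsTestFunction.mdifferentiableAt {U : Set X} {φ : X → ℂ} (h : IsTestFunction m U φ)
    (x : X) : MDifferentiableAt (𝓡 m) 𝓘(ℝ, ℂ) φ x :=
  h.smooth.mdifferentiableAt (by simp)

theorem differentialComponents_zero (x : X) :
    differentialComponents m (fun _ : X => (0 : ℂ)) x = 0 := by
  ext i
  simp only [differentialComponents, covectorComponents, differential, mfderiv_const]
  rfl

theorem differentialComponents_add {φ ψ : X → ℂ} {x : X}
    (h : MDifferentiableAt (𝓡 m) 𝓘(ℝ, ℂ) φ x) (h' : MDifferentiableAt (𝓡 m) 𝓘(ℝ, ℂ) ψ x) :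
    differentialComponents m (φ + ψ) x =
      differentialComponents m φ x + differentialComponents m ψ x := by
  ext i
  simp only [differentialComponents, covectorComponents, differential, PiLp.add_apply]
  rw [mfderiv_add h h']
  rfl

theorem differentialComponents_const_smul (c : ℂ) {φ : X → ℂ} {x : X}
    (h : MDifferentiableAt (𝓡 m) 𝓘(ℝ, ℂ) φ x) :
    differentialComponents m (c • φ) x = c • differentialComponents m φ x := by
  ext i
  have key : HasMFDerivAt (𝓡 m) 𝓘(ℝ, ℂ) (c • φ) x
      (((c • ContinuousLinearMap.id ℝ ℂ : ℂ →L[ℝ] ℂ)).comp (mfderiv (𝓡 m) 𝓘(ℝ, ℂ) φ x)) :=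
    HasMFDerivAt.comp (I' := 𝓘(ℝ, ℂ)) (g := fun z : ℂ => c • z) x
      (((c • ContinuousLinearMap.id ℝ ℂ : ℂ →L[ℝ] ℂ)).hasFDerivAt.hasMFDerivAt) h.hasMFDerivAt
  simp only [differentialComponents, covectorComponents, differential, PiLp.smul_apply]
  rw [key.mfderiv]
  rfl

/-- `L²(U)`. -/
abbrev L2 (U : Set X) : Type _ := Lp ℂ 2 ((riemannianVolume m (X := X)).restrict U)

/-- `L²(T*U)`, in terms of the components in the orthonormal frame. -/
abbrev L2Form (U : Set X) : Type _ :=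
  Lp (EuclideanSpace ℂ (Fin m)) 2 ((riemannianVolume m (X := X)).restrict U)

/-- The Hilbert space sum of `L²(U)` and `L²(T*U)`. -/
abbrev L2Pair (U : Set X) : Type _ := WithLp 2 (L2 m U × L2Form m U)

/-- The space of all pairs `(φ, dφ)` with a test function `φ`. The norm of such a pair is the
energy norm `(‖φ‖² + ‖dφ‖²)^(1/2)`. -/
def testPairs (U : Set X) : Submodule ℂ (L2Pair m U) where
  carrier := {z | ∃ φ : X → ℂ, IsTestFunction m U φ ∧
    z.fst =ᵐ[(riemannianVolume m).restrict U] φ ∧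
    z.snd =ᵐ[(riemannianVolume m).restrict U] differentialComponents m φ}
  zero_mem' := by
    refine ⟨fun _ => 0, ⟨contMDiff_const, HasCompactSupport.zero, ?_⟩, ?_, ?_⟩
    · have : tsupport (fun _ : X => (0 : ℂ)) = ∅ := tsupport_eq_empty_iff.2 rfl
      rw [this]; exact empty_subset _
    · exact Lp.coeFn_zero _ _ _
    · refine (Lp.coeFn_zero _ _ _).trans (Eventually.of_forall fun x => ?_)
      exact (differentialComponents_zero m x).symm
  add_mem' := by
    rintro z z' ⟨φ, hφ, h1, h2⟩ ⟨ψ, hψ, h1', h2'⟩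
    refine ⟨φ + ψ, ⟨hφ.smooth.add hψ.smooth, hφ.compact.add hψ.compact, ?_⟩, ?_, ?_⟩
    · exact (tsupport_add φ ψ).trans (union_subset hφ.supp hψ.supp)
    · exact (Lp.coeFn_add _ _).trans (h1.add h1')
    · refine (Lp.coeFn_add _ _).trans ((h2.add h2').trans (Eventually.of_forall fun x => ?_))
      exact (differentialComponents_add m (hφ.mdifferentiableAt m x)
        (hψ.mdifferentiableAt m x)).symm
  smul_mem' := by
    rintro c z ⟨φ, hφ, h1, h2⟩
    refine ⟨c • φ, ⟨?_, ?_, ?_⟩, ?_, ?_⟩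
    · exact ((c • ContinuousLinearMap.id ℝ ℂ : ℂ →L[ℝ] ℂ)).contDiff.contMDiff.comp hφ.smooth
    · exact hφ.compact.smul_left (f := fun _ => c)
    · exact (tsupport_smul_subset_right (fun _ => c) φ).trans hφ.supp
    · exact (Lp.coeFn_smul _ _).trans (h1.const_smul c)
    · refine (Lp.coeFn_smul _ _).trans ((h2.const_smul c).trans (Eventually.of_forall fun x => ?_))
      exact (differentialComponents_const_smul m c (hφ.mdifferentiableAt m x)).symm

/-- The Sobolev space `H¹₀(U)`: the closure of the smooth functions with compact support in `U`
with respect to the energy norm. An element is a function together with its differential. -/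
def sobolevZero (U : Set X) : Submodule ℂ (L2Pair m U) := (testPairs m U).topologicalClosure

instance (U : Set X) : CompleteSpace (sobolevZero m U) :=
  (Submodule.isClosed_topologicalClosure (testPairs m U)).completeSpace_coe

/-- The inclusion of `H¹₀(U)` into `L²(U)`. -/
def sobolevInclusion (U : Set X) : sobolevZero m U →L[ℂ] L2 m U :=
  (WithLp.fstL 2 ℂ (L2 m U) (L2Form m U)).comp (sobolevZero m U).subtypeL

/-- The differential on `H¹₀(U)`. -/
def sobolevDifferential (U : Set X) : sobolevZero m U →L[ℂ] L2Form m U :=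
  (WithLp.sndL 2 ℂ (L2 m U) (L2Form m U)).comp (sobolevZero m U).subtypeL

/-- The Dirichlet energy form of `U`, i.e. `(u, v) ↦ ∫_U ⟨du, dv⟩` on `H¹₀(U)`. -/
def dirichletForm (U : Set X) : EnergyForm (sobolevZero m U) (L2 m U) where
  ι := sobolevInclusion m U
  form := (innerSL ℂ : L2Form m U →L⋆[ℂ] L2Form m U →L[ℂ] ℂ).bilinearComp
    (sobolevDifferential m U) (sobolevDifferential m U)
  inner_eq f g := WithLp.prod_inner_apply f.1 g.1
  nonneg f := inner_self_nonneg (𝕜 := ℂ) (x := sobolevDifferential m U f)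

/-! ### The Sobolev space of order two -/

/-- `v` is the `i`-th weak partial derivative of `u` on the open subset `V` of `ℝ^m`. -/
def HasWeakPartial (V : Set (EuclideanSpace ℝ (Fin m))) (i : Fin m)
    (u v : EuclideanSpace ℝ (Fin m) → ℂ) : Prop :=
  LocallyIntegrableOn u V ∧ LocallyIntegrableOn v V ∧
  ∀ ψ : EuclideanSpace ℝ (Fin m) → ℝ, ContDiff ℝ ∞ ψ → HasCompactSupport ψ → tsupport ψ ⊆ V →
    ∫ y, fderiv ℝ ψ y (EuclideanSpace.single i 1) • u y = -∫ y, ψ y • v y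

/-- On the open set `U`, the function `u` has the weak differential `w` and the weak second
covariant derivative `t = ∇ w`. In charts, `w_i = ∂_i u` and
`t_ij = ∂_i w_j - ∑_k Γ^k_ij w_k`. -/
def HasWeakHessian (U : Set X) (u : X → ℂ) (w : ∀ x : X, TangentSpace (𝓡 m) x →L[ℝ] ℂ)
    (t : ∀ x : X, TangentSpace (𝓡 m) x →L[ℝ] TangentSpace (𝓡 m) x →L[ℝ] ℂ) : Prop :=
  ∀ p : X,
    let e := chartAt (EuclideanSpace ℝ (Fin m)) p
    let V := e.target ∩ e.symm ⁻¹' U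
    let wc : Fin m → EuclideanSpace ℝ (Fin m) → ℂ :=
      fun i y => w (e.symm y) (coordVec m p (e.symm y) i)
    let tc : Fin m → Fin m → EuclideanSpace ℝ (Fin m) → ℂ :=
      fun i j y => t (e.symm y) (coordVec m p (e.symm y) i) (coordVec m p (e.symm y) j)
    (∀ i, HasWeakPartial m V i (fun y => u (e.symm y)) (wc i)) ∧
    ∀ i j, HasWeakPartial m V i (wc j)
      (fun y => tc i j y + ∑ k, (christoffel m p k i j y : ℂ) * wc k y)

/-- The norm of `H²(U)`, `(‖u‖² + ‖∇u‖² + ‖∇²u‖²)^(1/2)`. -/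
def sobolevTwoNorm (U : Set X) (u : X → ℂ) (w : ∀ x : X, TangentSpace (𝓡 m) x →L[ℝ] ℂ)
    (t : ∀ x : X, TangentSpace (𝓡 m) x →L[ℝ] TangentSpace (𝓡 m) x →L[ℝ] ℂ) : ℝ≥0∞ :=
  (eLpNorm u 2 ((riemannianVolume m).restrict U) ^ 2 +
    eLpNorm (fun x => covectorComponents m x (w x)) 2 ((riemannianVolume m).restrict U) ^ 2 +
    eLpNorm (fun x => tensorComponents m x (t x)) 2 ((riemannianVolume m).restrict U) ^ 2) ^
    (1 / 2 : ℝ)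

/-- `u` is in `H²(U)`, with weak covariant derivatives `∇u = w` and `∇²u = t`. -/
def IsSobolevTwo (U : Set X) (u : X → ℂ) (w : ∀ x : X, TangentSpace (𝓡 m) x →L[ℝ] ℂ)
    (t : ∀ x : X, TangentSpace (𝓡 m) x →L[ℝ] TangentSpace (𝓡 m) x →L[ℝ] ℂ) : Prop :=
  HasWeakHessian m U u w t ∧ sobolevTwoNorm m U u w t < ⊤

/-! ### Solidifying obstacles -/

/-- `‖u‖_{L²(A)} ≤ δ ‖u‖_{H¹(U)}` for all `u ∈ H¹₀(U)`. -/
def NonConcentrating (A U : Set X) (δ : ℝ) : Prop :=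
  ∀ u : sobolevZero m U,
    eLpNorm (sobolevInclusion m U u) 2 ((riemannianVolume m).restrict A) ≤
      ENNReal.ofReal (δ * ‖u‖)

/-- `‖df‖_{L²(A)} ≤ δ ‖f‖_{H²(U)}` for all `f ∈ H²(U)`. -/
def NonConcentratingOfOrderTwo (A U : Set X) (δ : ℝ) : Prop :=
  ∀ (f : X → ℂ) (w : ∀ x : X, TangentSpace (𝓡 m) x →L[ℝ] ℂ)
    (t : ∀ x : X, TangentSpace (𝓡 m) x →L[ℝ] TangentSpace (𝓡 m) x →L[ℝ] ℂ),
    IsSobolevTwo m U f w t →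
      eLpNorm (fun x => covectorComponents m x (w x)) 2 ((riemannianVolume m).restrict A) ≤
        ENNReal.ofReal δ * sobolevTwoNorm m U f w t

/-- Elliptic regularity of `U` with constant `C`: every `f` in the domain of the Dirichlet
Laplacian `Δ` of `U` is in `H²(U)`, and `‖f‖_{H²(U)} ≤ C ‖(Δ + 1) f‖_{L²(U)}`. -/
def EllipticallyRegular (U : Set X) (C : ℝ) : Prop :=
  ∀ (f : sobolevZero m U) (h : L2 m U), (dirichletForm m U).IsOperatorValue f h →
    ∃ (w : ∀ x : X, TangentSpace (𝓡 m) x →L[ℝ] ℂ)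
      (t : ∀ x : X, TangentSpace (𝓡 m) x →L[ℝ] TangentSpace (𝓡 m) x →L[ℝ] ℂ),
      IsSobolevTwo m U (sobolevInclusion m U f) w t ∧
      sobolevTwoNorm m U (sobolevInclusion m U f) w t ≤
        ENNReal.ofReal (C * ‖h + sobolevInclusion m U f‖)

/-- The differential of a real function, in the orthonormal frame. -/
def realDifferential (χ : X → ℝ) : X → EuclideanSpace ℂ (Fin m) :=
  differentialComponents m fun x => (χ x : ℂ)

/-- The support of the almost everywhere defined `1`-form `dχ`. -/
def differentialSupport (χ : X → ℝ) : Set X :=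
  ((riemannianVolume m).restrict {x | realDifferential m χ x ≠ 0}).support

/-- The norm `‖dχ‖_∞`. -/
def differentialSupNorm (χ : X → ℝ) : ℝ :=
  (eLpNorm (realDifferential m χ) ⊤ (riemannianVolume m)).toReal

/-- The annulus region of the cut-off function `χ` outside `S`. -/
def annulus (S : Set X) (χ : X → ℝ) : Set X := differentialSupport m χ \ S

end Charts

variable [EMetricSpace X] [ChartedSpace (EuclideanSpace ℝ (Fin m)) X] [IsManifold (𝓡 m) ∞ X]
  [RiemannianBundle (fun x : X => TangentSpace (𝓡 m) x)]
  [SecondCountableTopology X] [MeasurableSpace X] [BorelSpace X]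

/-- The obstacles `B ε`, `0 < ε ≤ ε₀`, are Dirichlet-asymptotically solidifying towards `S`, with
cut-off functions `χ ε`, non-concentration rates `δ' ε` and `δ'' ε`, spectral rate `δbar ε` and
constant `C` of elliptic regularity. Here `X ∖ S` is `Sᶜ`, and `X ∖ B ε` is `(B ε)ᶜ`. -/
structure IsDirichletSolidifying (ε₀ : ℝ) (B : ℝ → Set X) (S : Set X) (χ : ℝ → X → ℝ)
    (δ' δ'' δbar : ℝ → ℝ) (C : ℝ) : Prop where
  isClosed_obstacle : ∀ ε ∈ Ioc 0 ε₀, IsClosed (B ε)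
  isClosed_limit : IsClosed S
  -- the cut-off functions
  lipschitz : ∀ ε ∈ Ioc 0 ε₀, ∃ K : ℝ≥0, LipschitzWith K (χ ε)
  range_cutoff : ∀ ε ∈ Ioc 0 ε₀, ∀ x, χ ε x ∈ Icc (0 : ℝ) 1
  cutoff_eq_zero : ∀ ε ∈ Ioc 0 ε₀, ∀ x ∈ S, χ ε x = 0
  cutoff_eq_one : ∀ ε ∈ Ioc 0 ε₀, ∀ x ∉ S, x ∉ annulus m S (χ ε) → χ ε x = 1
  -- the non-concentrating property
  rate_nonneg : ∀ ε ∈ Ioc 0 ε₀, 0 ≤ δ' ε ∧ 0 ≤ δ'' ε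
  nonConcentrating : ∀ ε ∈ Ioc 0 ε₀,
    NonConcentrating m (annulus m S (χ ε)) (B ε)ᶜ (δ' ε)
  tendsto_rate : Tendsto δ' (𝓝[>] 0) (𝓝 0)
  nonConcentrating_two : ∀ ε ∈ Ioc 0 ε₀,
    NonConcentratingOfOrderTwo m (annulus m S (χ ε)) Sᶜ (δ'' ε)
  tendsto_rate_two : Tendsto δ'' (𝓝[>] 0) (𝓝 0)
  -- elliptic regularity
  one_le_const : 1 ≤ C
  ellipticallyRegular : EllipticallyRegular m Sᶜ C
  -- the obstacles are spectrally solidifying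
  obstacle_subset : ∀ ε ∈ Ioc 0 ε₀, B ε ⊆ S
  null_boundary : ∀ ε ∈ Ioc 0 ε₀, riemannianVolume m (frontier S \ B ε) = 0
  spectral : ∀ ε ∈ Ioc 0 ε₀, NonConcentrating m (interior S \ B ε) (B ε)ᶜ (δbar ε)
  tendsto_spectral : Tendsto δbar (𝓝[>] 0) (𝓝 0)
  -- the cut-off functions have moderate decay
  moderate_decay :
    Tendsto (fun ε => δ' ε * δ'' ε * differentialSupNorm m (χ ε)) (𝓝[>] 0) (𝓝 0)

end Manifold

end

/-! Write `U = X ∖ S` and `V = X ∖ B ε`, so `U ⊆ V`. The identification operators are the natural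
ones: `J` is extension by zero, `J'` is restriction to `U`, `J₁` is extension by zero on `H¹₀(U)`,
and `J₁'` is multiplication by the cut-off function `χ` followed by restriction to `U`. Then `J` is
an isometry with adjoint `J'`, `J'J` is the identity, and `J₁` is compatible with `J` without error.
Three estimates remain.

The difference `u - JJ'u` is `u` on `S ∖ B ε`, which is `interior S ∖ B ε` up to a null set;
spectral solidification bounds it by `δbar`. The difference `J₁'u - J'u = (χ - 1)u` lives on the
annulus `A`, where non-concentration bounds it by `δ'`. The difference of the forms is the inner
product over `U` of `df` with `(1 - χ) du - u dχ`. The second factor vanishes off `A`, and its norm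
there is at most `(1 + δ' ‖dχ‖_∞) ‖u‖`. Non-concentration of order two and elliptic regularity bound
`df` on `A` by `δ'' C ‖(Δ + 1) f‖`. The product of the two bounds is the third term of the maximum.

Two facts carry the analytic weight. First, `χ u` lies in `H¹₀(U)` and the Leibniz rule holds
(`exists_sobolevCutoff`), although `χ` is only Lipschitz, vanishes on `S` without being supported
away from it, and `H¹₀` is a closure of smooth functions. By density `u` may be a test function. The
truncations `max (χ - η) 0` have support away from `S`; a partition of unity localizes to charts,
where mollification gives smooth approximations, and Rademacher's theorem and dominated convergence
give the limits.

Second, the differential of an element of `H¹₀`, which is a limit of classical differentials, must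
be the weak differential occurring in the definition of `H²`
(`snd_eq_covectorComponents_of_hasWeakPartial`). Integration by parts in charts passes to `L²`
limits, and weak derivatives are unique. Both facts rest on the description of the Riemannian
measure in charts and on the measurability of the orthonormal frame. -/

noncomputable section

/-! ### Derivatives, metric and orthonormal frame in charts -/

section ChartCalculus

set_option linter.unusedSectionVars false

variable (m : ℕ) {X : Type*} [TopologicalSpace X] [ChartedSpace (EuclideanSpace ℝ (Fin m)) X]
  [IsManifold (𝓡 m) ∞ X]

/-- The coordinate vector fields, assembled to a linear map. -/
def coordMap (p x : X) : EuclideanSpace ℝ (Fin m) →L[ℝ] TangentSpace (𝓡 m) x :=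
  (trivializationAt (EuclideanSpace ℝ (Fin m)) (TangentSpace (𝓡 m) : X → Type _) p).symmL ℝ x

/-- The coordinates of a tangent vector. -/
def coordMapInv (p x : X) : TangentSpace (𝓡 m) x →L[ℝ] EuclideanSpace ℝ (Fin m) :=
  (trivializationAt (EuclideanSpace ℝ (Fin m)) (TangentSpace (𝓡 m) : X → Type _) p).continuousLinearMapAt ℝ x

theorem coordVec_eq_coordMap (p x : X) (i : Fin m) :
    coordVec m p x i = coordMap m p x (EuclideanSpace.single i 1) := rfl

theorem coordMap_of_notMem {p x : X} (h : x ∉ (chartAt (EuclideanSpace ℝ (Fin m)) p).source) :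
    coordMap m p x = 0 := by
  ext v
  refine (trivializationAt (EuclideanSpace ℝ (Fin m)) (TangentSpace (𝓡 m) : X → Type _) p).symmL_apply_of_notMem ?_ v
  simpa using h

theorem coordVec_of_notMem {p x : X} (h : x ∉ (chartAt (EuclideanSpace ℝ (Fin m)) p).source)
    (i : Fin m) : coordVec m p x i = 0 := by
  rw [coordVec_eq_coordMap, coordMap_of_notMem m h]; rfl

theorem coordMapInv_coordMap {p x : X} (h : x ∈ (chartAt (EuclideanSpace ℝ (Fin m)) p).source)
    (v : EuclideanSpace ℝ (Fin m)) : coordMapInv m p x (coordMap m p x v) = v :=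
  (trivializationAt (EuclideanSpace ℝ (Fin m)) (TangentSpace (𝓡 m) : X → Type _) p).continuousLinearMapAt_symmL (by simpa using h) v

theorem coordMap_coordMapInv {p x : X} (h : x ∈ (chartAt (EuclideanSpace ℝ (Fin m)) p).source)
    (v : TangentSpace (𝓡 m) x) : coordMap m p x (coordMapInv m p x v) = v :=
  (trivializationAt (EuclideanSpace ℝ (Fin m)) (TangentSpace (𝓡 m) : X → Type _) p).symmL_continuousLinearMapAt (by simpa using h) v

/-- Over a chart domain the trivialization of the tangent bundle is the derivative of the chart.
This links the algebraic `coordMap` with calculus in coordinates. -/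
theorem hasMFDerivAt_chart_symm {p : X} {y : EuclideanSpace ℝ (Fin m)}
    (h : y ∈ (chartAt (EuclideanSpace ℝ (Fin m)) p).target) :
    HasMFDerivAt 𝓘(ℝ, EuclideanSpace ℝ (Fin m)) (𝓡 m) (chartAt (EuclideanSpace ℝ (Fin m)) p).symm
      y (coordMap m p ((chartAt (EuclideanSpace ℝ (Fin m)) p).symm y)) := by
  have hx := (chartAt (EuclideanSpace ℝ (Fin m)) p).map_target h
  have h1 := TangentBundle.symmL_trivializationAt (I := 𝓡 m) (𝕜 := ℝ) hx
  simp only [mfld_simps, mfderivWithin_univ] at h1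
  rw [(chartAt (EuclideanSpace ℝ (Fin m)) p).right_inv h] at h1
  have h2 : coordMap m p ((chartAt (EuclideanSpace ℝ (Fin m)) p).symm y) =
    mfderiv 𝓘(ℝ, EuclideanSpace ℝ (Fin m)) (𝓡 m) (chartAt (EuclideanSpace ℝ (Fin m)) p).symm y := h1
  rw [h2]
  exact (mdifferentiableAt_atlas_symm (I := 𝓡 m) (chart_mem_atlas _ p) h).hasMFDerivAt

theorem hasMFDerivAt_chart {p x : X}
    (h : x ∈ (chartAt (EuclideanSpace ℝ (Fin m)) p).source) :
    HasMFDerivAt (𝓡 m) 𝓘(ℝ, EuclideanSpace ℝ (Fin m)) (chartAt (EuclideanSpace ℝ (Fin m)) p)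
      x (coordMapInv m p x) := by
  have h1 := TangentBundle.continuousLinearMapAt_trivializationAt (I := 𝓡 m) (𝕜 := ℝ) h
  have h2 : coordMapInv m p x =
    mfderiv (𝓡 m) 𝓘(ℝ, EuclideanSpace ℝ (Fin m)) (chartAt (EuclideanSpace ℝ (Fin m)) p) x := h1
  rw [h2]
  exact (mdifferentiableAt_atlas (I := 𝓡 m) (chart_mem_atlas _ p) h).hasMFDerivAt

variable {F : Type*} [NormedAddCommGroup F] [NormedSpace ℝ F]

theorem mdifferentiableAt_iff_chart {p : X} {y : EuclideanSpace ℝ (Fin m)}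
    (h : y ∈ (chartAt (EuclideanSpace ℝ (Fin m)) p).target) (f : X → F) :
    MDifferentiableAt (𝓡 m) 𝓘(ℝ, F) f ((chartAt (EuclideanSpace ℝ (Fin m)) p).symm y) ↔
      DifferentiableAt ℝ (f ∘ (chartAt (EuclideanSpace ℝ (Fin m)) p).symm) y := by
  set e := chartAt (EuclideanSpace ℝ (Fin m)) p
  constructor
  · intro hf
    exact (hf.comp y (hasMFDerivAt_chart_symm m h).mdifferentiableAt).differentiableAt
  · intro hf
    have hx := e.map_target h
    have h1 : MDifferentiableAt (𝓡 m) 𝓘(ℝ, F) ((f ∘ e.symm) ∘ e) (e.symm y) := by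
      refine MDifferentiableAt.comp _ ?_ (hasMFDerivAt_chart m hx).mdifferentiableAt
      rw [e.right_inv h]
      exact hf.mdifferentiableAt
    refine h1.congr_of_eventuallyEq ?_
    filter_upwards [e.open_source.mem_nhds hx] with z hz
    simp [e.left_inv hz]

/-- At points of differentiability this is the chain rule. Elsewhere both derivatives are zero by
convention, so no regularity of `f` is needed; this matters for Lipschitz cut-off functions. -/
theorem mfderiv_coordMap {p : X} {y : EuclideanSpace ℝ (Fin m)}
    (h : y ∈ (chartAt (EuclideanSpace ℝ (Fin m)) p).target) (f : X → F)
    (v : EuclideanSpace ℝ (Fin m)) :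
    mfderiv (𝓡 m) 𝓘(ℝ, F) f ((chartAt (EuclideanSpace ℝ (Fin m)) p).symm y)
      (coordMap m p ((chartAt (EuclideanSpace ℝ (Fin m)) p).symm y) v) =
      fderiv ℝ (f ∘ (chartAt (EuclideanSpace ℝ (Fin m)) p).symm) y v := by
  by_cases hf : MDifferentiableAt (𝓡 m) 𝓘(ℝ, F) f ((chartAt (EuclideanSpace ℝ (Fin m)) p).symm y)
  · have h1 := hf.hasMFDerivAt.comp y (hasMFDerivAt_chart_symm m h)
    rw [← mfderiv_eq_fderiv, h1.mfderiv]
    rfl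
  · rw [mfderiv_zero_of_not_mdifferentiableAt hf, fderiv_zero_of_not_differentiableAt]
    · rfl
    · rwa [← mdifferentiableAt_iff_chart m h]

/-- The change of coordinates between two charts. -/
theorem coordMap_eq_coordMap_fderiv {p q : X} {y : EuclideanSpace ℝ (Fin m)}
    (h : y ∈ (chartAt (EuclideanSpace ℝ (Fin m)) p).target)
    (hq : (chartAt (EuclideanSpace ℝ (Fin m)) p).symm y ∈
      (chartAt (EuclideanSpace ℝ (Fin m)) q).source) (v : EuclideanSpace ℝ (Fin m)) :
    coordMap m p ((chartAt (EuclideanSpace ℝ (Fin m)) p).symm y) v =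
      coordMap m q ((chartAt (EuclideanSpace ℝ (Fin m)) p).symm y)
        (fderiv ℝ (chartAt (EuclideanSpace ℝ (Fin m)) q ∘
          (chartAt (EuclideanSpace ℝ (Fin m)) p).symm) y v) := by
  have h1 := mfderiv_coordMap m h (F := EuclideanSpace ℝ (Fin m))
    (chartAt (EuclideanSpace ℝ (Fin m)) q) v
  rw [(hasMFDerivAt_chart m hq).mfderiv] at h1
  rw [← h1]
  exact (coordMap_coordMapInv m hq _).symm

theorem linearIndependent_coordVec {p x : X}
    (h : x ∈ (chartAt (EuclideanSpace ℝ (Fin m)) p).source) :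
    LinearIndependent ℝ (coordVec m p x) := by
  have h1 : LinearIndependent ℝ (fun i : Fin m => EuclideanSpace.single i (1 : ℝ)) := by
    have := (EuclideanSpace.basisFun (Fin m) ℝ).orthonormal.linearIndependent
    rwa [show ⇑(EuclideanSpace.basisFun (Fin m) ℝ) = fun i => EuclideanSpace.single i (1 : ℝ) from
      funext fun i => EuclideanSpace.basisFun_apply _ _ i] at this
  have h2 := h1.map' (coordMap m p x).toLinearMap (LinearMap.ker_eq_bot.2
    (Function.LeftInverse.injective (g := coordMapInv m p x) (coordMapInv_coordMap m h)))
  exact h2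

theorem coordMap_eq_sum (p x : X) (v : EuclideanSpace ℝ (Fin m)) :
    coordMap m p x v = ∑ i, v i • coordVec m p x i := by
  conv_lhs => rw [← (EuclideanSpace.basisFun (Fin m) ℝ).sum_repr v]
  simp [coordVec_eq_coordMap]

theorem continuousLinearMap_ext_coordVec {p x : X}
    (h : x ∈ (chartAt (EuclideanSpace ℝ (Fin m)) p).source)
    {w w' : TangentSpace (𝓡 m) x →L[ℝ] F} (hw : ∀ i, w (coordVec m p x i) = w' (coordVec m p x i)) :
    w = w' := by
  ext v
  rw [← coordMap_coordMapInv m h v, coordMap_eq_sum]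
  simp [hw]

variable [RiemannianBundle (fun x : X => TangentSpace (𝓡 m) x)]
  [IsContinuousRiemannianBundle (EuclideanSpace ℝ (Fin m)) (fun x : X => TangentSpace (𝓡 m) x)]

theorem continuousOn_mk_coordVec (p : X) (i : Fin m) :
    ContinuousOn (fun x => (⟨x, coordVec m p x i⟩ : TangentBundle (𝓡 m) X))
      (chartAt (EuclideanSpace ℝ (Fin m)) p).source := by
  set t := trivializationAt (EuclideanSpace ℝ (Fin m)) (TangentSpace (𝓡 m) : X → Type _) p
  have h2 : ContinuousOn (fun x : X => t.toOpenPartialHomeomorph.symm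
      (x, EuclideanSpace.single i (1 : ℝ))) (chartAt (EuclideanSpace ℝ (Fin m)) p).source := by
    refine t.toOpenPartialHomeomorph.continuousOn_symm.comp (by fun_prop) fun x hx => ?_
    rw [t.target_eq]
    exact ⟨by simpa [t] using hx, trivial⟩
  refine h2.congr fun x hx => ?_
  have hx' : x ∈ t.baseSet := by simpa [t] using hx
  refine Eq.trans ?_ (t.mk_symm hx' (EuclideanSpace.single i (1 : ℝ)))
  rw [← t.symmL_apply (R := ℝ) hx']
  rfl

theorem continuousOn_inner_coordVec (p q : X) (i j : Fin m) :
    ContinuousOn (fun x => inner ℝ (coordVec m p x i) (coordVec m q x j))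
      ((chartAt (EuclideanSpace ℝ (Fin m)) p).source ∩
        (chartAt (EuclideanSpace ℝ (Fin m)) q).source) :=
  ((continuousOn_mk_coordVec m p i).mono inter_subset_left).inner_bundle
    ((continuousOn_mk_coordVec m q j).mono inter_subset_right)

theorem continuousOn_metricMatrix (p : X) (i j : Fin m) :
    ContinuousOn (fun x => metricMatrix m p x i j)
      (chartAt (EuclideanSpace ℝ (Fin m)) p).source := by
  have h := continuousOn_inner_coordVec m p p i j
  rw [inter_self] at h
  exact h

/-- Coordinate vectors take the default value zero outside their chart domain. The inner product is
therefore continuous on an open set and zero off it, which makes it measurable on all of `X`. -/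
theorem measurable_inner_coordVec [MeasurableSpace X] [BorelSpace X] (p q : X) (i j : Fin m) :
    Measurable (fun x => inner ℝ (coordVec m p x i) (coordVec m q x j)) := by
  classical
  have h := (continuousOn_inner_coordVec m p q i j).measurable_piecewise
    (continuousOn_const (c := (0 : ℝ))) ((chartAt (EuclideanSpace ℝ (Fin m)) p).open_source.inter
      (chartAt (EuclideanSpace ℝ (Fin m)) q).open_source).measurableSet
  convert h using 1
  ext x
  by_cases hx : x ∈ (chartAt (EuclideanSpace ℝ (Fin m)) p).source
  · by_cases hx' : x ∈ (chartAt (EuclideanSpace ℝ (Fin m)) q).source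
    · simp [hx, hx']
    · simp [hx', coordVec_of_notMem m hx']
  · simp [hx, coordVec_of_notMem m hx]

theorem continuousOn_metricInChart (p : X) :
    ContinuousOn (fun y => metricInChart m p y)
      (chartAt (EuclideanSpace ℝ (Fin m)) p).target := by
  set e := chartAt (EuclideanSpace ℝ (Fin m)) p
  refine continuousOn_pi.2 fun i => continuousOn_pi.2 fun j => ?_
  exact (continuousOn_metricMatrix m p i j).comp e.continuousOn_symm e.mapsTo_symm

theorem metricMatrix_posDef {p x : X}
    (h : x ∈ (chartAt (EuclideanSpace ℝ (Fin m)) p).source) : (metricMatrix m p x).PosDef := by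
  exact Matrix.posDef_gram_of_linearIndependent (linearIndependent_coordVec m h)

/-- The Gram-Schmidt process has measurable coefficients if the Gram matrix is measurable. -/
theorem exists_measurable_gramSchmidt_coeff {Ω : Type*} [MeasurableSpace Ω] {V : Ω → Type*}
    [∀ x, NormedAddCommGroup (V x)] [∀ x, InnerProductSpace ℝ (V x)] (v : ∀ x, Fin m → V x)
    (hv : ∀ i j, Measurable fun x => (inner ℝ (v x i) (v x j) : ℝ)) (n : Fin m) :
    ∃ a : Fin m → Ω → ℝ, (∀ j, Measurable (a j)) ∧
      ∀ x, InnerProductSpace.gramSchmidt ℝ (v x) n = ∑ j, a j x • v x j := by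
  induction n using WellFoundedLT.induction with
  | ind n ih =>
  -- The vectors live in spaces that vary with `x`, so measurability is expressed through scalar
  -- coefficients. Subtracting the projections onto earlier vectors gives a recursion for them, and
  -- the induction hypothesis turns each inner product in it into entries of the Gram matrix.
  choose! a ha hav using ih
  refine ⟨fun j x => (if j = n then 1 else 0) - ∑ i ∈ Finset.Iio n,
    (inner ℝ (InnerProductSpace.gramSchmidt ℝ (v x) i) (v x n) /
      (‖InnerProductSpace.gramSchmidt ℝ (v x) i‖ ^ 2)) * a i j x, fun j => ?_, fun x => ?_⟩
  · refine measurable_const.sub (Finset.measurable_sum _ fun i hi => ?_)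
    have hi' : i < n := by simpa using hi
    refine Measurable.mul ?_ (ha i hi' j)
    refine Measurable.div ?_ ?_
    · simp only [hav i hi', sum_inner, inner_smul_left]
      exact Finset.measurable_sum _ fun k _ => (ha i hi' k).mul (hv k n)
    · simp only [← real_inner_self_eq_norm_sq, hav i hi', sum_inner, inner_smul_left, inner_sum,
        inner_smul_right]
      exact Finset.measurable_sum _ fun k _ => (ha i hi' k).mul
        (Finset.measurable_sum _ fun l _ => (ha i hi' l).mul (hv l k))
  · rw [InnerProductSpace.gramSchmidt_def]
    simp only [sub_smul, Finset.sum_sub_distrib, ite_smul, one_smul, zero_smul,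
      Finset.sum_ite_eq', Finset.mem_univ, if_true, Finset.sum_smul]
    congr 1
    rw [Finset.sum_comm]
    refine Finset.sum_congr rfl fun i hi => ?_
    have hi' : i < n := by simpa using hi
    rw [Submodule.starProjection_singleton]
    simp only [mul_smul, ← Finset.smul_sum]
    rw [← hav i hi' x]
    rfl

theorem exists_measurable_gramSchmidtNormed_coeff {Ω : Type*} [MeasurableSpace Ω] {V : Ω → Type*}
    [∀ x, NormedAddCommGroup (V x)] [∀ x, InnerProductSpace ℝ (V x)] (v : ∀ x, Fin m → V x)
    (hv : ∀ i j, Measurable fun x => (inner ℝ (v x i) (v x j) : ℝ)) (n : Fin m) :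
    ∃ a : Fin m → Ω → ℝ, (∀ j, Measurable (a j)) ∧
      ∀ x, InnerProductSpace.gramSchmidtNormed ℝ (v x) n = ∑ j, a j x • v x j := by
  obtain ⟨a, ha, hav⟩ := exists_measurable_gramSchmidt_coeff m v hv n
  refine ⟨fun j x => ‖InnerProductSpace.gramSchmidt ℝ (v x) n‖⁻¹ * a j x, fun j => ?_, fun x => ?_⟩
  · refine Measurable.mul (Measurable.inv ?_) (ha j)
    simp only [norm_eq_sqrt_real_inner]
    refine Measurable.sqrt ?_
    simp only [hav, sum_inner, inner_smul_left, inner_sum, inner_smul_right]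
    exact Finset.measurable_sum _ fun k _ => (ha k).mul
      (Finset.measurable_sum _ fun l _ => (ha l).mul (hv l k))
  · simp only [mul_smul, ← Finset.smul_sum, ← hav]
    rfl

variable [SecondCountableTopology X] [MeasurableSpace X] [BorelSpace X]

theorem mem_source_chartChoice (x : X) :
    x ∈ (chartAt (EuclideanSpace ℝ (Fin m)) (chartChoice m x)).source :=
  (exists_measurable_chart_choice m (X := X)).choose_spec.1 x

theorem countable_range_chartChoice : (range (chartChoice m (X := X))).Countable :=
  (exists_measurable_chart_choice m (X := X)).choose_spec.2.1

theorem measurableSet_chartChoice_preimage (p : X) :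
    MeasurableSet (chartChoice m (X := X) ⁻¹' {p}) :=
  (exists_measurable_chart_choice m (X := X)).choose_spec.2.2 p

/-- The fibres of `chartChoice` split `X` into countably many measurable pieces, and `f` agrees with
one `g p` on each of them. -/
theorem measurable_of_chartChoice {β : Type*} [MeasurableSpace β] {f : X → β} {g : X → X → β}
    (hg : ∀ p, Measurable (g p)) (hfg : ∀ x, f x = g (chartChoice m x) x) : Measurable f := by
  intro s hs
  have : f ⁻¹' s = ⋃ p ∈ range (chartChoice m (X := X)),
      (chartChoice m (X := X) ⁻¹' {p}) ∩ (g p ⁻¹' s) := by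
    ext x
    simp only [mem_preimage, hfg, mem_iUnion, mem_inter_iff, mem_singleton_iff, exists_prop]
    exact ⟨fun h => ⟨_, mem_range_self x, rfl, h⟩, fun ⟨p, _, h1, h2⟩ => h1 ▸ h2⟩
  rw [this]
  exact MeasurableSet.biUnion (countable_range_chartChoice m) fun p _ =>
    (measurableSet_chartChoice_preimage m p).inter (hg p hs)

theorem exists_measurable_frame_coeff (i : Fin m) :
    ∃ a : X → Fin m → X → ℝ, (∀ p j, Measurable (a p j)) ∧
      ∀ x, frame m x i = ∑ j, a (chartChoice m x) j x • coordVec m (chartChoice m x) x j := by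
  have h : ∀ p : X, _ := fun p => exists_measurable_gramSchmidtNormed_coeff m
    (fun x : X => coordVec m p x) (measurable_inner_coordVec m p p) i
  choose a ha hav using h
  exact ⟨a, ha, fun x => hav _ x⟩

theorem measurable_inner_frame_coordVec (p : X) (i j : Fin m) :
    Measurable (fun x => inner ℝ (frame m x i) (coordVec m p x j)) := by
  obtain ⟨a, ha, haf⟩ := exists_measurable_frame_coeff m (X := X) i
  refine measurable_of_chartChoice m (g := fun q x => ∑ k, a q k x *
    inner ℝ (coordVec m q x k) (coordVec m p x j)) (fun q => ?_) fun x => ?_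
  · exact Finset.measurable_sum _ fun k _ => (ha q k).mul (measurable_inner_coordVec m q p k j)
  · rw [haf]
    simp only [sum_inner, inner_smul_left]
    rfl

/-- No regularity of `φ` enters: the Fréchet derivative of an arbitrary function, with its default
value zero, is measurable in the base point. The frame contributes measurable coefficients on each
piece of the chart choice. -/
theorem measurable_differentialComponents (φ : X → ℂ) :
    Measurable (differentialComponents m φ) := by
  classical
  suffices h : Measurable fun x => (differentialComponents m φ x).ofLp from
    (PiLp.continuous_toLp 2 fun _ : Fin m => ℂ).measurable.comp h
  refine measurable_pi_iff.2 fun i => ?_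
  obtain ⟨a, ha, haf⟩ := exists_measurable_frame_coeff m (X := X) i
  let E : X → X → EuclideanSpace ℝ (Fin m) := fun p =>
    (chartAt (EuclideanSpace ℝ (Fin m)) p).source.piecewise (chartAt (EuclideanSpace ℝ (Fin m)) p)
      (fun _ => 0)
  have hE : ∀ p, Measurable (E p) := fun p =>
    (chartAt (EuclideanSpace ℝ (Fin m)) p).continuousOn.measurable_piecewise continuousOn_const
      (chartAt (EuclideanSpace ℝ (Fin m)) p).open_source.measurableSet
  refine measurable_of_chartChoice m (g := fun q x => ∑ k, (a q k x : ℂ) *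
    fderiv ℝ (φ ∘ (chartAt (EuclideanSpace ℝ (Fin m)) q).symm) (E q x)
      (EuclideanSpace.single k 1)) (fun q => ?_) fun x => ?_
  · refine Finset.measurable_sum _ fun k _ => ?_
    exact (Complex.measurable_ofReal.comp (ha q k)).mul
      ((measurable_fderiv_apply_const ℝ _ _).comp (hE q))
  · have hx := mem_source_chartChoice m x
    set q := chartChoice m x
    have hEx : E q x = chartAt (EuclideanSpace ℝ (Fin m)) q x := by simp [E, hx]
    have hd := fun k => mfderiv_coordMap m
      ((chartAt (EuclideanSpace ℝ (Fin m)) q).map_source hx) φ (EuclideanSpace.single k 1)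
    rw [(chartAt (EuclideanSpace ℝ (Fin m)) q).left_inv hx] at hd
    change mfderiv (𝓡 m) 𝓘(ℝ, ℂ) φ x (frame m x i) = _
    rw [haf, hEx, map_sum]
    refine Finset.sum_congr rfl fun k _ => ?_
    rw [← hd, map_smul]
    exact Complex.real_smul

theorem orthonormal_frame (x : X) : Orthonormal ℝ (frame m x) :=
  InnerProductSpace.gramSchmidtNormed_orthonormal
    (linearIndependent_coordVec m (mem_source_chartChoice m x))

theorem sum_inner_smul_frame (x : X) (v : TangentSpace (𝓡 m) x) :
    ∑ i, (inner ℝ (frame m x i) v : ℝ) • frame m x i = v := by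
  have hs : ⊤ ≤ Submodule.span ℝ (range (frame m x)) := by
    unfold frame
    rw [InnerProductSpace.span_gramSchmidtNormed_range, InnerProductSpace.span_gramSchmidt]
    intro w _
    rw [← coordMap_coordMapInv m (mem_source_chartChoice m x) w, coordMap_eq_sum]
    exact Submodule.sum_mem _ fun i _ => Submodule.smul_mem _ _ (Submodule.subset_span ⟨i, rfl⟩)
  have := (OrthonormalBasis.mk (orthonormal_frame m x) hs).sum_repr' v
  simpa using this

theorem apply_eq_sum_frame (x : X) (w : TangentSpace (𝓡 m) x →L[ℝ] ℂ)
    (v : TangentSpace (𝓡 m) x) :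
    w v = ∑ i, ((inner ℝ (frame m x i) v : ℝ) : ℂ) * covectorComponents m x w i := by
  conv_lhs => rw [← sum_inner_smul_frame m x v]
  simp [covectorComponents]

theorem norm_inner_frame_le (x : X) (i : Fin m) (v : TangentSpace (𝓡 m) x) :
    |(inner ℝ (frame m x i) v : ℝ)| ≤ ‖v‖ := by
  have := abs_real_inner_le_norm (frame m x i) v
  rwa [(orthonormal_frame m x).1 i, one_mul] at this

/-- The factor `√m` is crude but harmless: the bound serves only to show boundedness and
integrability, and does not enter the final rate. -/
theorem norm_covectorComponents_le (x : X) (w : TangentSpace (𝓡 m) x →L[ℝ] ℂ) {K : ℝ}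
    (hK : ∀ v, ‖w v‖ ≤ K * ‖v‖) : ‖covectorComponents m x w‖ ≤ √m * K := by
  have h : ∀ i, ‖covectorComponents m x w i‖ ≤ K := fun i => by
    simpa [(orthonormal_frame m x).1 i, covectorComponents] using hK (frame m x i)
  -- In dimension zero nothing forces `K ≥ 0`, but then the factor `√m` vanishes.
  rcases isEmpty_or_nonempty (Fin m) with hm | ⟨⟨i⟩⟩
  · rw [Subsingleton.elim (covectorComponents m x w) 0, norm_zero]
    have : m = 0 := (Fintype.card_fin m).symm.trans Fintype.card_eq_zero
    simp [this]
  have hK0 : 0 ≤ K := (norm_nonneg _).trans (h i)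
  rw [EuclideanSpace.norm_eq, ← Real.sqrt_sq hK0, ← Real.sqrt_mul (Nat.cast_nonneg m)]
  refine Real.sqrt_le_sqrt ((Finset.sum_le_sum fun i _ =>
    pow_le_pow_left₀ (norm_nonneg _) (h i) 2).trans ?_)
  simp

end ChartCalculus

/-! ### The Riemannian measure in charts -/

section RiemannianMeasure

set_option linter.unusedSectionVars false

variable (m : ℕ) {X : Type*} [TopologicalSpace X] [ChartedSpace (EuclideanSpace ℝ (Fin m)) X]
  [IsManifold (𝓡 m) ∞ X] [RiemannianBundle (fun x : X => TangentSpace (𝓡 m) x)]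
  [IsContinuousRiemannianBundle (EuclideanSpace ℝ (Fin m)) (fun x : X => TangentSpace (𝓡 m) x)]
  [MeasurableSpace X] [BorelSpace X]

/-- The density of the Riemannian measure in a chart. -/
def chartDensity (p : X) (y : EuclideanSpace ℝ (Fin m)) : ℝ := √(metricInChart m p y).det

theorem continuousOn_chartDensity (p : X) :
    ContinuousOn (chartDensity m p) (chartAt (EuclideanSpace ℝ (Fin m)) p).target :=
  (Continuous.comp_continuousOn (g := fun M : Matrix (Fin m) (Fin m) ℝ => √M.det) (by fun_prop)
    (continuousOn_metricInChart m p))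

theorem chartDensity_pos {p : X} {y : EuclideanSpace ℝ (Fin m)}
    (h : y ∈ (chartAt (EuclideanSpace ℝ (Fin m)) p).target) : 0 < chartDensity m p y :=
  Real.sqrt_pos.2 (metricMatrix_posDef m
    ((chartAt (EuclideanSpace ℝ (Fin m)) p).map_target h)).det_pos

theorem aemeasurable_chart_symm (p : X) :
    AEMeasurable (chartAt (EuclideanSpace ℝ (Fin m)) p).symm
      (volume.restrict (chartAt (EuclideanSpace ℝ (Fin m)) p).target) :=
  (chartAt (EuclideanSpace ℝ (Fin m)) p).continuousOn_symm.aemeasurable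
    (chartAt (EuclideanSpace ℝ (Fin m)) p).open_target.measurableSet

theorem ContinuousOn.measurableSet_inter_preimage' {α β : Type*} [TopologicalSpace α]
    [MeasurableSpace α] [OpensMeasurableSpace α] [TopologicalSpace β] [MeasurableSpace β]
    [BorelSpace β] {f : α → β} {s : Set α} (hf : ContinuousOn f s) (hs : MeasurableSet s)
    {A : Set β} (hA : MeasurableSet A) : MeasurableSet (s ∩ f ⁻¹' A) := by
  have h1 : Measurable fun x : s => f x := hf.domRestrict.measurable
  have h2 := hs.subtype_image (h1 hA)
  convert h2 using 1
  ext x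
  simp [and_comm]

theorem chartVolume_apply (p : X) {A : Set X} (hA : MeasurableSet A) :
    chartVolume m p A = ∫⁻ y in (chartAt (EuclideanSpace ℝ (Fin m)) p).target ∩
      (chartAt (EuclideanSpace ℝ (Fin m)) p).symm ⁻¹' A,
        ENNReal.ofReal (chartDensity m p y) := by
  set e := chartAt (EuclideanSpace ℝ (Fin m)) p
  have hm : MeasurableSet (e.target ∩ e.symm ⁻¹' A) :=
    e.continuousOn_symm.measurableSet_inter_preimage' e.open_target.measurableSet hA
  rw [chartVolume, Measure.map_apply_of_aemeasurable
    ((aemeasurable_chart_symm m p).mono_ac (withDensity_absolutelyContinuous _ _)) hA,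
    ← restrict_withDensity e.open_target.measurableSet,
    Measure.restrict_apply' e.open_target.measurableSet, inter_comm, withDensity_apply _ hm]
  rfl

/-- The metric matrices are related by `G_q = Aᵀ G_p A` with the Jacobian matrix `A` of the
transition map. Taking determinants and square roots gives the factor `|det A|`. -/
theorem chartDensity_change {p q : X} {y : EuclideanSpace ℝ (Fin m)}
    (h : y ∈ (chartAt (EuclideanSpace ℝ (Fin m)) q).target)
    (hp : (chartAt (EuclideanSpace ℝ (Fin m)) q).symm y ∈
      (chartAt (EuclideanSpace ℝ (Fin m)) p).source) :
    chartDensity m q y = |(fderiv ℝ (chartAt (EuclideanSpace ℝ (Fin m)) p ∘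
      (chartAt (EuclideanSpace ℝ (Fin m)) q).symm) y).det| *
      chartDensity m p (chartAt (EuclideanSpace ℝ (Fin m)) p
        ((chartAt (EuclideanSpace ℝ (Fin m)) q).symm y)) := by
  set e := chartAt (EuclideanSpace ℝ (Fin m)) p
  set e' := chartAt (EuclideanSpace ℝ (Fin m)) q
  set D := fderiv ℝ (e ∘ e'.symm) y
  set b := EuclideanSpace.basisFun (Fin m) ℝ
  let A : Matrix (Fin m) (Fin m) ℝ := Matrix.of fun k i => D (EuclideanSpace.single i 1) k
  have hA : A.det = D.det := by
    have : A = LinearMap.toMatrix b.toBasis b.toBasis D.toLinearMap := by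
      ext k i
      simp [A, LinearMap.toMatrix_apply, b]
    rw [this, LinearMap.det_toMatrix]
  have hG : metricInChart m q y = A.transpose * metricInChart m p (e (e'.symm y)) * A := by
    ext i j
    have hc : ∀ i, coordVec m q (e'.symm y) i = ∑ k, A k i • coordVec m p (e'.symm y) k := by
      intro i
      rw [coordVec_eq_coordMap, coordMap_eq_coordMap_fderiv m h hp, coordMap_eq_sum]
      rfl
    change inner ℝ (coordVec m q (e'.symm y) i) (coordVec m q (e'.symm y) j) = _
    rw [hc, hc]
    simp only [sum_inner, inner_sum, inner_smul_left, inner_smul_right, Matrix.mul_apply,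
      Matrix.transpose_apply, Finset.sum_mul, Finset.mul_sum]
    refine Finset.sum_congr rfl fun k _ => Finset.sum_congr rfl fun l _ => ?_
    rw [metricInChart, e.left_inv hp]
    simp only [metricMatrix, Matrix.of_apply, conj_trivial]
    ring
  rw [chartDensity, hG, Matrix.det_mul, Matrix.det_mul, Matrix.det_transpose, hA, chartDensity,
    show D.det * (metricInChart m p (e (e'.symm y))).det * D.det =
      D.det ^ 2 * (metricInChart m p (e (e'.symm y))).det by ring,
    Real.sqrt_mul (sq_nonneg _), Real.sqrt_sq_eq_abs]

/-- The transformation law of the density cancels the Jacobian in the change of variables formula.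
-/
theorem chartVolume_apply_eq (p q : X) {A : Set X} (hA : MeasurableSet A)
    (hp : A ⊆ (chartAt (EuclideanSpace ℝ (Fin m)) p).source)
    (hq : A ⊆ (chartAt (EuclideanSpace ℝ (Fin m)) q).source) :
    chartVolume m p A = chartVolume m q A := by
  rw [chartVolume_apply m p hA, chartVolume_apply m q hA]
  set e := chartAt (EuclideanSpace ℝ (Fin m)) p
  set e' := chartAt (EuclideanSpace ℝ (Fin m)) q
  have himg : e.target ∩ e.symm ⁻¹' A = (e ∘ e'.symm) '' (e'.target ∩ e'.symm ⁻¹' A) := by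
    ext y
    constructor
    · rintro ⟨hy, hyA⟩
      refine ⟨e' (e.symm y), ⟨e'.map_source (hq hyA), ?_⟩, ?_⟩
      · rwa [mem_preimage, e'.left_inv (hq hyA)]
      · rw [Function.comp_apply, e'.left_inv (hq hyA), e.right_inv hy]
    · rintro ⟨z, ⟨hz, hzA⟩, rfl⟩
      refine ⟨e.map_source (hp hzA), ?_⟩
      rwa [mem_preimage, Function.comp_apply, e.left_inv (hp hzA)]
  have hm : MeasurableSet (e'.target ∩ e'.symm ⁻¹' A) :=
    e'.continuousOn_symm.measurableSet_inter_preimage' e'.open_target.measurableSet hA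
  rw [himg, lintegral_image_eq_lintegral_abs_det_fderiv_mul volume hm
    (f' := fun y => fderiv ℝ (e ∘ e'.symm) y)]
  · refine setLIntegral_congr_fun hm fun y hy => ?_
    rw [chartDensity_change m hy.1 (hp hy.2), ENNReal.ofReal_mul (abs_nonneg _)]
    rfl
  · intro y hy
    have h1 : MDifferentiableAt (𝓡 m) 𝓘(ℝ, EuclideanSpace ℝ (Fin m)) e (e'.symm y) :=
      (hasMFDerivAt_chart m (hp hy.2)).mdifferentiableAt
    exact ((mdifferentiableAt_iff_chart m hy.1 e).1 h1).hasFDerivAt.hasFDerivWithinAt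
  · intro y hy z hz hyz
    have := e.injOn (hp hy.2) (hp hz.2) hyz
    exact e'.symm.injOn hy.1 hz.1 this

theorem chartVolume_compl_source (p : X) :
    chartVolume m p (chartAt (EuclideanSpace ℝ (Fin m)) p).sourceᶜ = 0 := by
  set e := chartAt (EuclideanSpace ℝ (Fin m)) p
  rw [chartVolume_apply m p e.open_source.measurableSet.compl]
  have : e.target ∩ e.symm ⁻¹' e.sourceᶜ = ∅ := by
    ext y
    simp only [mem_inter_iff, mem_preimage, mem_compl_iff, mem_empty_iff_false, iff_false, not_and,
      not_not]
    exact fun h => e.map_target h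
  rw [this]
  simp

theorem restrict_source_chartVolume_le (p q : X) :
    (chartVolume m q).restrict (chartAt (EuclideanSpace ℝ (Fin m)) p).source ≤
      chartVolume m p := by
  set e := chartAt (EuclideanSpace ℝ (Fin m)) p
  set e' := chartAt (EuclideanSpace ℝ (Fin m)) q
  refine Measure.le_iff.2 fun A hA => ?_
  rw [Measure.restrict_apply hA]
  calc chartVolume m q (A ∩ e.source)
      ≤ chartVolume m q (A ∩ e.source ∩ e'.source) + chartVolume m q e'.sourceᶜ := by
        refine (measure_mono fun x hx => ?_).trans (measure_union_le _ _)
        by_cases h : x ∈ e'.source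
        · exact Or.inl ⟨hx, h⟩
        · exact Or.inr h
    _ = chartVolume m p (A ∩ e.source ∩ e'.source) := by
        rw [chartVolume_compl_source, add_zero]
        exact (chartVolume_apply_eq m p q ((hA.inter e.open_source.measurableSet).inter
          e'.open_source.measurableSet) (fun x hx => hx.1.2) (fun x hx => hx.2)).symm
    _ ≤ chartVolume m p A := measure_mono fun x hx => hx.1.1

/-- A supremum of measures could in principle be larger than each of them on a chart domain;
agreement on overlaps excludes this. -/
theorem riemannianVolume_restrict_source (p : X) :
    (riemannianVolume m).restrict (chartAt (EuclideanSpace ℝ (Fin m)) p).source =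
      chartVolume m p := by
  set e := chartAt (EuclideanSpace ℝ (Fin m)) p
  have hs := e.open_source.measurableSet
  apply le_antisymm
  -- The right side dominates every `chartVolume m q`: inside the chart domain of `p` by agreement
  -- on overlaps, outside it trivially. Hence it dominates the supremum, and restriction to the
  -- domain removes the second summand.
  · have h : riemannianVolume m (X := X) ≤
        chartVolume m p + (riemannianVolume m).restrict e.sourceᶜ := by
      refine iSup_le fun q => ?_
      rw [← Measure.restrict_add_restrict_compl (μ := chartVolume m q) hs]
      exact add_le_add (restrict_source_chartVolume_le m p q)
        (Measure.restrict_mono le_rfl (le_iSup (chartVolume m) q))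
    refine (Measure.restrict_mono le_rfl h).trans ?_
    rw [Measure.restrict_add, Measure.restrict_restrict hs, inter_compl_self,
      Measure.restrict_empty, add_zero]
    exact Measure.restrict_le_self
  · have : chartVolume m p = (chartVolume m p).restrict e.source := by
      refine (Measure.restrict_eq_self_of_ae_mem ?_).symm
      exact chartVolume_compl_source m p
    rw [this]
    exact Measure.restrict_mono le_rfl (le_iSup (chartVolume m) p)

theorem measurableSet_source_inter_preimage (p : X) {K : Set (EuclideanSpace ℝ (Fin m))}
    (hK : MeasurableSet K) :
    MeasurableSet ((chartAt (EuclideanSpace ℝ (Fin m)) p).source ∩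
      chartAt (EuclideanSpace ℝ (Fin m)) p ⁻¹' K) :=
  (chartAt (EuclideanSpace ℝ (Fin m)) p).continuousOn.measurableSet_inter_preimage'
    (chartAt (EuclideanSpace ℝ (Fin m)) p).open_source.measurableSet hK

theorem riemannianVolume_restrict_preimage (p : X) {K : Set (EuclideanSpace ℝ (Fin m))}
    (hK : MeasurableSet K) (hKt : K ⊆ (chartAt (EuclideanSpace ℝ (Fin m)) p).target) :
    (riemannianVolume m).restrict ((chartAt (EuclideanSpace ℝ (Fin m)) p).source ∩
      chartAt (EuclideanSpace ℝ (Fin m)) p ⁻¹' K) =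
    ((volume.restrict K).withDensity fun y => ENNReal.ofReal (chartDensity m p y)).map
      (chartAt (EuclideanSpace ℝ (Fin m)) p).symm := by
  set e := chartAt (EuclideanSpace ℝ (Fin m)) p
  have hA : MeasurableSet (e.source ∩ e ⁻¹' K) := measurableSet_source_inter_preimage m p hK
  have hae : AEMeasurable e.symm (volume.restrict K) :=
    (aemeasurable_chart_symm m p).mono_measure (Measure.restrict_mono hKt le_rfl)
  ext B hB
  have hmB : MeasurableSet (K ∩ e.symm ⁻¹' B) :=
    (e.continuousOn_symm.mono hKt).measurableSet_inter_preimage' hK hB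
  rw [Measure.map_apply_of_aemeasurable (hae.mono_ac (withDensity_absolutelyContinuous _ _)) hB,
    ← restrict_withDensity hK, Measure.restrict_apply' hK, inter_comm (e.symm ⁻¹' B) K, withDensity_apply _ hmB,
    Measure.restrict_apply hB]
  have h1 : riemannianVolume m (B ∩ (e.source ∩ e ⁻¹' K)) =
      chartVolume m p (B ∩ (e.source ∩ e ⁻¹' K)) := by
    rw [← riemannianVolume_restrict_source, Measure.restrict_apply (hB.inter hA)]
    congr 1
    ext x
    simp only [mem_inter_iff]
    tauto
  rw [h1, chartVolume_apply m p (hB.inter hA)]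
  congr 2
  ext y
  constructor
  · rintro ⟨hy, hyB, _, hyK⟩
    rw [mem_preimage, e.right_inv hy] at hyK
    exact ⟨hyK, hyB⟩
  · rintro ⟨hyK, hyB⟩
    refine ⟨hKt hyK, hyB, e.map_target (hKt hyK), ?_⟩
    rwa [mem_preimage, e.right_inv (hKt hyK)]

theorem isLocallyFiniteMeasure_riemannianVolume :
    IsLocallyFiniteMeasure (riemannianVolume m (X := X)) := by
  refine ⟨fun p => ?_⟩
  set e := chartAt (EuclideanSpace ℝ (Fin m)) p
  obtain ⟨K, hK, hKt, hKc⟩ := local_compact_nhds (e.open_target.mem_nhds (mem_chart_target (EuclideanSpace ℝ (Fin m)) p))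
  refine ⟨e.source ∩ e ⁻¹' K, ?_, ?_⟩
  · refine inter_mem (chart_source_mem_nhds _ p) ?_
    exact (e.continuousAt (mem_chart_source _ p)).preimage_mem_nhds hK
  · obtain ⟨C, hC⟩ := hKc.bddAbove_image ((continuousOn_chartDensity m p).mono hKt)
    have h := riemannianVolume_restrict_preimage m p hKc.measurableSet hKt
    have hae : AEMeasurable e.symm (volume.restrict K) :=
      (aemeasurable_chart_symm m p).mono_measure (Measure.restrict_mono hKt le_rfl)
    rw [← Measure.restrict_apply_univ, h, Measure.map_apply_of_aemeasurable
      (hae.mono_ac (withDensity_absolutelyContinuous _ _)) MeasurableSet.univ, preimage_univ,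
      withDensity_apply _ MeasurableSet.univ, Measure.restrict_univ]
    calc ∫⁻ y in K, ENNReal.ofReal (chartDensity m p y) ≤ ∫⁻ y in K, ENNReal.ofReal C := by
          refine setLIntegral_mono measurable_const fun y hy => ?_
          exact ENNReal.ofReal_le_ofReal (hC (mem_image_of_mem _ hy))
      _ < ⊤ := by
          rw [setLIntegral_const]
          exact ENNReal.mul_lt_top (by simp) hKc.measure_lt_top

/-- On compact sets, the Lebesgue measure in a chart is bounded by the Riemannian measure. -/
theorem exists_volume_restrict_le_smul (p : X) {K : Set (EuclideanSpace ℝ (Fin m))}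
    (hK : IsCompact K) (hKt : K ⊆ (chartAt (EuclideanSpace ℝ (Fin m)) p).target) :
    ∃ c : ℝ≥0∞, c ≠ ⊤ ∧ volume.restrict K ≤
      c • ((volume.restrict K).withDensity fun y => ENNReal.ofReal (chartDensity m p y)) := by
  rcases K.eq_empty_or_nonempty with rfl | hne
  · exact ⟨1, by simp, by simp⟩
  -- The constant is the reciprocal of the minimum of the density on `K`, which is positive.
  obtain ⟨y₀, hy₀, hmin⟩ := hK.exists_isMinOn hne ((continuousOn_chartDensity m p).mono hKt)
  have hpos := chartDensity_pos m (hKt hy₀)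
  refine ⟨(ENNReal.ofReal (chartDensity m p y₀))⁻¹, by simpa using hpos, ?_⟩
  have h1 : (volume.restrict K).withDensity (fun _ => ENNReal.ofReal (chartDensity m p y₀)) ≤
      (volume.restrict K).withDensity fun y => ENNReal.ofReal (chartDensity m p y) := by
    refine withDensity_mono ?_
    filter_upwards [ae_restrict_mem hK.measurableSet] with y hy
    exact ENNReal.ofReal_le_ofReal (hmin hy)
  rw [withDensity_const] at h1
  calc volume.restrict K = (ENNReal.ofReal (chartDensity m p y₀))⁻¹ •
        (ENNReal.ofReal (chartDensity m p y₀) • volume.restrict K) := by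
        rw [smul_smul, ENNReal.inv_mul_cancel (by simpa using hpos) (by simp), one_smul]
    _ ≤ _ := by gcongr

theorem ae_restrict_source_of_chart (p : X) {P : X → Prop}
    (h : ∀ᵐ y ∂(volume.restrict (chartAt (EuclideanSpace ℝ (Fin m)) p).target),
      P ((chartAt (EuclideanSpace ℝ (Fin m)) p).symm y)) :
    ∀ᵐ x ∂((riemannianVolume m).restrict (chartAt (EuclideanSpace ℝ (Fin m)) p).source), P x := by
  set e := chartAt (EuclideanSpace ℝ (Fin m)) p
  have h1 := (ae_restrict_iff' e.open_target.measurableSet).1 h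
  obtain ⟨N, hN, hNm, hN0⟩ := exists_measurable_superset_of_null (ae_iff.1 h1)
  have hsub : {x | ¬ P x} ∩ e.source ⊆ e.source ∩ e ⁻¹' N := by
    rintro x ⟨hx, hxs⟩
    refine ⟨hxs, hN ?_⟩
    simp only [mem_ofPred_eq, Classical.not_imp]
    exact ⟨e.map_source hxs, by rwa [e.left_inv hxs]⟩
  rw [ae_restrict_iff'₀ e.open_source.measurableSet.nullMeasurableSet, ae_iff]
  refine measure_mono_null (t := e.source ∩ e ⁻¹' N) (fun x hx => hsub ?_) ?_
  · simp only [mem_ofPred_eq, Classical.not_imp] at hx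
    exact ⟨hx.2, hx.1⟩
  · have hA := measurableSet_source_inter_preimage m p hNm
    have h2 : chartVolume m p (e.source ∩ e ⁻¹' N) = 0 := by
      rw [chartVolume_apply m p hA]
      refine setLIntegral_measure_zero _ _ (measure_mono_null ?_ hN0)
      rintro y ⟨hy, _, hyN⟩
      rwa [mem_preimage, e.right_inv hy] at hyN
    rw [← riemannianVolume_restrict_source, Measure.restrict_apply hA,
      inter_eq_left.2 inter_subset_left] at h2
    exact h2

theorem ae_riemannianVolume_of_chart [SecondCountableTopology X] {P : X → Prop}
    (h : ∀ p : X, ∀ᵐ y ∂(volume.restrict (chartAt (EuclideanSpace ℝ (Fin m)) p).target),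
      P ((chartAt (EuclideanSpace ℝ (Fin m)) p).symm y)) :
    ∀ᵐ x ∂(riemannianVolume m), P x := by
  obtain ⟨s, hs, hsU⟩ := TopologicalSpace.countable_cover_nhds
    (fun x : X => chart_source_mem_nhds (EuclideanSpace ℝ (Fin m)) x)
  have := (ae_restrict_biUnion_iff _ hs P).2 fun p _ => ae_restrict_source_of_chart m p (h p)
  rwa [hsU, Measure.restrict_univ] at this

/-- This direction uses that the density is positive, so that null sets of the Riemannian measure
are Lebesgue null in coordinates. -/
theorem ae_chart_of_ae_riemannianVolume (p : X) {P : X → Prop} {U : Set X} (hU : MeasurableSet U)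
    (h : ∀ᵐ x ∂((riemannianVolume m).restrict U), P x) :
    ∀ᵐ y ∂(volume.restrict ((chartAt (EuclideanSpace ℝ (Fin m)) p).target ∩
      (chartAt (EuclideanSpace ℝ (Fin m)) p).symm ⁻¹' U)),
      P ((chartAt (EuclideanSpace ℝ (Fin m)) p).symm y) := by
  set e := chartAt (EuclideanSpace ℝ (Fin m)) p
  rw [ae_restrict_iff' hU] at h
  have h1 := ae_restrict_of_ae (s := e.source) h
  rw [riemannianVolume_restrict_source] at h1
  have h2 := ae_of_ae_map ((aemeasurable_chart_symm m p).mono_ac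
    (withDensity_absolutelyContinuous _ _)) h1
  have hD : AEMeasurable (fun y => ENNReal.ofReal (chartDensity m p y))
      (volume.restrict e.target) :=
    ((continuousOn_chartDensity m p).aemeasurable e.open_target.measurableSet).ennreal_ofReal
  have h3 := (ae_withDensity_iff' hD).1 h2
  rw [ae_restrict_iff' (e.continuousOn_symm.measurableSet_inter_preimage'
    e.open_target.measurableSet hU)]
  filter_upwards [(ae_restrict_iff' e.open_target.measurableSet).1 h3] with y hy hyU
  exact hy hyU.1 (by simpa using chartDensity_pos m hyU.1) hyU.2

end RiemannianMeasure

/-! ### Lipschitz functions for the Riemannian distance, and Rademacher's theorem -/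

section LipschitzInCharts

set_option linter.unusedSectionVars false

variable (m : ℕ) {X : Type*} [EMetricSpace X] [ChartedSpace (EuclideanSpace ℝ (Fin m)) X]
  [IsManifold (𝓡 m) ∞ X] [RiemannianBundle (fun x : X => TangentSpace (𝓡 m) x)]
  [IsContinuousRiemannianBundle (EuclideanSpace ℝ (Fin m)) (fun x : X => TangentSpace (𝓡 m) x)]

theorem continuousOn_norm_coordMap (p : X) (v : EuclideanSpace ℝ (Fin m)) :
    ContinuousOn (fun x => ‖coordMap m p x v‖)
      (chartAt (EuclideanSpace ℝ (Fin m)) p).source := by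
  have h : ∀ x, ‖coordMap m p x v‖ = √(∑ i, ∑ j, v i * (v j * metricMatrix m p x i j)) := by
    intro x
    rw [norm_eq_sqrt_real_inner, coordMap_eq_sum]
    simp only [sum_inner, inner_sum, inner_smul_left, inner_smul_right, Finset.mul_sum]
    rw [Finset.sum_comm]
    simp only [metricMatrix, Matrix.of_apply, conj_trivial]
    congr 1
    exact Finset.sum_congr rfl fun i _ => Finset.sum_congr rfl fun j _ => by ring
  simp only [h]
  refine ContinuousOn.sqrt (continuousOn_finsetSum _ fun i _ => continuousOn_finsetSum _
    fun j _ => ?_)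
  exact continuousOn_const.mul (continuousOn_const.mul (continuousOn_metricMatrix m p i j))

theorem exists_norm_coordMap_le {p : X} {y : EuclideanSpace ℝ (Fin m)}
    (h : y ∈ (chartAt (EuclideanSpace ℝ (Fin m)) p).target) :
    ∃ L : ℝ≥0, ∀ᶠ z in 𝓝 y, ∀ v,
      ‖coordMap m p ((chartAt (EuclideanSpace ℝ (Fin m)) p).symm z) v‖ ≤ L * ‖v‖ := by
  set e := chartAt (EuclideanSpace ℝ (Fin m)) p
  have hc : ContinuousAt (fun z => ∑ i, ‖coordVec m p (e.symm z) i‖) y := by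
    refine ContinuousOn.continuousAt (s := e.target) ?_ (e.open_target.mem_nhds h)
    exact continuousOn_finsetSum _ fun i _ =>
      (continuousOn_norm_coordMap m p (EuclideanSpace.single i 1)).comp e.continuousOn_symm
        e.mapsTo_symm
  have hL := hc.eventually (gt_mem_nhds (lt_add_one _))
  refine ⟨Real.toNNReal (∑ i, ‖coordVec m p (e.symm y) i‖ + 1), ?_⟩
  filter_upwards [hL] with z hz v
  rw [coordMap_eq_sum]
  refine (norm_sum_le _ _).trans ?_
  refine (Finset.sum_le_sum fun i _ => ?_).trans (b := ∑ i, ‖coordVec m p (e.symm z) i‖ * ‖v‖) ?_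
  · rw [norm_smul, mul_comm]
    exact mul_le_mul_of_nonneg_left (PiLp.norm_apply_le v i) (norm_nonneg _)
  · rw [← Finset.sum_mul]
    exact mul_le_mul_of_nonneg_right (hz.le.trans (Real.le_coe_toNNReal _)) (norm_nonneg _)

variable [IsRiemannianManifold (𝓡 m) X]

/-- The Riemannian distance is at most the length of the image of the coordinate segment from `y` to
`z`, whose speed is bounded by `L`. -/
theorem edist_chart_symm_le {p : X} {y z : EuclideanSpace ℝ (Fin m)} {L : ℝ≥0}
    (h : ∀ t ∈ Icc (0 : ℝ) 1, y + t • (z - y) ∈ (chartAt (EuclideanSpace ℝ (Fin m)) p).target)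
    (hL : ∀ t ∈ Icc (0 : ℝ) 1, ‖coordMap m p
      ((chartAt (EuclideanSpace ℝ (Fin m)) p).symm (y + t • (z - y))) (z - y)‖ ≤ L) :
    edist ((chartAt (EuclideanSpace ℝ (Fin m)) p).symm y)
      ((chartAt (EuclideanSpace ℝ (Fin m)) p).symm z) ≤ L := by
  set e := chartAt (EuclideanSpace ℝ (Fin m)) p
  let l : ℝ → EuclideanSpace ℝ (Fin m) := fun t => y + t • (z - y)
  have hl : ∀ t, HasFDerivAt l ((ContinuousLinearMap.id ℝ ℝ).smulRight (z - y)) t := fun t =>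
    ((ContinuousLinearMap.id ℝ ℝ).smulRight (z - y)).hasFDerivAt.const_add y
  rw [IsRiemannianManifold.out (I := 𝓡 m)]
  have hsm : ContMDiffOn 𝓘(ℝ, ℝ) (𝓡 m) 1 (e.symm ∘ l) (Icc 0 1) := by
    refine ContMDiffOn.comp (t := e.target) (contMDiffOn_chart_symm (I := 𝓡 m) (n := 1)) ?_ h
    refine ContMDiff.contMDiffOn (ContDiff.contMDiff ?_)
    fun_prop
  refine (Manifold.riemannianEDist_le_pathELength hsm (by simp [l]) (by simp [l]) zero_le_one).trans ?_
  rw [Manifold.pathELength_eq_lintegral_mfderiv_Icc]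
  calc _ ≤ ∫⁻ t in Icc (0 : ℝ) 1, (L : ℝ≥0∞) := by
        refine setLIntegral_mono measurable_const fun t ht => ?_
        have h1 := (hasMFDerivAt_chart_symm m (h t ht)).comp t (hl t).hasMFDerivAt
        rw [h1.mfderiv]
        have h2 := hL t ht
        have h3 : (((coordMap m p ((e.symm ∘ l) t)).comp
            ((ContinuousLinearMap.id ℝ ℝ).smulRight (z - y))) 1) =
              coordMap m p (e.symm (l t)) (z - y) := by
          change coordMap m p (e.symm (l t)) ((1 : ℝ) • (z - y)) = _
          rw [one_smul]
        refine (congrArg enorm h3).trans_le ?_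
        rw [enorm_le_coe]
        exact h2
    _ = L := by simp

theorem LipschitzWith.locallyLipschitzOn_chart {F : Type*} [PseudoEMetricSpace F]
    {f : X → F} {K : ℝ≥0}
    (hf : LipschitzWith K f) (p : X) :
    LocallyLipschitzOn (chartAt (EuclideanSpace ℝ (Fin m)) p).target
      (f ∘ (chartAt (EuclideanSpace ℝ (Fin m)) p).symm) := by
  intro y hy
  set e := chartAt (EuclideanSpace ℝ (Fin m)) p
  obtain ⟨L, hL⟩ := exists_norm_coordMap_le m hy
  obtain ⟨r, hr, hrs⟩ := Metric.mem_nhds_iff.1 (inter_mem hL (e.open_target.mem_nhds hy))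
  refine ⟨K * L, Metric.ball y r, mem_nhdsWithin_of_mem_nhds (Metric.ball_mem_nhds y hr), ?_⟩
  intro z hz z' hz'
  have hseg : ∀ t ∈ Icc (0 : ℝ) 1, z + t • (z' - z) ∈ Metric.ball y r := fun t ht =>
    (convex_ball y r).add_smul_sub_mem hz hz' ht
  refine (hf _ _).trans ?_
  rw [ENNReal.coe_mul, mul_assoc]
  gcongr
  refine (edist_chart_symm_le m (L := L * ‖z' - z‖₊) (fun t ht => (hrs (hseg t ht)).2)
    fun t ht => ?_).trans ?_
  · simpa using (hrs (hseg t ht)).1 (z' - z)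
  · rw [edist_comm z z', edist_eq_enorm_sub]
    simp [enorm]

/-- Along a coordinate line with initial velocity `v` the speed stays below `‖v‖ + η` for a short
time, so the increments of `f` are at most `K (‖v‖ + η) |t|`. Letting `η` tend to zero keeps the
constant `K`. -/
theorem LipschitzWith.norm_differential_le {f : X → ℂ} {K : ℝ≥0}
    (hf : LipschitzWith K f) (x : X) (v : TangentSpace (𝓡 m) x) :
    ‖differential m f x v‖ ≤ K * ‖v‖ := by
  by_cases hd : MDifferentiableAt (𝓡 m) 𝓘(ℝ, ℂ) f x
  swap
  · rw [differential, mfderiv_zero_of_not_mdifferentiableAt hd]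
    change ‖(0 : ℂ)‖ ≤ _
    simp only [norm_zero]
    positivity
  have hlim : Tendsto (fun η : ℝ => (K : ℝ) * (‖v‖ + η)) (𝓝[>] 0) (𝓝 (K * (‖v‖ + 0))) :=
    (((continuous_const.add continuous_id).const_mul _).tendsto 0).mono_left nhdsWithin_le_nhds
  rw [add_zero] at hlim
  refine ge_of_tendsto hlim ?_
  filter_upwards [self_mem_nhdsWithin] with η hη
  rw [mem_Ioi] at hη
  set e := chartAt (EuclideanSpace ℝ (Fin m)) x
  obtain ⟨a, rfl⟩ : ∃ a, coordMap m x x a = v :=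
    ⟨coordMapInv m _ _ v, coordMap_coordMapInv m (mem_chart_source _ _) v⟩
  obtain ⟨y, hy, hyx⟩ : ∃ y ∈ e.target, e.symm y = x :=
    ⟨e x, mem_chart_target _ x, e.left_inv (mem_chart_source _ x)⟩
  have hcoord : ∀ x', e.symm y = x' → MDifferentiableAt (𝓡 m) 𝓘(ℝ, ℂ) f x' →
      differential m f x' (coordMap m x x' a) = fderiv ℝ (f ∘ e.symm) y a := by
    rintro _ rfl _
    exact mfderiv_coordMap m hy f a
  have hd0 := hd
  rw [← hyx] at hd
  have hd' := ((mdifferentiableAt_iff_chart m hy f).1 hd).hasFDerivAt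
  have hc : ContinuousAt (fun z => ‖coordMap m x (e.symm z) a‖) y :=
    ((continuousOn_norm_coordMap m x a).comp e.continuousOn_symm
      e.mapsTo_symm).continuousAt (e.open_target.mem_nhds hy)
  have hlt : ‖coordMap m x (e.symm y) a‖ < ‖coordMap m x x a‖ + η := by rw [hyx]; linarith
  obtain ⟨r, hr, hrs⟩ := Metric.mem_nhds_iff.1
    (inter_mem (hc.eventually (gt_mem_nhds hlt)) (e.open_target.mem_nhds hy))
  have hl : HasDerivAt (fun t : ℝ => y + t • a) a 0 := by
    simpa using ((hasDerivAt_id (0 : ℝ)).smul_const a).const_add y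
  have hg : HasDerivAt (fun t : ℝ => (f ∘ e.symm) (y + t • a))
      (fderiv ℝ (f ∘ e.symm) y a) 0 := by
    refine HasFDerivAt.comp_hasDerivAt (0 : ℝ) (l := f ∘ e.symm) ?_ hl
    simpa using hd'
  rw [hcoord x hyx hd0]
  have hLnn : 0 ≤ ‖coordMap m x x a‖ + η := by positivity
  obtain ⟨L, hL⟩ : ∃ L : ℝ≥0, (L : ℝ) = ‖coordMap m x x a‖ + η := ⟨⟨_, hLnn⟩, rfl⟩
  rw [← hL] at hrs ⊢
  -- The derivative at `0` along the line is bounded by any constant that bounds the difference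
  -- quotients near `0`.
  refine hg.le_of_lip' (by positivity) ?_
  have hev : ∀ᶠ t : ℝ in 𝓝 0, y + t • a ∈ Metric.ball y r := by
    refine hl.continuousAt.eventually_mem ?_
    simpa using Metric.ball_mem_nhds y hr
  filter_upwards [hev] with t ht
  have hseg : ∀ s ∈ Icc (0 : ℝ) 1, y + s • ((y + t • a) - y) ∈ Metric.ball y r := fun s hs =>
    (convex_ball y r).add_smul_sub_mem (Metric.mem_ball_self hr) ht hs
  have h1 := edist_chart_symm_le m (L := ‖t‖₊ * L)
    (fun s hs => (hrs (hseg s hs)).2) fun s hs => by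
      have h2 := (hrs (hseg s hs)).1
      rw [add_sub_cancel_left, map_smul, norm_smul] at *
      rw [NNReal.coe_mul, coe_nnnorm]
      exact mul_le_mul_of_nonneg_left h2.le (norm_nonneg _)
  have h3 := (hf (e.symm y) (e.symm (y + t • a))).trans (mul_le_mul_right h1 (K : ℝ≥0∞))
  rw [edist_comm, edist_eq_enorm_sub, ← ENNReal.coe_mul, enorm_le_coe, ← NNReal.coe_le_coe] at h3
  simp only [Function.comp_apply, zero_smul, add_zero, sub_zero]
  simpa [mul_assoc, mul_comm, mul_left_comm] using h3

/-- Rademacher's theorem holds on a small open neighbourhood of each point, and by second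
countability countably many of these cover `s`. -/
theorem LocallyLipschitzOn.ae_differentiableAt {E F : Type*} [NormedAddCommGroup E]
    [NormedSpace ℝ E] [FiniteDimensional ℝ E] [MeasurableSpace E] [BorelSpace E]
    [NormedAddCommGroup F] [NormedSpace ℝ F] [FiniteDimensional ℝ F] (μ : Measure E)
    [μ.IsAddHaarMeasure]
    {f : E → F} {s : Set E} (hs : IsOpen s) (hf : LocallyLipschitzOn s f) :
    ∀ᵐ y ∂(μ.restrict s), DifferentiableAt ℝ f y := by
  have h : ∀ y ∈ s, ∃ t ∈ 𝓝[s] y, ∀ᵐ z ∂(μ.restrict t), DifferentiableAt ℝ f z := by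
    intro y hy
    obtain ⟨K, t, ht, hK⟩ := hf hy
    rw [hs.nhdsWithin_eq hy] at ht ⊢
    obtain ⟨u, hut, huo, hyu⟩ := mem_nhds_iff.1 ht
    refine ⟨u, huo.mem_nhds hyu, ?_⟩
    rw [ae_restrict_iff' huo.measurableSet]
    filter_upwards [(hK.mono hut).ae_differentiableWithinAt_of_mem (μ := μ)] with z hz hzu
    exact (hz hzu).differentiableAt (huo.mem_nhds hzu)
  choose! t ht hta using h
  obtain ⟨c, hcs, hc, hcov⟩ := TopologicalSpace.countable_cover_nhdsWithin ht
  refine ae_restrict_of_ae_restrict_of_subset hcov ?_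
  exact (ae_restrict_biUnion_iff t hc _).2 fun y hy => hta y (hcs hy)

variable [SecondCountableTopology X] [MeasurableSpace X] [BorelSpace X]

theorem LipschitzWith.norm_differentialComponents_le {f : X → ℂ} {K : ℝ≥0}
    (hf : LipschitzWith K f) (x : X) : ‖differentialComponents m f x‖ ≤ √m * K :=
  norm_covectorComponents_le m x _ (hf.norm_differential_le m x)

theorem LipschitzWith.ae_mdifferentiableAt {f : X → ℂ} {K : ℝ≥0} (hf : LipschitzWith K f) :
    ∀ᵐ x ∂(riemannianVolume m), MDifferentiableAt (𝓡 m) 𝓘(ℝ, ℂ) f x := by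
  refine ae_riemannianVolume_of_chart m fun p => ?_
  set e := chartAt (EuclideanSpace ℝ (Fin m)) p
  filter_upwards [(hf.locallyLipschitzOn_chart m p).ae_differentiableAt volume e.open_target,
    ae_restrict_mem e.open_target.measurableSet] with y hy hyt
  exact (mdifferentiableAt_iff_chart m hyt f).2 hy

end LipschitzInCharts

/-! ### Dominated convergence in `L²` and mollification -/

section EuclideanApproximation

set_option linter.unusedSectionVars false

/-- The integrals of `‖f n - g‖²` tend to zero by dominated convergence with majorant `(2 b)²`,
since the limit inherits the bound `b`. -/
theorem tendsto_eLpNorm_two_of_dominated {α G : Type*} [MeasurableSpace α] {μ : Measure α}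
    [NormedAddCommGroup G] {f : ℕ → α → G} {g : α → G} {b : α → ℝ} (hb : MemLp b 2 μ)
    (hf : ∀ n, AEStronglyMeasurable (f n) μ) (hbound : ∀ n, ∀ᵐ x ∂μ, ‖f n x‖ ≤ b x)
    (hlim : ∀ᵐ x ∂μ, Tendsto (fun n => f n x) atTop (𝓝 (g x))) :
    MemLp g 2 μ ∧ Tendsto (fun n => eLpNorm (f n - g) 2 μ) atTop (𝓝 0) := by
  have hg : AEStronglyMeasurable g μ := aestronglyMeasurable_of_tendsto_ae _ hf hlim
  have hgb : ∀ᵐ x ∂μ, ‖g x‖ ≤ b x := by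
    filter_upwards [hlim, ae_all_iff.2 hbound] with x hx hbx
    exact le_of_tendsto hx.norm (Eventually.of_forall hbx)
  refine ⟨hb.of_le hg (hgb.mono fun x hx => hx.trans (le_abs_self _)), ?_⟩
  have hlint : Tendsto (fun n => ∫⁻ x, ‖(f n - g) x‖ₑ ^ (2 : ℝ) ∂μ) atTop (𝓝 (∫⁻ _, 0 ∂μ)) := by
    refine tendsto_lintegral_of_dominated_convergence' (fun x => ‖2 * b x‖ₑ ^ (2 : ℝ))
      (fun n => ((hf n).sub hg).enorm.pow_const _) (fun n => ?_) ?_ ?_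
    · filter_upwards [hbound n, hgb] with x h1 h2
      refine ENNReal.rpow_le_rpow ?_ (by norm_num)
      rw [← ofReal_norm, ← ofReal_norm]
      refine ENNReal.ofReal_le_ofReal ((norm_sub_le _ _).trans ?_)
      rw [Real.norm_eq_abs]
      exact le_trans (by linarith) (le_abs_self _)
    · have h2 := (hb.const_mul (2 : ℝ)).2
      rw [eLpNorm_lt_top_iff_lintegral_rpow_enorm_lt_top (by norm_num) (by norm_num)] at h2
      simpa using h2.ne
    · filter_upwards [hlim] with x hx
      have h3 : Tendsto (fun n => ‖f n x - g x‖ₑ) atTop (𝓝 0) := by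
        have := (tendsto_sub_nhds_zero_iff.2 hx).enorm
        simpa using this
      have h4 := ((ENNReal.continuous_rpow_const (y := 2)).tendsto 0).comp h3
      rw [ENNReal.zero_rpow_of_pos (by norm_num)] at h4
      exact h4
  rw [lintegral_zero] at hlint
  have h5 := ((ENNReal.continuous_rpow_const (y := 1 / 2)).tendsto 0).comp hlint
  rw [ENNReal.zero_rpow_of_pos (by norm_num)] at h5
  refine h5.congr fun n => ?_
  rw [eLpNorm_eq_lintegral_rpow_enorm_toReal (by norm_num) (by norm_num)]
  simp

variable {E F : Type*} [NormedAddCommGroup E] [NormedSpace ℝ E] [FiniteDimensional ℝ E]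
  [NormedAddCommGroup F] [NormedSpace ℝ F]

/-- Compactness gives a Lipschitz constant on the closed `1`-thickening of the support. A point
outside it is at distance at least `1` from the support, where the supremum `M` of `‖g‖` serves as a
Lipschitz constant. -/
theorem LocallyLipschitz.exists_lipschitzWith_of_hasCompactSupport {g : E → F}
    (hg : LocallyLipschitz g) (hc : HasCompactSupport g) : ∃ L, LipschitzWith L g := by
  have := FiniteDimensional.proper ℝ E
  have hK : IsCompact (Metric.cthickening 1 (tsupport g)) := hc.cthickening
  obtain ⟨C, hC⟩ := (hg.locallyLipschitzOn (s := Metric.cthickening 1 (tsupport g))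
    ).exists_lipschitzOnWith_of_compact hK
  obtain ⟨M, hM⟩ := hc.exists_bound_of_continuous hg.continuous
  have hM0 : 0 ≤ M := (norm_nonneg _).trans (hM 0)
  have key : ∀ x y, x ∈ tsupport g → ‖g x - g y‖ ≤ max C (Real.toNNReal M) * ‖x - y‖ := by
    intro x y hx
    by_cases hy : y ∈ Metric.cthickening 1 (tsupport g)
    · have := hC.norm_sub_le (Metric.self_subset_cthickening _ hx) hy
      refine this.trans (mul_le_mul_of_nonneg_right ?_ (norm_nonneg _))
      exact le_max_left _ _
    · have hd : 1 ≤ ‖x - y‖ := by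
        by_contra! h
        refine hy (Metric.mem_cthickening_of_dist_le y x 1 _ hx ?_)
        rw [dist_comm, dist_eq_norm]
        exact h.le
      have hy0 : g y = 0 := image_eq_zero_of_notMem_tsupport fun h =>
        hy (Metric.self_subset_cthickening _ h)
      rw [hy0, sub_zero]
      calc ‖g x‖ ≤ M := hM x
        _ ≤ max C (Real.toNNReal M) := (Real.le_coe_toNNReal M).trans (le_max_right _ _)
        _ ≤ max C (Real.toNNReal M) * ‖x - y‖ :=
          le_mul_of_one_le_right (by positivity) hd
  refine ⟨max C (Real.toNNReal M), LipschitzWith.of_dist_le_mul fun x y => ?_⟩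
  rw [dist_eq_norm, dist_eq_norm]
  by_cases hx : x ∈ tsupport g
  · exact key x y hx
  by_cases hy : y ∈ tsupport g
  · rw [norm_sub_rev, norm_sub_rev x y]
    exact key y x hy
  · rw [image_eq_zero_of_notMem_tsupport hx, image_eq_zero_of_notMem_tsupport hy, sub_zero,
      norm_zero]
    positivity

variable [FiniteDimensional ℝ F] [MeasurableSpace E] [BorelSpace E]

open ContinuousLinearMap in
-- The convolution is an average with a non-negative weight of total mass one.
theorem ContDiffBump.norm_convolution_normed_le {G : Type*} [NormedAddCommGroup G]
    [NormedSpace ℝ G] {μ : Measure E} [μ.IsAddHaarMeasure] (ρ : ContDiffBump (0 : E)) {h : E → G}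
    {C : ℝ} (hC : ∀ y, ‖h y‖ ≤ C) (y : E) :
    ‖convolution (ρ.normed μ) h (lsmul ℝ ℝ) μ y‖ ≤ C := by
  have h1 : ‖∫ t, ρ.normed μ t • h (y - t) ∂μ‖ ≤ ∫ t, ρ.normed μ t * C ∂μ := by
    refine norm_integral_le_of_norm_le (ρ.integrable_normed.mul_const C)
      (Eventually.of_forall fun t => ?_)
    rw [norm_smul, Real.norm_of_nonneg (ρ.nonneg_normed t)]
    exact mul_le_mul_of_nonneg_left (hC _) (ρ.nonneg_normed t)
  rwa [integral_mul_const, ρ.integral_normed, one_mul] at h1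

open ContinuousLinearMap in
/-- Mollification of a Lipschitz function with compact support. -/
theorem LipschitzWith.exists_smooth_approx (μ : Measure E) [μ.IsAddHaarMeasure] {g : E → F}
    {L : ℝ≥0} (hg : LipschitzWith L g) (hc : HasCompactSupport g) {r : ℝ} (hr : 0 < r) :
    ∃ h : ℕ → E → F, (∀ n, ContDiff ℝ ∞ (h n)) ∧
      (∀ n, tsupport (h n) ⊆ Metric.cthickening r (tsupport g)) ∧
      (∀ y, Tendsto (fun n => h n y) atTop (𝓝 (g y))) ∧
      (∀ᵐ y ∂μ, Tendsto (fun n => fderiv ℝ (h n) y) atTop (𝓝 (fderiv ℝ g y))) ∧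
      (∀ n y, ‖fderiv ℝ (h n) y‖ ≤ L) ∧ ∃ M, ∀ n y, ‖h n y‖ ≤ M := by
  have := FiniteDimensional.proper ℝ E
  -- Outer radii at most `r` keep the supports inside the `r`-thickening. The fixed ratio `2` of
  -- outer to inner radius is what the Lebesgue differentiation theorem for these kernels requires.
  let ρ : ℕ → ContDiffBump (0 : E) := fun n =>
    ⟨r / (2 * (n + 1)), r / (n + 1), by positivity, by
      rw [div_lt_div_iff₀ (by positivity) (by positivity)]
      nlinarith [hr, (n.cast_nonneg : (0 : ℝ) ≤ n)]⟩
  have hρ0 : Tendsto (fun n => (ρ n).rOut) atTop (𝓝 0) := by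
    have := (tendsto_one_div_add_atTop_nhds_zero_nat (𝕜 := ℝ)).const_mul r
    simpa [ρ, div_eq_mul_inv] using this
  have hρr : ∀ n, (ρ n).rOut ≤ r := fun n => div_le_self hr.le (by simp)
  have hρK : ∀ n, (ρ n).rOut ≤ 2 * (ρ n).rIn := fun n => by
    simp only [ρ]
    apply le_of_eq
    field_simp
  have := FiniteDimensional.complete ℝ F
  have := FiniteDimensional.proper ℝ (E →L[ℝ] F)
  have hloc : LocallyIntegrable (fderiv ℝ g) μ :=
    (locallyIntegrable_const (L : ℝ)).mono (measurable_fderiv ℝ g).aestronglyMeasurable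
      (Eventually.of_forall fun y => by simpa using norm_fderiv_le_of_lipschitz ℝ hg)
  -- The derivative falls on `g`, by differentiation under the integral with a Lipschitz majorant
  -- and Rademacher's theorem. As an average of `fderiv ℝ g` it is bounded by `L` and converges
  -- almost everywhere.
  have hfd : ∀ n y, HasFDerivAt (convolution ((ρ n).normed μ) g (lsmul ℝ ℝ) μ)
      (convolution ((ρ n).normed μ) (fderiv ℝ g) (lsmul ℝ ℝ) μ y) y := by
    intro n y
    have hdiff : ∀ᵐ t ∂μ, DifferentiableAt ℝ g (y - t) :=
      (Measure.measurePreserving_sub_left μ y).quasiMeasurePreserving.ae hg.ae_differentiableAt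
    have hcont : ∀ z, Continuous fun t => (ρ n).normed μ t • g (z - t) := fun z =>
      (ρ n).continuous_normed.smul (hg.continuous.comp (by fun_prop))
    refine (hasFDerivAt_integral_of_dominated_loc_of_lip (s := univ)
      (F := fun z t => (ρ n).normed μ t • g (z - t))
      (F' := fun t => (ρ n).normed μ t • fderiv ℝ g (y - t))
      (bound := fun t => (ρ n).normed μ t * L) univ_mem
      (Eventually.of_forall fun z => (hcont z).aestronglyMeasurable) ?_ ?_ ?_
      ((ρ n).integrable_normed.mul_const _) ?_).2
    · exact (hcont y).integrable_of_hasCompactSupport ((ρ n).hasCompactSupport_normed.smul_right)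
    · exact (ρ n).continuous_normed.aestronglyMeasurable.smul
        ((measurable_fderiv ℝ g).comp (measurable_const_sub y)).aestronglyMeasurable
    · refine Eventually.of_forall fun t => LipschitzWith.lipschitzOnWith
        (LipschitzWith.of_dist_le_mul fun z z' => ?_)
      rw [dist_eq_norm, ← smul_sub, norm_smul, Real.norm_of_nonneg ((ρ n).nonneg_normed t),
        Real.coe_nnabs, abs_of_nonneg (a := (ρ n).normed μ t * (L : ℝ))
          (mul_nonneg ((ρ n).nonneg_normed t) L.2), mul_assoc]
      refine mul_le_mul_of_nonneg_left ?_ ((ρ n).nonneg_normed t)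
      have := hg.dist_le_mul (z - t) (z' - t)
      rwa [dist_sub_right, dist_eq_norm] at this
    · filter_upwards [hdiff] with t ht
      have h1 : HasFDerivAt (fun z => g (z - t)) (fderiv ℝ g (y - t)) y := by
        have := ht.hasFDerivAt.comp y ((hasFDerivAt_id y).sub_const t)
        rwa [ContinuousLinearMap.comp_id] at this
      exact h1.const_smul _
  refine ⟨fun n => convolution ((ρ n).normed μ) g (lsmul ℝ ℝ) μ, fun n => ?_, fun n => ?_,
    fun y => ?_, ?_, fun n y => ?_, ?_⟩
  · exact (ρ n).hasCompactSupport_normed.contDiff_convolution_left _ (ρ n).contDiff_normed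
      hg.continuous.locallyIntegrable
  · refine closure_minimal ?_ Metric.isClosed_cthickening
    refine (support_convolution_subset_swap (lsmul ℝ ℝ)).trans ?_
    rintro _ ⟨a, ha, b, hb, rfl⟩
    rw [(ρ n).support_normed_eq] at hb
    refine Metric.mem_cthickening_of_dist_le _ a r _ (subset_tsupport _ ha) ?_
    rw [dist_eq_norm, add_sub_cancel_left]
    rw [mem_ball_zero_iff] at hb
    exact hb.le.trans (hρr n)
  · exact ContDiffBump.convolution_tendsto_right_of_continuous hρ0 hg.continuous y
  · filter_upwards [ContDiffBump.ae_convolution_tendsto_right_of_locallyIntegrable hρ0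
      (Eventually.of_forall hρK) hloc] with y hy
    exact hy.congr fun n => (hfd n y).fderiv.symm
  · rw [(hfd n y).fderiv]
    exact (ρ n).norm_convolution_normed_le (fun y => norm_fderiv_le_of_lipschitz ℝ hg) y
  · obtain ⟨M, hM⟩ := hc.exists_bound_of_continuous hg.continuous
    exact ⟨M, fun n y => (ρ n).norm_convolution_normed_le hM y⟩

end EuclideanApproximation

/-! ### Membership in `H¹₀` through pointwise representatives -/

section SobolevZero

set_option linter.unusedSectionVars false

variable (m : ℕ) {X : Type*} [EMetricSpace X] [ChartedSpace (EuclideanSpace ℝ (Fin m)) X]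
  [IsManifold (𝓡 m) ∞ X] [RiemannianBundle (fun x : X => TangentSpace (𝓡 m) x)]
  [IsContinuousRiemannianBundle (EuclideanSpace ℝ (Fin m)) (fun x : X => TangentSpace (𝓡 m) x)]

/-- The coordinates of `v` arise by applying the inverse metric matrix to the vector of the products
`⟨∂_j, v⟩`. Cauchy-Schwarz then gives a bound that depends continuously on the point. -/
theorem exists_norm_coordMapInv_le (p : X) :
    ∃ N : X → ℝ, ContinuousOn N (chartAt (EuclideanSpace ℝ (Fin m)) p).source ∧
      ∀ x ∈ (chartAt (EuclideanSpace ℝ (Fin m)) p).source, ∀ v,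
        ‖coordMapInv m p x v‖ ≤ N x * ‖v‖ := by
  refine ⟨fun x => ∑ i, ∑ j, ‖(metricMatrix m p x)⁻¹ i j‖ * ‖coordVec m p x j‖, ?_, ?_⟩
  · refine continuousOn_finsetSum _ fun i _ => continuousOn_finsetSum _ fun j _ => ?_
    refine ContinuousOn.mul (ContinuousOn.norm ?_) (continuousOn_norm_coordMap m p _)
    have hG : ContinuousOn (fun x => metricMatrix m p x)
        (chartAt (EuclideanSpace ℝ (Fin m)) p).source :=
      continuousOn_pi.2 fun i => continuousOn_pi.2 fun j => continuousOn_metricMatrix m p i j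
    simp only [Matrix.inv_def, Matrix.smul_apply, Ring.inverse_eq_inv', smul_eq_mul]
    refine ContinuousOn.mul (ContinuousOn.inv₀ ?_ fun x hx => ?_) ?_
    · exact Continuous.comp_continuousOn (g := fun M : Matrix (Fin m) (Fin m) ℝ => M.det)
        (by fun_prop) hG
    · exact (metricMatrix_posDef m hx).det_pos.ne'
    · exact Continuous.comp_continuousOn
        (g := fun M : Matrix (Fin m) (Fin m) ℝ => M.adjugate i j)
        ((continuous_id.matrix_adjugate).matrix_elem i j) hG
  · intro x hx v
    obtain ⟨a, rfl⟩ : ∃ a, coordMap m p x a = v := ⟨_, coordMap_coordMapInv m hx v⟩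
    rw [coordMapInv_coordMap m hx]
    have hGa : (metricMatrix m p x).mulVec a = fun i => inner ℝ (coordVec m p x i)
        (coordMap m p x a) := by
      ext i
      rw [coordMap_eq_sum]
      simp only [Matrix.mulVec, dotProduct, inner_sum, inner_smul_right, metricMatrix,
        Matrix.of_apply]
      exact Finset.sum_congr rfl fun j _ => mul_comm _ _
    have ha : ∀ i, a i = ∑ j, (metricMatrix m p x)⁻¹ i j *
        inner ℝ (coordVec m p x j) (coordMap m p x a) := by
      intro i
      have h1 : (metricMatrix m p x)⁻¹.mulVec ((metricMatrix m p x).mulVec a) = a := by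
        rw [Matrix.mulVec_mulVec, Matrix.nonsing_inv_mul, Matrix.one_mulVec]
        exact (metricMatrix_posDef m hx).det_pos.ne'.isUnit
      rw [hGa] at h1
      exact (congrFun h1 i).symm
    calc ‖a‖ ≤ ∑ i, ‖a i‖ := by
          conv_lhs => rw [← (EuclideanSpace.basisFun (Fin m) ℝ).sum_repr a]
          refine (norm_sum_le _ _).trans (Finset.sum_le_sum fun i _ => ?_)
          simp [norm_smul]
      _ ≤ _ := by
          rw [Finset.sum_mul]
          refine Finset.sum_le_sum fun i _ => ?_
          rw [ha i, Finset.sum_mul]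
          refine (norm_sum_le _ _).trans (Finset.sum_le_sum fun j _ => ?_)
          rw [norm_mul, mul_assoc]
          exact mul_le_mul_of_nonneg_left (norm_inner_le_norm _ _) (norm_nonneg _)

variable [SecondCountableTopology X] [MeasurableSpace X] [BorelSpace X]

/-- The constant is independent of `f`, so it bounds a whole sequence of mollifications at once. -/
theorem exists_norm_differentialComponents_le (p : X) {A : Set X} (hA : IsCompact A)
    (hAs : A ⊆ (chartAt (EuclideanSpace ℝ (Fin m)) p).source) :
    ∃ C : ℝ, 0 ≤ C ∧ ∀ x ∈ A, ∀ f : X → ℂ, ‖differentialComponents m f x‖ ≤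
      C * ‖fderiv ℝ (f ∘ (chartAt (EuclideanSpace ℝ (Fin m)) p).symm)
        (chartAt (EuclideanSpace ℝ (Fin m)) p x)‖ := by
  obtain ⟨N, hN, hNle⟩ := exists_norm_coordMapInv_le m p
  obtain ⟨C, hC⟩ := hA.bddAbove_image (hN.mono hAs)
  refine ⟨√m * max C 0, by positivity, fun x hx f => ?_⟩
  rw [mul_assoc]
  refine norm_covectorComponents_le m x _ fun v => ?_
  have hxs := hAs hx
  have h1 := mfderiv_coordMap m ((chartAt (EuclideanSpace ℝ (Fin m)) p).map_source hxs) f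
    (coordMapInv m p x v)
  rw [(chartAt (EuclideanSpace ℝ (Fin m)) p).left_inv hxs, coordMap_coordMapInv m hxs] at h1
  have h2 : differential m f x v = _ := h1
  rw [h2]
  refine (ContinuousLinearMap.le_opNorm _ _).trans ?_
  rw [mul_comm (max C 0), mul_assoc]
  refine mul_le_mul_of_nonneg_left ((hNle x hxs v).trans ?_) (norm_nonneg _)
  exact mul_le_mul_of_nonneg_right ((hC (mem_image_of_mem _ hx)).trans (le_max_left _ _))
    (norm_nonneg _)

/-- The differential components in terms of the coordinates. -/
theorem differentialComponents_eq_fderiv (p : X) {x : X}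
    (hx : x ∈ (chartAt (EuclideanSpace ℝ (Fin m)) p).source) (f : X → ℂ) :
    differentialComponents m f x = WithLp.toLp 2 fun i =>
      fderiv ℝ (f ∘ (chartAt (EuclideanSpace ℝ (Fin m)) p).symm)
        (chartAt (EuclideanSpace ℝ (Fin m)) p x) (coordMapInv m p x (frame m x i)) := by
  ext i
  have h1 := mfderiv_coordMap m ((chartAt (EuclideanSpace ℝ (Fin m)) p).map_source hx) f
    (coordMapInv m p x (frame m x i))
  rw [(chartAt (EuclideanSpace ℝ (Fin m)) p).left_inv hx, coordMap_coordMapInv m hx] at h1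
  exact h1

/-- The functions `u` and `w` represent an element of `H¹₀(U)` and its differential. -/
def MemSobolevZero (U : Set X) (u : X → ℂ) (w : X → EuclideanSpace ℂ (Fin m)) : Prop :=
  ∃ z ∈ sobolevZero m U, z.fst =ᵐ[(riemannianVolume m).restrict U] u ∧
    z.snd =ᵐ[(riemannianVolume m).restrict U] w

variable {m} {U : Set X}

theorem MemSobolevZero.add {u u' : X → ℂ} {w w' : X → EuclideanSpace ℂ (Fin m)}
    (h : MemSobolevZero m U u w) (h' : MemSobolevZero m U u' w') :
    MemSobolevZero m U (u + u') (w + w') := by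
  obtain ⟨z, hz, h1, h2⟩ := h
  obtain ⟨z', hz', h1', h2'⟩ := h'
  exact ⟨z + z', add_mem hz hz', (Lp.coeFn_add _ _).trans (h1.add h1'),
    (Lp.coeFn_add _ _).trans (h2.add h2')⟩

theorem memSobolevZero_zero : MemSobolevZero m U (0 : X → ℂ) 0 :=
  ⟨0, zero_mem _, Lp.coeFn_zero _ _ _, Lp.coeFn_zero _ _ _⟩

theorem MemSobolevZero.sum {ι : Type*} {s : Finset ι} {u : ι → X → ℂ}
    {w : ι → X → EuclideanSpace ℂ (Fin m)} (h : ∀ i ∈ s, MemSobolevZero m U (u i) (w i)) :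
    MemSobolevZero m U (∑ i ∈ s, u i) (∑ i ∈ s, w i) := by
  classical
  induction s using Finset.induction_on with
  | empty => simpa using memSobolevZero_zero
  | insert i s hi ih =>
    rw [Finset.sum_insert hi, Finset.sum_insert hi]
    exact (h i (Finset.mem_insert_self i s)).add
      (ih fun j hj => h j (Finset.mem_insert_of_mem hj))

theorem MemSobolevZero.congr {u u' : X → ℂ} {w w' : X → EuclideanSpace ℂ (Fin m)}
    (h : MemSobolevZero m U u w) (hu : u =ᵐ[(riemannianVolume m).restrict U] u')
    (hw : w =ᵐ[(riemannianVolume m).restrict U] w') : MemSobolevZero m U u' w' := by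
  obtain ⟨z, hz, h1, h2⟩ := h
  exact ⟨z, hz, h1.trans hu, h2.trans hw⟩

/-- Dominated pointwise convergence of the functions and of their differentials is convergence in
the energy norm, and `H¹₀` is closed. All later approximation arguments pass through this criterion.
-/
theorem MemSobolevZero.of_tendsto {u : ℕ → X → ℂ} {w : ℕ → X → EuclideanSpace ℂ (Fin m)}
    {u₀ : X → ℂ} {w₀ : X → EuclideanSpace ℂ (Fin m)} {b : X → ℝ}
    (hb : MemLp b 2 ((riemannianVolume m).restrict U))
    (h : ∀ n, MemSobolevZero m U (u n) (w n))
    (hub : ∀ n, ∀ᵐ x ∂((riemannianVolume m).restrict U), ‖u n x‖ ≤ b x)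
    (hwb : ∀ n, ∀ᵐ x ∂((riemannianVolume m).restrict U), ‖w n x‖ ≤ b x)
    (hu : ∀ᵐ x ∂((riemannianVolume m).restrict U), Tendsto (fun n => u n x) atTop (𝓝 (u₀ x)))
    (hw : ∀ᵐ x ∂((riemannianVolume m).restrict U), Tendsto (fun n => w n x) atTop (𝓝 (w₀ x))) :
    MemSobolevZero m U u₀ w₀ := by
  choose z hz h1 h2 using h
  obtain ⟨hu2, hut⟩ := tendsto_eLpNorm_two_of_dominated hb
    (fun n => (Lp.aestronglyMeasurable _).congr (h1 n)) hub hu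
  obtain ⟨hw2, hwt⟩ := tendsto_eLpNorm_two_of_dominated hb
    (fun n => (Lp.aestronglyMeasurable _).congr (h2 n)) hwb hw
  have ht1 : Tendsto (fun n => (z n).fst) atTop (𝓝 (hu2.toLp u₀)) := by
    rw [Lp.tendsto_Lp_iff_tendsto_eLpNorm']
    exact hut.congr fun n => eLpNorm_congr_ae ((h1 n).sub hu2.coeFn_toLp).symm
  have ht2 : Tendsto (fun n => (z n).snd) atTop (𝓝 (hw2.toLp w₀)) := by
    rw [Lp.tendsto_Lp_iff_tendsto_eLpNorm']
    exact hwt.congr fun n => eLpNorm_congr_ae ((h2 n).sub hw2.coeFn_toLp).symm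
  have ht : Tendsto z atTop (𝓝 (WithLp.toLp 2 (hu2.toLp u₀, hw2.toLp w₀))) :=
    ((WithLp.prod_continuous_toLp 2 _ _).tendsto _).comp (ht1.prodMk_nhds ht2)
  refine ⟨_, (Submodule.isClosed_topologicalClosure _).mem_of_tendsto ht
    (Eventually.of_forall hz), hu2.coeFn_toLp, hw2.coeFn_toLp⟩

theorem memLp_indicator_const_of_isCompact {K : Set X} (hK : IsCompact K) (C : ℝ) :
    MemLp (K.indicator fun _ => C) 2 ((riemannianVolume m).restrict U) := by
  have := isLocallyFiniteMeasure_riemannianVolume m (X := X)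
  refine memLp_indicator_const 2 hK.measurableSet C (Or.inr ?_)
  exact ((Measure.restrict_apply_le _ _).trans_lt hK.measure_lt_top).ne

/-- The frame is only known to be measurable, so the components need not be continuous. The bound
comes instead from the continuity of the coordinate derivative in each chart, by compactness. -/
theorem exists_norm_differentialComponents_le_of_contMDiff {φ : X → ℂ}
    (hφ : ContMDiff (𝓡 m) 𝓘(ℝ, ℂ) ∞ φ) {K : Set X} (hK : IsCompact K) :
    ∃ C : ℝ, ∀ x ∈ K, ‖differentialComponents m φ x‖ ≤ C := by
  have := ChartedSpace.locallyCompactSpace (EuclideanSpace ℝ (Fin m)) X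
  refine hK.induction_on (p := fun K => ∃ C : ℝ, ∀ x ∈ K, ‖differentialComponents m φ x‖ ≤ C)
    ⟨0, by simp⟩ ?_ ?_ ?_
  · rintro s t hst ⟨C, hC⟩
    exact ⟨C, fun x hx => hC x (hst hx)⟩
  · rintro s t ⟨C, hC⟩ ⟨C', hC'⟩
    exact ⟨max C C', fun x hx => hx.elim (fun h => (hC x h).trans (le_max_left _ _))
      fun h => (hC' x h).trans (le_max_right _ _)⟩
  · intro p _
    obtain ⟨A, hA, hAs, hAc⟩ := local_compact_nhds (chart_source_mem_nhds (EuclideanSpace ℝ (Fin m)) p)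
    refine ⟨A, mem_nhdsWithin_of_mem_nhds hA, ?_⟩
    obtain ⟨C, hC0, hC⟩ := exists_norm_differentialComponents_le m p hAc hAs
    set e := chartAt (EuclideanSpace ℝ (Fin m)) p
    have hc : ContinuousOn (fun x => fderiv ℝ (φ ∘ e.symm) (e x)) A := by
      have h1 : ContDiffOn ℝ ∞ (φ ∘ e.symm) e.target :=
        (hφ.comp_contMDiffOn (contMDiffOn_chart_symm (I := 𝓡 m) (x := p))).contDiffOn
      exact (h1.continuousOn_fderiv_of_isOpen e.open_target (by simp)).comp
        (e.continuousOn.mono hAs) fun x hx => e.map_source (hAs hx)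
    obtain ⟨D, hD⟩ := hAc.exists_bound_of_continuousOn hc
    exact ⟨C * D, fun x hx => (hC x hx φ).trans (mul_le_mul_of_nonneg_left (hD x hx) hC0)⟩

theorem differentialComponents_eq_zero_of_notMem_tsupport {f : X → ℂ} {x : X}
    (hx : x ∉ tsupport f) : differentialComponents m f x = 0 := by
  have h : f =ᶠ[𝓝 x] fun _ => 0 := notMem_tsupport_iff_eventuallyEq.1 hx
  rw [← differentialComponents_zero m x, differentialComponents, differentialComponents,
    differential, differential, h.mfderiv_eq]

/-- The point is square integrability: `φ` and its differential are bounded with compact support,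
and the Riemannian measure is locally finite. -/
theorem IsTestFunction.memSobolevZero {φ : X → ℂ} (hφ : IsTestFunction m U φ) :
    MemSobolevZero m U φ (differentialComponents m φ) := by
  obtain ⟨C, hC⟩ := exists_norm_differentialComponents_le_of_contMDiff hφ.smooth hφ.compact
  obtain ⟨M, hM⟩ := hφ.compact.exists_bound_of_continuous hφ.smooth.continuous
  have h1 : MemLp φ 2 ((riemannianVolume m).restrict U) := by
    refine (memLp_indicator_const_of_isCompact hφ.compact M).of_le
      hφ.smooth.continuous.aestronglyMeasurable (Eventually.of_forall fun x => ?_)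
    by_cases hx : x ∈ tsupport φ
    · simpa [hx] using (hM x).trans (le_abs_self _)
    · simp [image_eq_zero_of_notMem_tsupport hx]
  have h2 : MemLp (differentialComponents m φ) 2 ((riemannianVolume m).restrict U) := by
    refine (memLp_indicator_const_of_isCompact hφ.compact C).of_le
      (measurable_differentialComponents m φ).aestronglyMeasurable
      (Eventually.of_forall fun x => ?_)
    by_cases hx : x ∈ tsupport φ
    · simpa [hx] using (hC x hx).trans (le_abs_self _)
    · simp [differentialComponents_eq_zero_of_notMem_tsupport hx]
  exact ⟨WithLp.toLp 2 (h1.toLp φ, h2.toLp _), Submodule.le_topologicalClosure _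
    ⟨φ, hφ, h1.coeFn_toLp, h2.coeFn_toLp⟩, h1.coeFn_toLp, h2.coeFn_toLp⟩

end SobolevZero

/-! ### Lipschitz functions supported in a chart -/

section LipschitzMembership

set_option linter.unusedSectionVars false

variable {m : ℕ} {X : Type*} [EMetricSpace X] [ChartedSpace (EuclideanSpace ℝ (Fin m)) X]
  [IsManifold (𝓡 m) ∞ X] [RiemannianBundle (fun x : X => TangentSpace (𝓡 m) x)]
  [IsContinuousRiemannianBundle (EuclideanSpace ℝ (Fin m)) (fun x : X => TangentSpace (𝓡 m) x)]
  [SecondCountableTopology X] [MeasurableSpace X] [BorelSpace X] {U : Set X}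

/-- Lipschitz functions with compact support in a chart domain are in `H¹₀`. -/
theorem memSobolevZero_of_locallyLipschitzOn_chart (p : X) (hU : IsOpen U) {u : X → ℂ}
    (hc : HasCompactSupport u) (hs : tsupport u ⊆ (chartAt (EuclideanSpace ℝ (Fin m)) p).source)
    (hsU : tsupport u ⊆ U)
    (hl : LocallyLipschitzOn (chartAt (EuclideanSpace ℝ (Fin m)) p).target
      (u ∘ (chartAt (EuclideanSpace ℝ (Fin m)) p).symm)) :
    MemSobolevZero m U u (differentialComponents m u) := by
  classical
  set e := chartAt (EuclideanSpace ℝ (Fin m)) p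
  set A' := e '' tsupport u
  have hA'c : IsCompact A' := hc.isCompact.image_of_continuousOn (e.continuousOn.mono hs)
  have hA't : A' ⊆ e.target := by
    rintro _ ⟨x, hx, rfl⟩
    exact e.map_source (hs hx)
  -- Since the support of `u` is compact inside the chart domain, extending the coordinate
  -- expression by zero keeps it locally Lipschitz on all of `ℝ^m`, hence globally Lipschitz.
  set g : EuclideanSpace ℝ (Fin m) → ℂ := e.target.indicator (u ∘ e.symm)
  have hgt : ∀ y ∈ e.target, g =ᶠ[𝓝 y] u ∘ e.symm := fun y hy => by
    filter_upwards [e.open_target.mem_nhds hy] with z hz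
    simp [g, hz]
  have hg0 : ∀ y ∉ A', g y = 0 := by
    intro y hy
    by_cases hyt : y ∈ e.target
    · simp only [g, indicator_of_mem hyt, Function.comp_apply]
      refine image_eq_zero_of_notMem_tsupport fun h => hy ⟨_, h, e.right_inv hyt⟩
    · simp [g, hyt]
  have hgs : tsupport g ⊆ A' := closure_minimal (fun y hy => by
    by_contra h
    exact hy (hg0 y h)) hA'c.isClosed
  have hgc : HasCompactSupport g := hA'c.of_isClosed_subset (isClosed_tsupport g) hgs
  have hgl : LocallyLipschitz g := by
    intro y
    by_cases hy : y ∈ e.target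
    · obtain ⟨K, t, ht, hK⟩ := hl hy
      rw [e.open_target.nhdsWithin_eq hy] at ht
      refine ⟨K, t ∩ e.target, inter_mem ht (e.open_target.mem_nhds hy), ?_⟩
      intro z hz z' hz'
      simp only [g, indicator_of_mem hz.2, indicator_of_mem hz'.2]
      exact hK hz.1 hz'.1
    · refine ⟨0, A'ᶜ, hA'c.isClosed.isOpen_compl.mem_nhds fun h => hy (hA't h), ?_⟩
      intro z hz z' hz'
      simp [hg0 z hz, hg0 z' hz']
  obtain ⟨L, hL⟩ := hgl.exists_lipschitzWith_of_hasCompactSupport hgc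
  have hVo : IsOpen (e.target ∩ e.symm ⁻¹' U) := e.isOpen_inter_preimage_symm hU
  have hAV : A' ⊆ e.target ∩ e.symm ⁻¹' U := by
    rintro _ ⟨x, hx, rfl⟩
    refine ⟨e.map_source (hs hx), ?_⟩
    rw [mem_preimage, e.left_inv (hs hx)]
    exact hsU hx
  -- This `r` leaves room for the mollifications: their supports stay in the chart and inside `U`.
  obtain ⟨r, hr, hrV⟩ := hA'c.exists_cthickening_subset_open hVo hAV
  obtain ⟨h, hsm, hsupp, hlim, hdlim, hdb, M, hM⟩ := hL.exists_smooth_approx volume hgc hr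
  set K := Metric.cthickening r A'
  have hKc : IsCompact K := hA'c.cthickening
  have hhK : ∀ n, tsupport (h n) ⊆ K := fun n =>
    (hsupp n).trans (Metric.cthickening_subset_of_subset r hgs)
  have hK'c : IsCompact (e.symm '' K) :=
    hKc.image_of_continuousOn (e.continuousOn_symm.mono fun y hy => (hrV hy).1)
  have hK's : e.symm '' K ⊆ e.source := by
    rintro _ ⟨y, hy, rfl⟩
    exact e.map_target (hrV hy).1
  have hK'U : e.symm '' K ⊆ U := by
    rintro _ ⟨y, hy, rfl⟩
    exact (hrV hy).2
  set φ : ℕ → X → ℂ := fun n => e.source.indicator (h n ∘ e)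
  have hφ0 : ∀ n, ∀ x ∉ e.symm '' K, φ n x = 0 := by
    intro n x hx
    by_cases hxs : x ∈ e.source
    · simp only [φ, indicator_of_mem hxs, Function.comp_apply]
      refine image_eq_zero_of_notMem_tsupport fun h => hx ⟨_, hhK n h, e.left_inv hxs⟩
    · simp [φ, hxs]
  have hφs : ∀ n, tsupport (φ n) ⊆ e.symm '' K := fun n => closure_minimal (fun x hx => by
    by_contra h
    exact hx (hφ0 n x h)) hK'c.isClosed
  have hφtest : ∀ n, IsTestFunction m U (φ n) := by
    intro n
    refine ⟨fun x => ?_, hK'c.of_isClosed_subset (isClosed_tsupport _) (hφs n),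
      (hφs n).trans hK'U⟩
    by_cases hx : x ∈ e.source
    · have h1 : ContMDiffAt (𝓡 m) 𝓘(ℝ, ℂ) ∞ (h n ∘ e) x :=
        (hsm n).contMDiff.contMDiffAt.comp x
          ((contMDiffOn_chart (I := 𝓡 m) (x := p)).contMDiffAt (e.open_source.mem_nhds hx))
      refine h1.congr_of_eventuallyEq ?_
      filter_upwards [e.open_source.mem_nhds hx] with z hz
      simp [φ, hz]
    · refine (contMDiffAt_const (c := (0 : ℂ))).congr_of_eventuallyEq ?_
      filter_upwards [hK'c.isClosed.isOpen_compl.mem_nhds fun h => hx (hK's h)] with z hz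
      exact hφ0 n z hz
  have hfd : ∀ n, ∀ y ∈ e.target, fderiv ℝ (φ n ∘ e.symm) y = fderiv ℝ (h n) y := by
    intro n y hy
    refine Filter.EventuallyEq.fderiv_eq ?_
    filter_upwards [e.open_target.mem_nhds hy] with z hz
    simp [φ, e.map_target hz, e.right_inv hz]
  -- With `M` bounding the mollifications and `C * L` their differentials, a constant on the compact
  -- set `e.symm '' K` dominates the whole sequence.
  obtain ⟨C, hC0, hC⟩ := exists_norm_differentialComponents_le m p hK'c hK's
  refine MemSobolevZero.of_tendsto (b := (e.symm '' K).indicator fun _ => max M (C * L))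
    (memLp_indicator_const_of_isCompact hK'c _) (fun n => (hφtest n).memSobolevZero)
    (fun n => Eventually.of_forall fun x => ?_) (fun n => Eventually.of_forall fun x => ?_)
    (Eventually.of_forall fun x => ?_) (ae_restrict_of_ae ?_)
  · by_cases hx : x ∈ e.symm '' K
    · rw [indicator_of_mem hx]
      refine le_trans ?_ (le_max_left _ _)
      simp only [φ, indicator_of_mem (hK's hx)]
      exact hM n _
    · rw [hφ0 n x hx, indicator_of_notMem hx, norm_zero]
  · by_cases hx : x ∈ e.symm '' K
    · rw [indicator_of_mem hx]
      refine le_trans ?_ (le_max_right _ _)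
      refine (hC x hx _).trans (mul_le_mul_of_nonneg_left ?_ hC0)
      rw [hfd n _ (e.map_source (hK's hx))]
      exact hdb n _
    · rw [differentialComponents_eq_zero_of_notMem_tsupport fun h => hx (hφs n h),
        indicator_of_notMem hx, norm_zero]
  · by_cases hx : x ∈ e.source
    · have h1 := hlim (e x)
      simp only [g, indicator_of_mem (e.map_source hx), Function.comp_apply, e.left_inv hx] at h1
      simpa [φ, hx] using h1
    · have h1 : u x = 0 := image_eq_zero_of_notMem_tsupport fun h => hx (hs h)
      simp [φ, hx, h1]
  -- Almost everywhere convergence of the coordinate derivatives is transported to the manifold by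
  -- the chart, which preserves null sets. Outside the chart domain all differentials vanish.
  · have h1 : ∀ᵐ x ∂((riemannianVolume m).restrict e.source),
        Tendsto (fun n => differentialComponents m (φ n) x) atTop
          (𝓝 (differentialComponents m u x)) := by
      refine ae_restrict_source_of_chart m p ?_
      filter_upwards [ae_restrict_of_ae hdlim, ae_restrict_mem e.open_target.measurableSet]
        with y hy hyt
      have hx := e.map_target hyt
      change Tendsto (fun n => differentialComponents m (φ n) (e.symm y)) atTop
        (𝓝 (differentialComponents m u (e.symm y)))
      simp only [differentialComponents_eq_fderiv m p hx]
      refine ((PiLp.continuous_toLp 2 _).tendsto _).comp (tendsto_pi_nhds.2 fun i => ?_)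
      change Tendsto (fun n => fderiv ℝ (φ n ∘ e.symm) (e (e.symm y)) _) atTop
        (𝓝 (fderiv ℝ (u ∘ e.symm) (e (e.symm y)) _))
      simp only [e.right_inv hyt, hfd _ y hyt]
      rw [← (hgt y hyt).fderiv_eq]
      exact ((ContinuousLinearMap.apply ℝ ℂ _).continuous.tendsto _).comp hy
    filter_upwards [(ae_restrict_iff' e.open_source.measurableSet).1 h1] with x hx
    by_cases hxs : x ∈ e.source
    · exact hx hxs
    · simp [differentialComponents_eq_zero_of_notMem_tsupport fun h => hxs (hs h),
        differentialComponents_eq_zero_of_notMem_tsupport fun h => hxs (hK's (hφs _ h))]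

end LipschitzMembership

/-! ### Products of Lipschitz cut-off functions with test functions -/

section Cutoff

set_option linter.unusedSectionVars false

variable {m : ℕ} {X : Type*} [EMetricSpace X] [ChartedSpace (EuclideanSpace ℝ (Fin m)) X]
  [IsManifold (𝓡 m) ∞ X] [RiemannianBundle (fun x : X => TangentSpace (𝓡 m) x)]
  [IsContinuousRiemannianBundle (EuclideanSpace ℝ (Fin m)) (fun x : X => TangentSpace (𝓡 m) x)]
  [SecondCountableTopology X] [MeasurableSpace X] [BorelSpace X]

theorem mdifferentiableAt_iff_chartAt_self (f : X → ℂ) (x : X) :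
    MDifferentiableAt (𝓡 m) 𝓘(ℝ, ℂ) f x ↔ DifferentiableAt ℝ
      (f ∘ (chartAt (EuclideanSpace ℝ (Fin m)) x).symm)
      (chartAt (EuclideanSpace ℝ (Fin m)) x x) := by
  have h := mdifferentiableAt_iff_chart m (mem_chart_target (EuclideanSpace ℝ (Fin m)) x) f
  rwa [(chartAt (EuclideanSpace ℝ (Fin m)) x).left_inv (mem_chart_source _ x)] at h

theorem differentialComponents_mul {f g : X → ℂ} {x : X}
    (hf : MDifferentiableAt (𝓡 m) 𝓘(ℝ, ℂ) f x) (hg : MDifferentiableAt (𝓡 m) 𝓘(ℝ, ℂ) g x) :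
    differentialComponents m (f * g) x =
      f x • differentialComponents m g x + g x • differentialComponents m f x := by
  rw [mdifferentiableAt_iff_chartAt_self] at hf hg
  have hx := mem_chart_source (EuclideanSpace ℝ (Fin m)) x
  simp only [differentialComponents_eq_fderiv m x hx]
  set e := chartAt (EuclideanSpace ℝ (Fin m)) x
  have h : (f * g) ∘ e.symm = (f ∘ e.symm) * (g ∘ e.symm) := rfl
  ext i
  simp only [h, fderiv_mul hf hg, PiLp.add_apply, PiLp.smul_apply, smul_eq_mul,
    _root_.add_apply, _root_.smul_apply, Function.comp_apply,
    e.left_inv hx]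

theorem differentialComponents_congr {f g : X → ℂ} {x : X} (h : f =ᶠ[𝓝 x] g) :
    differentialComponents m f x = differentialComponents m g x := by
  rw [differentialComponents, differentialComponents, differential, differential, h.mfderiv_eq]

theorem differentialComponents_add_const (f : X → ℂ) (c : ℂ) (x : X) :
    differentialComponents m (fun y => f y + c) x = differentialComponents m f x := by
  have hx := mem_chart_source (EuclideanSpace ℝ (Fin m)) x
  simp only [differentialComponents_eq_fderiv m x hx]
  set e := chartAt (EuclideanSpace ℝ (Fin m)) x
  have h : (fun y => f y + c) ∘ e.symm = fun y => (f ∘ e.symm) y + c := rfl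
  rw [h, fderiv_add_const]

theorem differentialComponents_sum {ι : Type*} (s : Finset ι) {f : ι → X → ℂ} {x : X}
    (hf : ∀ i ∈ s, MDifferentiableAt (𝓡 m) 𝓘(ℝ, ℂ) (f i) x) :
    differentialComponents m (∑ i ∈ s, f i) x = ∑ i ∈ s, differentialComponents m (f i) x := by
  simp only [mdifferentiableAt_iff_chartAt_self] at hf
  have hx := mem_chart_source (EuclideanSpace ℝ (Fin m)) x
  simp only [differentialComponents_eq_fderiv m x hx]
  set e := chartAt (EuclideanSpace ℝ (Fin m)) x
  have h : (∑ i ∈ s, f i) ∘ e.symm = ∑ i ∈ s, f i ∘ e.symm := by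
    ext y
    simp
  ext i
  rw [h, fderiv_sum hf]
  simp

/-- Either the derivative exists and Fermat's criterion applies, or it is zero by convention. It
will be used where a non-negative `χ` vanishes. -/
theorem realDifferential_eq_zero_of_isLocalMin {χ : X → ℝ} {x : X} (h : IsLocalMin χ x) :
    realDifferential m χ x = 0 := by
  have hx := mem_chart_source (EuclideanSpace ℝ (Fin m)) x
  rw [realDifferential, differentialComponents_eq_fderiv m x hx]
  set e := chartAt (EuclideanSpace ℝ (Fin m)) x
  have hmin : IsLocalMin (χ ∘ e.symm) (e x) := by
    have h1 : Tendsto e.symm (𝓝 (e x)) (𝓝 x) := by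
      have := e.continuousAt_symm (e.map_source hx)
      rwa [ContinuousAt, e.left_inv hx] at this
    have h2 := h1.eventually h
    simpa [IsLocalMin, IsMinFilter, e.left_inv hx] using h2
  have h0 : fderiv ℝ ((fun x => (χ x : ℂ)) ∘ e.symm) (e x) = 0 := by
    by_cases hd : DifferentiableAt ℝ ((fun x => (χ x : ℂ)) ∘ e.symm) (e x)
    · have h1 : DifferentiableAt ℝ (χ ∘ e.symm) (e x) :=
        (Complex.reCLM.differentiableAt.comp (e x) hd)
      have h2 := Complex.ofRealCLM.hasFDerivAt.comp (e x) h1.hasFDerivAt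
      rw [hmin.fderiv_eq_zero, ContinuousLinearMap.comp_zero] at h2
      exact h2.fderiv
    · exact fderiv_zero_of_not_differentiableAt hd
  ext i
  simp [h0]

variable [IsRiemannianManifold (𝓡 m) X] {S : Set X} {χ : X → ℝ} {K : ℝ≥0}

theorem LipschitzWith.ofReal_complex {Y : Type*} [PseudoEMetricSpace Y] {f : Y → ℝ} {K : ℝ≥0}
    (hf : LipschitzWith K f) : LipschitzWith K fun x => (f x : ℂ) := by
  have h := Complex.isometry_ofReal.lipschitz.comp hf
  rwa [one_mul] at h

/-- The support of `χ φ` may touch `S`, so the product cannot be mollified directly inside the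
complement of `S`. The truncations `max (χ - η) 0` have support away from `S` and the same Lipschitz
constant, and they approximate `χ` together with its differential. -/
theorem memSobolevZero_cutoff_mul_of_chart (hS : IsClosed S) (hχ : LipschitzWith K χ)
    (hχ01 : ∀ x, χ x ∈ Icc (0 : ℝ) 1) (hχS : ∀ x ∈ S, χ x = 0) (p : X) {φ : X → ℂ}
    (hφ : ContMDiff (𝓡 m) 𝓘(ℝ, ℂ) ∞ φ) (hc : HasCompactSupport φ)
    (hs : tsupport φ ⊆ (chartAt (EuclideanSpace ℝ (Fin m)) p).source) :
    MemSobolevZero m Sᶜ (fun x => χ x * φ x)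
      (fun x => (χ x : ℂ) • differentialComponents m φ x + φ x • realDifferential m χ x) := by
  set e := chartAt (EuclideanSpace ℝ (Fin m)) p
  set η : ℕ → ℝ := fun n => 1 / ((n : ℝ) + 1)
  have hη : ∀ n, 0 < η n := fun n => by positivity
  have hη0 : Tendsto η atTop (𝓝 0) := tendsto_one_div_add_atTop_nhds_zero_nat
  set ξ : ℕ → X → ℂ := fun n x => ((max (χ x - η n) 0 : ℝ) : ℂ)
  have hξL : ∀ n, LipschitzWith K (ξ n) := fun n => by
    have h1 : LipschitzWith K fun x => max (χ x - η n) 0 := by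
      have h2 : LipschitzWith K fun x => χ x - η n := by
        simpa using hχ.sub (LipschitzWith.const (η n))
      simpa using h2.max (LipschitzWith.const (0 : ℝ))
    exact h1.ofReal_complex
  have hξ1 : ∀ n x, ‖ξ n x‖ ≤ 1 := fun n x => by
    simp only [ξ, Complex.norm_real, Real.norm_eq_abs]
    rw [abs_of_nonneg (le_max_right _ _)]
    exact max_le (by linarith [(hχ01 x).2, hη n]) zero_le_one
  obtain ⟨M, hM⟩ := hc.exists_bound_of_continuous hφ.continuous
  obtain ⟨D, hD⟩ := exists_norm_differentialComponents_le_of_contMDiff hφ hc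
  have hM0 : 0 ≤ M := (norm_nonneg _).trans (hM p)
  have hts : ∀ n, tsupport (ξ n * φ) ⊆ tsupport φ := fun n => tsupport_mul_subset_right
  -- The support lies in the closed set where `χ ≥ η n > 0`, which misses `S`.
  have htsS : ∀ n, tsupport (ξ n * φ) ⊆ Sᶜ := by
    intro n x hx hxS
    have h1 : tsupport (ξ n * φ) ⊆ {x | η n ≤ χ x} := by
      refine closure_minimal (fun y hy => ?_) (isClosed_le continuous_const hχ.continuous)
      by_contra h
      refine hy ?_
      rw [mem_ofPred_eq, not_le] at h
      simp [ξ, max_eq_right (sub_nonpos.2 h.le)]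
    have h2 := h1 hx
    rw [mem_ofPred_eq, hχS x hxS] at h2
    exact absurd (hη n) (not_lt.2 h2)
  have hmem : ∀ n, MemSobolevZero m Sᶜ (ξ n * φ) (differentialComponents m (ξ n * φ)) := by
    intro n
    refine memSobolevZero_of_locallyLipschitzOn_chart p hS.isOpen_compl
      (hc.of_isClosed_subset (isClosed_tsupport _) (hts n)) ((hts n).trans hs) (htsS n) ?_
    intro y hy
    obtain ⟨K₁, t₁, ht₁, h₁⟩ := (hξL n).locallyLipschitzOn_chart m p hy
    have hcd : ContDiffAt ℝ 1 (φ ∘ e.symm) y := by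
      have h1 : ContDiffOn ℝ ∞ (φ ∘ e.symm) e.target :=
        (hφ.comp_contMDiffOn (contMDiffOn_chart_symm (I := 𝓡 m) (x := p))).contDiffOn
      exact (h1.contDiffAt (e.open_target.mem_nhds hy)).of_le (by simp)
    obtain ⟨K₂, t₂, ht₂, h₂⟩ := hcd.exists_lipschitzOnWith
    refine ⟨K₂ + Real.toNNReal M * K₁, t₁ ∩ t₂, inter_mem ht₁ (mem_nhdsWithin_of_mem_nhds ht₂),
      LipschitzOnWith.of_dist_le_mul fun z hz z' hz' => ?_⟩
    have d1 := h₁.dist_le_mul z hz.1 z' hz'.1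
    have d2 := h₂.dist_le_mul z hz.2 z' hz'.2
    rw [dist_eq_norm] at d1 d2 ⊢
    have h3 : ((ξ n * φ) ∘ e.symm) z - ((ξ n * φ) ∘ e.symm) z' =
        ξ n (e.symm z) * (φ (e.symm z) - φ (e.symm z')) +
          φ (e.symm z') * (ξ n (e.symm z) - ξ n (e.symm z')) := by
      simp only [Function.comp_apply, Pi.mul_apply]
      ring
    rw [h3]
    refine (norm_add_le _ _).trans ?_
    rw [norm_mul, norm_mul, NNReal.coe_add, NNReal.coe_mul, add_mul, Real.coe_toNNReal M hM0,
      mul_assoc]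
    refine add_le_add ?_ (mul_le_mul (hM _) d1 (norm_nonneg _) hM0)
    exact (mul_le_of_le_one_left (norm_nonneg _) (hξ1 n _)).trans d2
  have hφd : ∀ x, MDifferentiableAt (𝓡 m) 𝓘(ℝ, ℂ) φ x := fun x =>
    hφ.mdifferentiableAt (by simp)
  have hprod : ∀ᵐ x ∂((riemannianVolume m).restrict Sᶜ), ∀ n,
      differentialComponents m (ξ n * φ) x =
        ξ n x • differentialComponents m φ x + φ x • differentialComponents m (ξ n) x := by
    refine ae_restrict_of_ae (ae_all_iff.2 fun n => ?_)
    filter_upwards [(hξL n).ae_mdifferentiableAt m] with x hx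
    exact differentialComponents_mul hx (hφd x)
  have hξlim : ∀ x, Tendsto (fun n => ξ n x) atTop (𝓝 (χ x : ℂ)) := by
    intro x
    refine (Complex.continuous_ofReal.tendsto _).comp ?_
    have h1 : Tendsto (fun n => max (χ x - η n) 0) atTop (𝓝 (max (χ x - 0) 0)) :=
      (tendsto_const_nhds.sub hη0).max tendsto_const_nhds
    rwa [sub_zero, max_eq_left (hχ01 x).1] at h1
  -- Convergence holds at every point. Where `χ` vanishes, it has a minimum and each truncation is
  -- locally zero; where `χ > 0`, the truncation eventually differs from `χ` only by a constant near
  -- the point.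
  have hdξ : ∀ x, Tendsto (fun n => differentialComponents m (ξ n) x) atTop
      (𝓝 (realDifferential m χ x)) := by
    intro x
    rcases (hχ01 x).1.eq_or_lt with h0 | h0
    · rw [realDifferential_eq_zero_of_isLocalMin
        (Eventually.of_forall fun y => h0 ▸ (hχ01 y).1)]
      refine tendsto_const_nhds.congr fun n => ?_
      rw [← differentialComponents_zero m x]
      refine differentialComponents_congr ?_
      have h1 : ∀ᶠ y in 𝓝 x, χ y < η n :=
        hχ.continuous.continuousAt.eventually (gt_mem_nhds (h0 ▸ hη n))
      filter_upwards [h1] with y hy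
      simp [ξ, max_eq_right (sub_nonpos.2 hy.le)]
    · refine tendsto_const_nhds.congr' ?_
      filter_upwards [hη0.eventually (gt_mem_nhds h0)] with n hn
      rw [realDifferential, ← differentialComponents_add_const _ (-(η n : ℂ))]
      refine differentialComponents_congr ?_
      have h1 : ∀ᶠ y in 𝓝 x, η n < χ y :=
        hχ.continuous.continuousAt.eventually (lt_mem_nhds hn)
      filter_upwards [h1] with y hy
      simp only [ξ]
      rw [max_eq_left (sub_nonneg.2 hy.le), Complex.ofReal_sub, sub_eq_add_neg]
  refine MemSobolevZero.of_tendsto (u := fun n => ξ n * φ)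
    (b := (tsupport φ).indicator fun _ => max M (D + M * (√m * K)))
    (memLp_indicator_const_of_isCompact hc _) hmem
    (fun n => Eventually.of_forall fun x => ?_) (fun n => ?_)
    (Eventually.of_forall fun x => (hξlim x).mul_const _) ?_
  · by_cases hx : x ∈ tsupport φ
    · rw [indicator_of_mem hx]
      refine le_trans ?_ (le_max_left _ _)
      rw [Pi.mul_apply, norm_mul]
      exact (mul_le_of_le_one_left (norm_nonneg _) (hξ1 n x)).trans (hM x)
    · simp [image_eq_zero_of_notMem_tsupport hx, hx]
  · filter_upwards [hprod] with x hpx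
    by_cases hx : x ∈ tsupport φ
    · rw [indicator_of_mem hx, hpx n]
      refine le_trans ?_ (le_max_right _ _)
      refine (norm_add_le _ _).trans ?_
      rw [norm_smul, norm_smul]
      refine add_le_add ((mul_le_of_le_one_left (norm_nonneg _) (hξ1 n x)).trans (hD x hx)) ?_
      exact mul_le_mul (hM x) ((hξL n).norm_differentialComponents_le m x) (norm_nonneg _) hM0
    · rw [differentialComponents_eq_zero_of_notMem_tsupport fun h => hx (hts n h),
        indicator_of_notMem hx, norm_zero]
  · filter_upwards [hprod] with x hpx
    simp only [hpx]
    exact ((hξlim x).smul_const _).add ((hdξ x).const_smul _)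

/-- A smooth partition of unity subordinate to the chart domains splits the test function into
finitely many pieces, each handled in its chart. The Leibniz formula is linear in the test function,
so the pieces recombine. -/
theorem memSobolevZero_cutoff_mul (hS : IsClosed S) (hχ : LipschitzWith K χ)
    (hχ01 : ∀ x, χ x ∈ Icc (0 : ℝ) 1) (hχS : ∀ x ∈ S, χ x = 0) {V : Set X} {φ : X → ℂ}
    (hφ : IsTestFunction m V φ) :
    MemSobolevZero m Sᶜ (fun x => χ x * φ x)
      (fun x => (χ x : ℂ) • differentialComponents m φ x + φ x • realDifferential m χ x) := by
  have := ChartedSpace.locallyCompactSpace (EuclideanSpace ℝ (Fin m)) X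
  have : SigmaCompactSpace X := inferInstance
  obtain ⟨f, hf⟩ := SmoothPartitionOfUnity.exists_isSubordinate_chartAt_source (I := 𝓡 m) X
  set J := (f.locallyFinite.finite_nonempty_inter_compact hφ.compact).toFinset with hJ
  have hsum : ∑ i ∈ J, (fun x => (f i x : ℂ) * φ x) = φ := by
    ext x
    rw [Finset.sum_apply, ← Finset.sum_mul]
    by_cases hx : φ x = 0
    · simp [hx]
    have hx' : x ∈ tsupport φ := subset_tsupport _ hx
    have h1 : ∑ i ∈ J, f i x = 1 := by
      rw [← f.sum_eq_one (mem_univ x)]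
      refine (finsum_eq_sum_of_support_subset _ fun i hi => ?_).symm
      rw [hJ, Finite.coe_toFinset]
      exact ⟨x, hi, hx'⟩
    rw [← Complex.ofReal_sum, h1]
    simp
  have hsm : ∀ i, ContMDiff (𝓡 m) 𝓘(ℝ, ℂ) ∞ fun x => (f i x : ℂ) * φ x := fun i => by
    have h1 : (⇑(f i) • φ) = fun x => (f i x : ℂ) * φ x := funext fun x => Complex.real_smul
    rw [← h1]
    exact (f i).contMDiff.smul hφ.smooth
  have hi : ∀ i ∈ J, MemSobolevZero m Sᶜ (fun x => χ x * ((f i x : ℂ) * φ x))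
      (fun x => (χ x : ℂ) • differentialComponents m (fun x => (f i x : ℂ) * φ x) x +
        ((f i x : ℂ) * φ x) • realDifferential m χ x) := fun i _ => by
    refine memSobolevZero_cutoff_mul_of_chart hS hχ hχ01 hχS i (hsm i) ?_ ?_
    · exact hφ.compact.mul_left
    · refine Subset.trans ?_ (hf i)
      refine closure_mono fun x hx => ?_
      contrapose! hx
      simp only [Function.mem_support, not_not] at hx ⊢
      simp [hx]
  refine (MemSobolevZero.sum hi).congr (Eventually.of_forall fun x => ?_)
    (Eventually.of_forall fun x => ?_)
  · simp only [Finset.sum_apply, ← Finset.mul_sum]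
    congr 1
    simpa using congrFun hsum x
  · simp only [Finset.sum_apply, Finset.sum_add_distrib, ← Finset.smul_sum, ← Finset.sum_smul]
    rw [← differentialComponents_sum J fun i _ => (hsm i).mdifferentiableAt (by simp), hsum]
    congr 2
    simpa using congrFun hsum x

end Cutoff

/-! ### Operators on Lebesgue spaces induced by maps of functions -/

section LpMaps

variable {α β G H : Type*} [MeasurableSpace α] [MeasurableSpace β] {μ : Measure α} {ν : Measure β}
  [NormedAddCommGroup G] [NormedSpace ℂ G] [NormedAddCommGroup H] [NormedSpace ℂ H]
  {p q : ℝ≥0∞} [Fact (1 ≤ p)] [Fact (1 ≤ q)]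

/-- The bounded operator between Lebesgue spaces induced by a linear map between spaces of
functions. -/
def lpMapOfBound (T : (α → G) →ₗ[ℂ] (β → H)) (c : ℝ≥0)
    (hT : ∀ f, MemLp f p μ → MemLp (T f) q ν ∧ eLpNorm (T f) q ν ≤ c * eLpNorm f p μ) :
    Lp G p μ →L[ℂ] Lp H q ν :=
  -- Compatibility with almost everywhere equality need not be assumed: the bound, applied to the
  -- null function `f - g`, forces it by linearity.
  have hcongr : ∀ f g : α → G, f =ᵐ[μ] g → T f =ᵐ[ν] T g := fun f g hfg => by
    have h0 : f - g =ᵐ[μ] 0 := by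
      filter_upwards [hfg] with x hx
      simp [hx]
    have h1 := hT (f - g) ((memLp_congr_ae h0).2 MemLp.zero)
    rw [eLpNorm_congr_ae h0, eLpNorm_zero, mul_zero, nonpos_iff_eq_zero,
      eLpNorm_eq_zero_iff h1.1.1 (zero_lt_one.trans_le Fact.out).ne', map_sub] at h1
    filter_upwards [h1.2] with x hx
    exact sub_eq_zero.1 hx
  LinearMap.mkContinuous
    { toFun := fun f => (hT f (Lp.memLp f)).1.toLp (T f)
      map_add' := fun f g => by
        rw [← MemLp.toLp_add, MemLp.toLp_eq_toLp_iff, ← map_add]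
        exact hcongr _ _ (Lp.coeFn_add f g)
      map_smul' := fun a f => by
        rw [RingHom.id_apply, ← MemLp.toLp_const_smul, MemLp.toLp_eq_toLp_iff, ← map_smul]
        exact hcongr _ _ (Lp.coeFn_smul a f) } c fun f => by
    simp only [LinearMap.coe_mk, AddHom.coe_mk]
    rw [Lp.norm_toLp, Lp.norm_def, ← ENNReal.coe_toReal, ← ENNReal.toReal_mul]
    exact ENNReal.toReal_mono (ENNReal.mul_ne_top (by simp) (Lp.eLpNorm_ne_top f))
      (hT f (Lp.memLp f)).2

theorem coeFn_lpMapOfBound (T : (α → G) →ₗ[ℂ] (β → H)) (c : ℝ≥0)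
    (hT : ∀ f, MemLp f p μ → MemLp (T f) q ν ∧ eLpNorm (T f) q ν ≤ c * eLpNorm f p μ)
    (f : Lp G p μ) : lpMapOfBound T c hT f =ᵐ[ν] T f :=
  MemLp.coeFn_toLp (hT f (Lp.memLp f)).1

end LpMaps

/-! ### Continuity of chart integrals with respect to `L²` convergence -/

section WeakDerivatives

set_option linter.unusedSectionVars false

variable {m : ℕ} {X : Type*} [EMetricSpace X] [ChartedSpace (EuclideanSpace ℝ (Fin m)) X]
  [IsManifold (𝓡 m) ∞ X] [RiemannianBundle (fun x : X => TangentSpace (𝓡 m) x)]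
  [IsContinuousRiemannianBundle (EuclideanSpace ℝ (Fin m)) (fun x : X => TangentSpace (𝓡 m) x)]
  [MeasurableSpace X] [BorelSpace X] {U : Set X}
  {G : Type*} [NormedAddCommGroup G] [NormedSpace ℂ G]

/-- Lebesgue measure on `K` is at most a multiple of the measure with the Riemannian density, whose
push-forward is at most the Riemannian measure on `U`. -/
theorem exists_eLpNorm_comp_chart_symm_le (p : X) {K : Set (EuclideanSpace ℝ (Fin m))}
    (hK : IsCompact K) (hKU : K ⊆ (chartAt (EuclideanSpace ℝ (Fin m)) p).target ∩
      (chartAt (EuclideanSpace ℝ (Fin m)) p).symm ⁻¹' U) :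
    ∃ c : ℝ≥0, ∀ f : X → G, MemLp f 2 ((riemannianVolume m).restrict U) →
      MemLp (f ∘ (chartAt (EuclideanSpace ℝ (Fin m)) p).symm) 2 (volume.restrict K) ∧
      eLpNorm (f ∘ (chartAt (EuclideanSpace ℝ (Fin m)) p).symm) 2 (volume.restrict K) ≤
        c * eLpNorm f 2 ((riemannianVolume m).restrict U) := by
  set e := chartAt (EuclideanSpace ℝ (Fin m)) p
  have hKt : K ⊆ e.target := fun y hy => (hKU hy).1
  obtain ⟨c, hc, hcK⟩ := exists_volume_restrict_le_smul m p hK hKt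
  set ν := (volume.restrict K).withDensity fun y => ENNReal.ofReal (chartDensity m p y)
  have hmap : ν.map e.symm ≤ (riemannianVolume m).restrict U := by
    rw [← riemannianVolume_restrict_preimage m p hK.measurableSet hKt]
    refine Measure.restrict_mono (fun x hx => ?_) le_rfl
    have := (hKU hx.2).2
    rwa [mem_preimage, e.left_inv hx.1] at this
  have hae : AEMeasurable e.symm ν :=
    ((aemeasurable_chart_symm m p).mono_measure (Measure.restrict_mono hKt le_rfl)).mono_ac
      (withDensity_absolutelyContinuous _ _)
  refine ⟨(c ^ (1 / (2 : ℝ≥0∞)).toReal).toNNReal, fun f hf => ?_⟩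
  have h1 : MemLp (f ∘ e.symm) 2 ν :=
    (memLp_map_measure_iff (hf.1.mono_measure hmap) hae).1 (hf.mono_measure hmap)
  refine ⟨h1.of_measure_le_smul hc hcK, ?_⟩
  rw [ENNReal.coe_toNNReal (ENNReal.rpow_ne_top_of_nonneg (by simp) hc)]
  calc eLpNorm (f ∘ e.symm) 2 (volume.restrict K) ≤ eLpNorm (f ∘ e.symm) 2 (c • ν) :=
        eLpNorm_mono_measure _ hcK
    _ = c ^ (1 / (2 : ℝ≥0∞)).toReal • eLpNorm (f ∘ e.symm) 2 ν :=
        eLpNorm_smul_measure_of_ne_top (by simp) _ _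
    _ ≤ _ := by
        rw [smul_eq_mul, ← eLpNorm_map_measure (hf.1.mono_measure hmap) hae]
        gcongr

/-- Integrals over compact sets in charts are continuous with respect to convergence in `L²`. -/
theorem continuous_setIntegral_chart (p : X) {K : Set (EuclideanSpace ℝ (Fin m))}
    (hK : IsCompact K) (hKU : K ⊆ (chartAt (EuclideanSpace ℝ (Fin m)) p).target ∩
      (chartAt (EuclideanSpace ℝ (Fin m)) p).symm ⁻¹' U) {θ : EuclideanSpace ℝ (Fin m) → ℂ}
    (hθ : AEStronglyMeasurable θ (volume.restrict K)) {C : ℝ} (hC : ∀ y ∈ K, ‖θ y‖ ≤ C)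
    (ℓ : G →L[ℂ] ℂ) :
    (∀ F : Lp G 2 ((riemannianVolume m).restrict U), IntegrableOn
      (fun y => θ y * ℓ (F ((chartAt (EuclideanSpace ℝ (Fin m)) p).symm y))) K) ∧
    Continuous fun F : Lp G 2 ((riemannianVolume m).restrict U) =>
      ∫ y in K, θ y * ℓ (F ((chartAt (EuclideanSpace ℝ (Fin m)) p).symm y)) := by
  set e := chartAt (EuclideanSpace ℝ (Fin m)) p
  obtain ⟨c, hc⟩ := exists_eLpNorm_comp_chart_symm_le (m := m) (G := G) p hK hKU
  have := (isFiniteMeasure_restrict (μ := volume)).2 hK.measure_lt_top.ne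
  let T : (X → G) →ₗ[ℂ] (EuclideanSpace ℝ (Fin m) → ℂ) :=
    { toFun := fun f y => θ y * ℓ (f (e.symm y))
      map_add' := fun f g => by
        ext y
        simp [mul_add]
      map_smul' := fun a f => by
        ext y
        simp [mul_left_comm] }
  have hT : ∀ f, MemLp f 2 ((riemannianVolume m).restrict U) →
      MemLp (T f) 1 (volume.restrict K) ∧ eLpNorm (T f) 1 (volume.restrict K) ≤
        -- The factor `volume K ^ (1 / 2)` comes from Hölder's inequality, passing from `L²` to `L¹`
        -- on the set `K` of finite measure.
        (Real.toNNReal (C * ‖ℓ‖) * (c * (volume K ^ (1 / 2 : ℝ)).toNNReal) : ℝ≥0) *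
          eLpNorm f 2 ((riemannianVolume m).restrict U) := by
    intro f hf
    obtain ⟨h1, h2⟩ := hc f hf
    have hm : AEStronglyMeasurable (T f) (volume.restrict K) :=
      hθ.mul (ℓ.continuous.comp_aestronglyMeasurable h1.1)
    have hle : ∀ᵐ y ∂(volume.restrict K), ‖T f y‖ ≤ C * ‖ℓ‖ * ‖(f ∘ e.symm) y‖ := by
      filter_upwards [ae_restrict_mem hK.measurableSet] with y hy
      simp only [T, LinearMap.coe_mk, AddHom.coe_mk, norm_mul, Function.comp_apply]
      rw [mul_assoc]
      exact mul_le_mul (hC y hy) (ℓ.le_opNorm _) (norm_nonneg _)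
        ((norm_nonneg _).trans (hC y hy))
    have hb : eLpNorm (T f) 1 (volume.restrict K) ≤
        (Real.toNNReal (C * ‖ℓ‖) * (c * (volume K ^ (1 / 2 : ℝ)).toNNReal) : ℝ≥0) *
          eLpNorm f 2 ((riemannianVolume m).restrict U) := by
      refine (eLpNorm_le_mul_eLpNorm_of_ae_le_mul hle 1).trans ?_
      rw [ENNReal.coe_mul, mul_assoc]
      refine mul_le_mul_right ?_ _
      refine (eLpNorm_le_eLpNorm_mul_rpow_measure_univ (q := 2) (by norm_num) h1.1).trans ?_
      rw [Measure.restrict_apply_univ, ENNReal.coe_mul,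
        ENNReal.coe_toNNReal (ENNReal.rpow_ne_top_of_nonneg (by norm_num)
          hK.measure_lt_top.ne), mul_right_comm]
      norm_num
      gcongr
    exact ⟨⟨hm, hb.trans_lt (ENNReal.mul_lt_top ENNReal.coe_lt_top hf.2)⟩, hb⟩
  have hcoe := fun F => coeFn_lpMapOfBound T _ hT F
  refine ⟨fun F => memLp_one_iff_integrable.1 (hT F (Lp.memLp F)).1, ?_⟩
  refine (continuous_integral.comp (lpMapOfBound T _ hT).continuous).congr fun F => ?_
  exact integral_congr_ae (hcoe F)

end WeakDerivatives

/-! ### The differential of an element of `H¹₀` is its weak differential -/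

section WeakDifferential

set_option linter.unusedSectionVars false

variable {m : ℕ} {X : Type*} [EMetricSpace X] [ChartedSpace (EuclideanSpace ℝ (Fin m)) X]
  [IsManifold (𝓡 m) ∞ X] [RiemannianBundle (fun x : X => TangentSpace (𝓡 m) x)]
  [IsContinuousRiemannianBundle (EuclideanSpace ℝ (Fin m)) (fun x : X => TangentSpace (𝓡 m) x)]
  [SecondCountableTopology X] [MeasurableSpace X] [BorelSpace X] {U : Set X}

/-- Integration by parts in a chart, for smooth functions. -/
theorem integral_chart_of_contMDiff (p : X) (i : Fin m) {φ : X → ℂ}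
    (hφ : ContMDiff (𝓡 m) 𝓘(ℝ, ℂ) ∞ φ) {ψ : EuclideanSpace ℝ (Fin m) → ℝ} (hψ : ContDiff ℝ ∞ ψ)
    (hc : HasCompactSupport ψ) (hs : tsupport ψ ⊆ (chartAt (EuclideanSpace ℝ (Fin m)) p).target) :
    ∫ y, ψ y • fderiv ℝ (φ ∘ (chartAt (EuclideanSpace ℝ (Fin m)) p).symm) y
        (EuclideanSpace.single i 1) =
      -∫ y, fderiv ℝ ψ y (EuclideanSpace.single i 1) •
        φ ((chartAt (EuclideanSpace ℝ (Fin m)) p).symm y) := by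
  set e := chartAt (EuclideanSpace ℝ (Fin m)) p
  have hg : ContDiffOn ℝ ∞ (φ ∘ e.symm) e.target :=
    (hφ.contMDiffOn.comp (contMDiffOn_chart_symm (I := 𝓡 m)) (t := univ) (mapsTo_univ _ _)).contDiffOn
  have hgc := hg.continuousOn
  have hgd : ContinuousOn (fderiv ℝ (φ ∘ e.symm)) e.target :=
    hg.continuousOn_fderiv_of_isOpen e.open_target (by simp)
  have hψd : Continuous fun y => fderiv ℝ ψ y (EuclideanSpace.single i 1) :=
    (hψ.continuous_fderiv (by simp)).clm_apply continuous_const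
  have key : ∀ {a : EuclideanSpace ℝ (Fin m) → ℝ} {b : EuclideanSpace ℝ (Fin m) → ℂ},
      Continuous a → ContinuousOn b e.target → (∀ y ∉ tsupport ψ, a y = 0) →
      Integrable fun y => a y • b y := by
    intro a b ha hb h0
    refine (integrableOn_iff_integrable_of_support_subset (s := tsupport ψ) ?_).1
      ((ha.continuousOn.smul (hb.mono hs)).integrableOn_compact hc)
    intro y hy
    by_contra h
    exact hy (by simp [h0 y h])
  refine integral_smul_fderiv_eq_neg_fderiv_smul_of_integrable ?_ ?_ ?_ ?_ ?_
  · refine key hψd hgc fun y hy => ?_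
    rw [fderiv_of_notMem_tsupport ℝ hy]
    rfl
  · exact key hψ.continuous (hgd.clm_apply continuousOn_const) fun y hy =>
      image_eq_zero_of_notMem_tsupport hy
  · exact key hψ.continuous hgc fun y hy => image_eq_zero_of_notMem_tsupport hy
  · exact fun y _ => (hψ.differentiable (by simp)) y
  · exact fun y hy => (hg.contDiffAt (e.open_target.mem_nhds (hs hy))).differentiableAt (by simp)

/-- The second component of an element of `H¹₀(U)` is the weak differential of the first one. -/
theorem integral_chart_of_mem_sobolevZero (p : X) (i : Fin m) {z : L2Pair m U}
    (hU : IsOpen U) (hz : z ∈ sobolevZero m U) {ψ : EuclideanSpace ℝ (Fin m) → ℝ}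
    (hψ : ContDiff ℝ ∞ ψ) (hc : HasCompactSupport ψ)
    (hs : tsupport ψ ⊆ (chartAt (EuclideanSpace ℝ (Fin m)) p).target ∩
      (chartAt (EuclideanSpace ℝ (Fin m)) p).symm ⁻¹' U) :
    (IntegrableOn (fun y => ψ y • ∑ k, ((inner ℝ (frame m ((chartAt (EuclideanSpace ℝ (Fin m)) p).symm y) k)
        (coordVec m p ((chartAt (EuclideanSpace ℝ (Fin m)) p).symm y) i) : ℝ) : ℂ) *
          z.snd ((chartAt (EuclideanSpace ℝ (Fin m)) p).symm y) k) (tsupport ψ)) ∧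
    ∫ y, ψ y • ∑ k, ((inner ℝ (frame m ((chartAt (EuclideanSpace ℝ (Fin m)) p).symm y) k)
        (coordVec m p ((chartAt (EuclideanSpace ℝ (Fin m)) p).symm y) i) : ℝ) : ℂ) *
          z.snd ((chartAt (EuclideanSpace ℝ (Fin m)) p).symm y) k =
      -∫ y, fderiv ℝ ψ y (EuclideanSpace.single i 1) •
        z.fst ((chartAt (EuclideanSpace ℝ (Fin m)) p).symm y) := by
  set e := chartAt (EuclideanSpace ℝ (Fin m)) p
  set V := e.target ∩ e.symm ⁻¹' U
  set K := tsupport ψ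
  have hKm : MeasurableSet K := (isClosed_tsupport ψ).measurableSet
  have hKt : K ⊆ e.target := hs.trans inter_subset_left
  set θ : EuclideanSpace ℝ (Fin m) → ℂ := fun y =>
    ((fderiv ℝ ψ y (EuclideanSpace.single i 1) : ℝ) : ℂ)
  set η : Fin m → EuclideanSpace ℝ (Fin m) → ℂ := fun k y =>
    ((ψ y * inner ℝ (frame m (e.symm y) k) (coordVec m p (e.symm y) i) : ℝ) : ℂ)
  have hθc : Continuous θ := Complex.continuous_ofReal.comp
    ((hψ.continuous_fderiv (by simp)).clm_apply continuous_const)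
  obtain ⟨C, hC⟩ := hc.isCompact.exists_bound_of_continuousOn hθc.continuousOn
  obtain ⟨-, h1⟩ := continuous_setIntegral_chart (m := m) p hc hs hθc.aestronglyMeasurable
    hC (ContinuousLinearMap.id ℂ ℂ)
  have hN : ContinuousOn (fun y => ψ y * ‖coordVec m p (e.symm y) i‖) K :=
    hψ.continuous.continuousOn.mul ((continuousOn_norm_coordMap m p (EuclideanSpace.single i 1)).comp
      (e.continuousOn_symm.mono hKt) fun y hy => e.map_target (hKt hy))
  obtain ⟨D, hD⟩ := hc.isCompact.exists_bound_of_continuousOn hN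
  have hηm : ∀ k, AEStronglyMeasurable (η k) (volume.restrict K) := fun k => by
    have h2 : AEMeasurable (fun y => inner ℝ (frame m (e.symm y) k) (coordVec m p (e.symm y) i))
        (volume.restrict K) :=
      (measurable_inner_frame_coordVec m p k i).comp_aemeasurable
        ((aemeasurable_chart_symm m p).mono_measure (Measure.restrict_mono hKt le_rfl))
    exact (Complex.measurable_ofReal.comp_aemeasurable
      (hψ.continuous.measurable.aemeasurable.mul h2)).aestronglyMeasurable
  -- The frame enters only measurably, but its vectors are unit vectors. The continuous function
  -- `‖∂_i‖` therefore controls these coefficients on the compact set `K`.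
  have hηD : ∀ k, ∀ y ∈ K, ‖η k y‖ ≤ D := fun k y hy => by
    refine le_trans ?_ (hD y hy)
    simp only [η, Complex.norm_real, norm_mul, Real.norm_eq_abs, abs_norm]
    exact mul_le_mul_of_nonneg_left (norm_inner_frame_le m _ _ _) (abs_nonneg _)
  have h2 := fun k => continuous_setIntegral_chart (m := m) (U := U) p hc hs (hηm k) (hηD k)
    (EuclideanSpace.proj k : EuclideanSpace ℂ (Fin m) →L[ℂ] ℂ)
  have hsum : ∀ F : X → EuclideanSpace ℂ (Fin m), (fun y => ψ y • ∑ k, ((inner ℝ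
      (frame m (e.symm y) k) (coordVec m p (e.symm y) i) : ℝ) : ℂ) * F (e.symm y) k) =
      fun y => ∑ k, η k y * (EuclideanSpace.proj k : EuclideanSpace ℂ (Fin m) →L[ℂ] ℂ)
        (F (e.symm y)) := fun F => by
    ext y
    simp only [η, Complex.real_smul, Finset.mul_sum, Complex.ofReal_mul, mul_assoc]
    rfl
  have hint : ∀ F : L2Form m U, IntegrableOn (fun y => ψ y • ∑ k, ((inner ℝ
      (frame m (e.symm y) k) (coordVec m p (e.symm y) i) : ℝ) : ℂ) * F (e.symm y) k) K :=
    fun F => by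
      rw [hsum]
      exact integrable_finsetSum _ fun k _ => (h2 k).1 F
  refine ⟨hint _, ?_⟩
  have hK1 : ∀ u : X → EuclideanSpace ℂ (Fin m), ∫ y, ψ y • ∑ k, ((inner ℝ
      (frame m (e.symm y) k) (coordVec m p (e.symm y) i) : ℝ) : ℂ) * u (e.symm y) k =
      ∫ y in K, ψ y • ∑ k, ((inner ℝ
      (frame m (e.symm y) k) (coordVec m p (e.symm y) i) : ℝ) : ℂ) * u (e.symm y) k := fun u => by
    refine (setIntegral_eq_integral_of_forall_compl_eq_zero fun y hy => ?_).symm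
    rw [image_eq_zero_of_notMem_tsupport hy, zero_smul]
  have hK2 : ∀ u : X → ℂ, ∫ y, fderiv ℝ ψ y (EuclideanSpace.single i 1) • u (e.symm y) =
      ∫ y in K, θ y * u (e.symm y) := fun u => by
    rw [← setIntegral_eq_integral_of_forall_compl_eq_zero (s := K) fun y hy => ?_]
    · simp only [θ, Complex.real_smul]
    · rw [fderiv_of_notMem_tsupport ℝ hy]
      exact zero_smul _ _
  -- For a fixed `ψ` both sides of the integration by parts formula are continuous in the `L²`
  -- norms. It therefore suffices to prove the formula for test pairs, where it is the classical
  -- one.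
  have hclosed : IsClosed {z : L2Pair m U | (∑ k, ∫ y in K, η k y *
      (EuclideanSpace.proj k : EuclideanSpace ℂ (Fin m) →L[ℂ] ℂ) (z.snd (e.symm y))) =
      -∫ y in K, θ y * z.fst (e.symm y)} := by
    refine isClosed_eq (continuous_finsetSum _ fun k _ => ?_) ?_
    · exact (h2 k).2.comp (WithLp.sndL 2 ℂ (L2 m U) (L2Form m U)).continuous
    · exact (h1.comp (WithLp.fstL 2 ℂ (L2 m U) (L2Form m U)).continuous).neg
  have hform : ∀ z : L2Pair m U, (∑ k, ∫ y in K, η k y *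
      (EuclideanSpace.proj k : EuclideanSpace ℂ (Fin m) →L[ℂ] ℂ) (z.snd (e.symm y))) =
      ∫ y, ψ y • ∑ k, ((inner ℝ (frame m (e.symm y) k)
        (coordVec m p (e.symm y) i) : ℝ) : ℂ) * z.snd (e.symm y) k := fun z => by
    rw [hK1, hsum, integral_finsetSum _ fun k _ => (h2 k).1 z.snd]
  rw [hK2, ← hform]
  refine closure_minimal (s := (testPairs m U : Set (L2Pair m U))) ?_ hclosed hz
  rintro z ⟨φ, hφ, hz1, hz2⟩
  have hz1' : ∀ᵐ y ∂(volume.restrict K), z.fst (e.symm y) = φ (e.symm y) :=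
    ae_restrict_of_ae_restrict_of_subset hs
      (ae_chart_of_ae_riemannianVolume m p hU.measurableSet hz1)
  have hz2' : ∀ᵐ y ∂(volume.restrict K),
      z.snd (e.symm y) = differentialComponents m φ (e.symm y) :=
    ae_restrict_of_ae_restrict_of_subset hs
      (ae_chart_of_ae_riemannianVolume m p hU.measurableSet hz2)
  rw [mem_ofPred_eq, hform, ← hK2, hK1, hK2]
  have e1 : ∫ y in K, θ y * z.fst (e.symm y) = ∫ y in K, θ y * φ (e.symm y) := by
    refine integral_congr_ae ?_
    filter_upwards [hz1'] with y hy
    rw [hy]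
  have e2 : ∫ y, ψ y • fderiv ℝ (φ ∘ e.symm) y (EuclideanSpace.single i 1) =
      ∫ y in K, ψ y • fderiv ℝ (φ ∘ e.symm) y (EuclideanSpace.single i 1) := by
    refine (setIntegral_eq_integral_of_forall_compl_eq_zero fun y hy => ?_).symm
    rw [image_eq_zero_of_notMem_tsupport hy, zero_smul]
  rw [e1, ← hK2 φ, ← integral_chart_of_contMDiff p i hφ.smooth hψ hc hKt, e2]
  refine integral_congr_ae ?_
  filter_upwards [hz2', ae_restrict_mem hKm] with y hy hyK
  rw [hy, ← mfderiv_coordMap m (hKt hyK), ← coordVec_eq_coordMap]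
  congr 1
  exact (apply_eq_sum_frame m _ _ _).symm

/-- The differential of an element of `H¹₀(U)` coincides with any weak differential. -/
theorem snd_eq_covectorComponents_of_hasWeakPartial (hU : IsOpen U) {z : L2Pair m U}
    (hz : z ∈ sobolevZero m U) {w : ∀ x : X, TangentSpace (𝓡 m) x →L[ℝ] ℂ}
    (hw : ∀ (p : X) (i : Fin m), HasWeakPartial m ((chartAt (EuclideanSpace ℝ (Fin m)) p).target ∩
      (chartAt (EuclideanSpace ℝ (Fin m)) p).symm ⁻¹' U) i
      (fun y => z.fst ((chartAt (EuclideanSpace ℝ (Fin m)) p).symm y))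
      (fun y => w ((chartAt (EuclideanSpace ℝ (Fin m)) p).symm y)
        (coordVec m p ((chartAt (EuclideanSpace ℝ (Fin m)) p).symm y) i))) :
    z.snd =ᵐ[(riemannianVolume m).restrict U] fun x => covectorComponents m x (w x) := by
  refine (ae_restrict_iff' hU.measurableSet).2 (ae_riemannianVolume_of_chart m fun p => ?_)
  set e := chartAt (EuclideanSpace ℝ (Fin m)) p
  set V := e.target ∩ e.symm ⁻¹' U
  have hV : IsOpen V := e.isOpen_inter_preimage_symm hU
  -- Both functions satisfy the same integration by parts formula, so the fundamental lemma of the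
  -- calculus of variations applies to their difference.
  have h : ∀ i, ∀ᵐ y, y ∈ V → (∑ k, ((inner ℝ (frame m (e.symm y) k)
      (coordVec m p (e.symm y) i) : ℝ) : ℂ) * z.snd (e.symm y) k) -
        w (e.symm y) (coordVec m p (e.symm y) i) = 0 := by
    intro i
    have hloc : LocallyIntegrableOn (fun y => ∑ k, ((inner ℝ (frame m (e.symm y) k)
      (coordVec m p (e.symm y) i) : ℝ) : ℂ) * z.snd (e.symm y) k) V := by
      intro x hx
      obtain ⟨r, hr, hrV⟩ := Metric.nhds_basis_closedBall.mem_iff.1 (hV.mem_nhds hx)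
      -- Local integrability is read off from the integrability of `ψ` times the function, with a
      -- bump function equal to one near `x`.
      let ψ : ContDiffBump x := ⟨r / 2, r, by positivity, by linarith⟩
      have h1 := (integral_chart_of_mem_sobolevZero p i hU hz (ψ := ψ) ψ.contDiff
        ψ.hasCompactSupport (by rw [ψ.tsupport_eq]; exact hrV)).1
      have h2 : ∀ y ∈ Metric.closedBall x (r / 2), ψ y = 1 := fun y hy =>
        ψ.one_of_mem_closedBall hy
      refine ⟨Metric.closedBall x (r / 2),
        mem_nhdsWithin_of_mem_nhds (Metric.closedBall_mem_nhds _ (by positivity)), ?_⟩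
      refine (h1.mono_set fun y hy => ?_).congr_fun (fun y hy => ?_)
        Metric.isClosed_closedBall.measurableSet
      · exact subset_tsupport _ (by simp [h2 y hy])
      · simp only [h2 y hy, one_smul]
        rfl
    refine hV.ae_eq_zero_of_integral_contDiff_smul_eq_zero (hloc.sub (hw p i).2.1)
      fun ψ hψ hψc hψs => ?_
    obtain ⟨h1, h2⟩ := integral_chart_of_mem_sobolevZero p i hU hz hψ hψc hψs
    have h3 := (hw p i).2.2 ψ hψ hψc hψs
    rw [h3, neg_neg] at h2
    simp only [smul_sub]
    rw [integral_sub, h2, sub_self]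
    · refine (integrableOn_iff_integrable_of_support_subset fun y hy => ?_).1 h1
      by_contra hy'
      exact hy (by simp [image_eq_zero_of_notMem_tsupport hy'])
    · refine (integrableOn_iff_integrable_of_support_subset (s := tsupport ψ) fun y hy => ?_).1 ?_
      · by_contra hy'
        exact hy (by simp [image_eq_zero_of_notMem_tsupport hy'])
      · exact ((hw p i).2.1.integrableOn_compact_subset hψs hψc).continuousOn_smul
          hψ.continuous.continuousOn hψc
  rw [ae_restrict_iff' e.open_target.measurableSet]
  filter_upwards [ae_all_iff.2 h] with y hy hyt hyU
  have hx := e.map_target hyt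
  set x := e.symm y
  -- The covector is rebuilt from its frame components. It agrees with `w x` on the coordinate
  -- vectors, which span, and so has the same components in the frame.
  set D : TangentSpace (𝓡 m) x →L[ℝ] ℂ :=
    ∑ k, (innerSL ℝ (frame m x k)).smulRight (z.snd x k)
  have hD : ∀ v, D v = ∑ k, ((inner ℝ (frame m x k) v : ℝ) : ℂ) * z.snd x k := fun v => by
    simp [D]
  have hDw : D = w x := continuousLinearMap_ext_coordVec m hx fun i => by
    rw [hD]
    exact sub_eq_zero.1 (hy i ⟨hyt, hyU⟩)
  ext k
  rw [← hDw]
  simp only [covectorComponents, hD]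
  rw [Finset.sum_eq_single k]
  · simp [(orthonormal_frame m x).1 k]
  · intro j _ hj
    simp [(orthonormal_frame m x).2 hj]
  · simp

end WeakDifferential

/-! ### Extension by zero and restriction in `L²` -/

section LpMaps

set_option linter.unusedSectionVars false

variable {α G H : Type*} [MeasurableSpace α] {μ ν : Measure α}
  [NormedAddCommGroup G] [NormedSpace ℂ G] [NormedAddCommGroup H] [NormedSpace ℂ H]

theorem eLpNorm_restrict_of_pointwise_le {p : ℝ≥0∞} (hνμ : ν ≤ μ) {f : α → G} {g : α → H}
    {c : ℝ≥0} (h : ∀ x, ‖g x‖ ≤ c * ‖f x‖) : eLpNorm g p ν ≤ c * eLpNorm f p μ := by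
  have h1 := eLpNorm_le_nnreal_smul_eLpNorm_of_ae_le_mul (μ := ν) (f := g) (g := f) (c := c)
    (Eventually.of_forall h) p
  rw [ENNReal.smul_def, smul_eq_mul] at h1
  exact h1.trans (mul_le_mul_right (eLpNorm_mono_measure f hνμ) _)

/-- The operator induced by a pointwise bounded linear map, followed by the passage to a smaller
measure. -/
def lpMapOfPointwise (hνμ : ν ≤ μ) (T : (α → G) →ₗ[ℂ] (α → H)) (c : ℝ≥0)
    (hm : ∀ f, AEStronglyMeasurable f ν → AEStronglyMeasurable (T f) ν)
    (hT : ∀ f x, ‖T f x‖ ≤ c * ‖f x‖) : Lp G 2 μ →L[ℂ] Lp H 2 ν :=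
  lpMapOfBound T c fun f hf => by
    have h := eLpNorm_restrict_of_pointwise_le (p := 2) hνμ (hT f)
    exact ⟨⟨hm f (hf.1.mono_measure hνμ), h.trans_lt (ENNReal.mul_lt_top ENNReal.coe_lt_top hf.2)⟩,
      h⟩

theorem coeFn_lpMapOfPointwise (hνμ : ν ≤ μ) (T : (α → G) →ₗ[ℂ] (α → H)) (c : ℝ≥0)
    (hm : ∀ f, AEStronglyMeasurable f ν → AEStronglyMeasurable (T f) ν)
    (hT : ∀ f x, ‖T f x‖ ≤ c * ‖f x‖) (f : Lp G 2 μ) :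
    lpMapOfPointwise hνμ T c hm hT f =ᵐ[ν] T f :=
  coeFn_lpMapOfBound _ _ _ f

/-- The passage to a smaller measure. -/
def lpRestrict (hνμ : ν ≤ μ) : Lp G 2 μ →L[ℂ] Lp G 2 ν :=
  lpMapOfPointwise hνμ LinearMap.id 1 (fun _ h => h) fun f x => by simp

theorem coeFn_lpRestrict (hνμ : ν ≤ μ) (f : Lp G 2 μ) : lpRestrict hνμ f =ᵐ[ν] f :=
  coeFn_lpMapOfPointwise _ _ _ _ _ f

variable {s t : Set α}

/-- Extension by zero. -/
def lpExtend (hs : MeasurableSet s) (hst : s ⊆ t) :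
    Lp G 2 (μ.restrict s) →L[ℂ] Lp G 2 (μ.restrict t) :=
  lpMapOfBound
    { toFun := fun f => s.indicator f
      map_add' := fun f g => indicator_add s f g
      map_smul' := fun c f => indicator_const_smul s c f } 1 fun f hf => by
    have h : (μ.restrict t).restrict s = μ.restrict s := by
      rw [Measure.restrict_restrict hs, inter_eq_left.2 hst]
    simp only [LinearMap.coe_mk, AddHom.coe_mk, ENNReal.coe_one, one_mul]
    rw [memLp_indicator_iff_restrict hs, eLpNorm_indicator_eq_eLpNorm_restrict hs, h]
    exact ⟨hf, le_rfl⟩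

theorem coeFn_lpExtend (hs : MeasurableSet s) (hst : s ⊆ t) {f : Lp G 2 (μ.restrict s)}
    {g : α → G} (hfg : f =ᵐ[μ.restrict s] g) :
    lpExtend hs hst f =ᵐ[μ.restrict t] s.indicator g := by
  refine (coeFn_lpMapOfBound _ _ _ f).trans ?_
  refine ae_restrict_of_ae ?_
  filter_upwards [(ae_restrict_iff' hs).1 hfg] with x hx
  by_cases hxs : x ∈ s
  · simp [hxs, hx hxs]
  · simp [hxs]

theorem norm_lpExtend_le (hs : MeasurableSet s) (hst : s ⊆ t) (f : Lp G 2 (μ.restrict s)) :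
    ‖lpExtend hs hst f‖ ≤ ‖f‖ := by
  rw [Lp.norm_def, Lp.norm_def, eLpNorm_congr_ae (coeFn_lpExtend hs hst EventuallyEq.rfl),
    eLpNorm_indicator_eq_eLpNorm_restrict hs, Measure.restrict_restrict hs, inter_eq_left.2 hst]

theorem lpRestrict_lpExtend (hs : MeasurableSet s) (hst : s ⊆ t) (f : Lp G 2 (μ.restrict s)) :
    lpRestrict (Measure.restrict_mono hst le_rfl) (lpExtend hs hst f) = f := by
  refine Lp.ext ((coeFn_lpRestrict _ _).trans ?_)
  filter_upwards [ae_restrict_of_ae_restrict_of_subset hst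
    (coeFn_lpExtend hs hst (EventuallyEq.refl _ f)), ae_restrict_mem hs] with x hx hxs
  rw [hx, indicator_of_mem hxs]

theorem lpExtend_lpRestrict (hs : MeasurableSet s) (hst : s ⊆ t) {f : Lp G 2 (μ.restrict t)}
    (hf : ∀ᵐ x ∂(μ.restrict t), x ∉ s → f x = 0) :
    lpExtend hs hst (lpRestrict (Measure.restrict_mono hst le_rfl) f) = f := by
  refine Lp.ext ((coeFn_lpExtend hs hst (coeFn_lpRestrict _ f)).trans ?_)
  filter_upwards [hf] with x hx
  by_cases hxs : x ∈ s
  · simp [hxs]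
  · simp [hxs, hx hxs]

variable {E : Type*} [NormedAddCommGroup E] [InnerProductSpace ℂ E]

/-- Extension by zero and restriction are adjoint. This removes the adjointness error altogether and
reduces the comparison of the two forms to an inner product on the smaller set. -/
theorem inner_lpExtend_left (hs : MeasurableSet s) (hst : s ⊆ t) (f : Lp E 2 (μ.restrict s))
    (g : Lp E 2 (μ.restrict t)) :
    inner ℂ (lpExtend hs hst f) g =
      inner ℂ f (lpRestrict (Measure.restrict_mono hst le_rfl) g) := by
  have h : (μ.restrict t).restrict s = μ.restrict s := by
    rw [Measure.restrict_restrict hs, inter_eq_left.2 hst]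
  rw [L2.inner_def, L2.inner_def]
  calc ∫ x, inner ℂ (lpExtend hs hst f x) (g x) ∂(μ.restrict t)
      = ∫ x, s.indicator (fun x => inner ℂ (f x) (g x)) x ∂(μ.restrict t) := by
        refine integral_congr_ae ?_
        filter_upwards [coeFn_lpExtend hs hst (EventuallyEq.refl _ f)] with x hx
        rw [hx]
        by_cases hxs : x ∈ s <;> simp [hxs]
    _ = ∫ x, inner ℂ (f x) (g x) ∂(μ.restrict s) := by rw [integral_indicator hs, h]
    _ = _ := by
        refine integral_congr_ae ?_
        filter_upwards [coeFn_lpRestrict (Measure.restrict_mono hst le_rfl) g] with x hx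
        rw [hx]

/-- This is Cauchy-Schwarz localized to `s`: `g` is the extension of its own restriction, and the
extension moves to the other factor as a restriction. It brings in the norm of `df` on the annulus
alone. -/
theorem norm_inner_le_of_eq_zero (hs : MeasurableSet s) (hst : s ⊆ t)
    (f g : Lp E 2 (μ.restrict t)) (hg : ∀ᵐ x ∂(μ.restrict t), x ∉ s → g x = 0) :
    ‖inner ℂ f g‖ ≤ (eLpNorm f 2 (μ.restrict s)).toReal * (eLpNorm g 2 (μ.restrict s)).toReal := by
  have h : μ.restrict s ≤ μ.restrict t := Measure.restrict_mono hst le_rfl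
  rw [← lpExtend_lpRestrict hs hst hg, ← inner_conj_symm, RCLike.norm_conj, inner_lpExtend_left]
  refine (norm_inner_le_norm _ _).trans (le_of_eq ?_)
  rw [mul_comm, Lp.norm_def, Lp.norm_def, eLpNorm_congr_ae (coeFn_lpRestrict h f),
    eLpNorm_congr_ae (coeFn_lpRestrict h g), lpExtend_lpRestrict hs hst hg]

end LpMaps

/-! ### Operators on Hilbert space sums and on closures -/

section HilbertSum

variable {E F G H : Type*} [NormedAddCommGroup E] [NormedSpace ℂ E] [NormedAddCommGroup F]
  [NormedSpace ℂ F] [NormedAddCommGroup G] [NormedSpace ℂ G] [NormedAddCommGroup H]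
  [NormedSpace ℂ H]

/-- The operator into a Hilbert space sum with the given components. -/
def prodLift (A : E →L[ℂ] G) (D : E →L[ℂ] H) : E →L[ℂ] WithLp 2 (G × H) :=
  (WithLp.prodContinuousLinearEquiv 2 ℂ G H).symm.toContinuousLinearMap.comp (A.prod D)

/-- An operator which maps `s` into the closure of `t` maps the closure of `s` there, too. -/
def mapTopologicalClosure (T : E →L[ℂ] F) (s : Submodule ℂ E) (t : Submodule ℂ F)
    (h : ∀ z ∈ s, T z ∈ t.topologicalClosure) :
    s.topologicalClosure →L[ℂ] t.topologicalClosure :=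
  (T.comp s.topologicalClosure.subtypeL).codRestrict t.topologicalClosure fun z =>
    closure_minimal (s := (s : Set E)) h
      (t.isClosed_topologicalClosure.preimage T.continuous) z.2

end HilbertSum

/-! ### Extension by zero and cut-off as operators between Sobolev spaces -/

section SobolevMaps

set_option linter.unusedSectionVars false

variable {m : ℕ} {X : Type*} [EMetricSpace X] [ChartedSpace (EuclideanSpace ℝ (Fin m)) X]
  [IsManifold (𝓡 m) ∞ X] [RiemannianBundle (fun x : X => TangentSpace (𝓡 m) x)]
  [IsContinuousRiemannianBundle (EuclideanSpace ℝ (Fin m)) (fun x : X => TangentSpace (𝓡 m) x)]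
  [SecondCountableTopology X] [MeasurableSpace X] [BorelSpace X] {U V : Set X}

theorem norm_sobolevDifferential_le (u : sobolevZero m U) :
    ‖sobolevDifferential m U u‖ ≤ ‖u‖ :=
  WithLp.norm_snd_le _ (u : L2Pair m U)

/-- An operator on pairs which maps test pairs into `H¹₀` induces an operator on `H¹₀`. -/
def sobolevMap (A : L2Pair m U →L[ℂ] L2 m V) (D : L2Pair m U →L[ℂ] L2Form m V)
    (h : ∀ z ∈ testPairs m U, WithLp.toLp 2 (A z, D z) ∈ sobolevZero m V) :
    sobolevZero m U →L[ℂ] sobolevZero m V :=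
  mapTopologicalClosure (prodLift A D) (testPairs m U) (testPairs m V) h

variable (m) in
/-- Extension by zero, from `H¹₀(U)` to `H¹₀(V)`. -/
def sobolevExtend (hU : MeasurableSet U) (hUV : U ⊆ V) : sobolevZero m U →L[ℂ] sobolevZero m V :=
  sobolevMap ((lpExtend hU hUV).comp (WithLp.fstL 2 ℂ (L2 m U) (L2Form m U)))
    ((lpExtend hU hUV).comp (WithLp.sndL 2 ℂ (L2 m U) (L2Form m U))) fun z hz => by
    obtain ⟨φ, hφ, h1, h2⟩ := hz
    refine Submodule.le_topologicalClosure _ ⟨φ, ⟨hφ.smooth, hφ.compact, hφ.supp.trans hUV⟩, ?_, ?_⟩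
    · refine (coeFn_lpExtend hU hUV h1).trans (EventuallyEq.of_eq ?_)
      exact indicator_eq_self.2 ((subset_tsupport φ).trans hφ.supp)
    · refine (coeFn_lpExtend hU hUV h2).trans (EventuallyEq.of_eq ?_)
      refine indicator_eq_self.2 fun x hx => hφ.supp ?_
      by_contra h
      exact hx (differentialComponents_eq_zero_of_notMem_tsupport h)

variable {S : Set X} {χ : X → ℝ}

/-- Multiplication of functions or forms with a continuous function `χ` with values in `[0,1]`. -/
def lpCutoff {G : Type*} [NormedAddCommGroup G] [NormedSpace ℂ G] (hχ : Continuous χ)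
    (hχ01 : ∀ x, χ x ∈ Icc (0 : ℝ) 1) {μ ν : Measure X} (hνμ : ν ≤ μ) :
    Lp G 2 μ →L[ℂ] Lp G 2 ν :=
  lpMapOfPointwise hνμ
    { toFun := fun f x => (χ x : ℂ) • f x
      map_add' := fun f g => by ext; simp
      map_smul' := fun c f => funext fun x => smul_comm _ _ _ } 1
    (fun f hf => (Complex.continuous_ofReal.comp hχ).aestronglyMeasurable.smul hf) fun f x => by
      simp only [LinearMap.coe_mk, AddHom.coe_mk, norm_smul, Complex.norm_real, Real.norm_eq_abs,
        abs_of_nonneg (hχ01 x).1, NNReal.coe_one]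
      exact mul_le_mul_of_nonneg_right (hχ01 x).2 (norm_nonneg _)

theorem coeFn_lpCutoff {G : Type*} [NormedAddCommGroup G] [NormedSpace ℂ G] (hχ : Continuous χ)
    (hχ01 : ∀ x, χ x ∈ Icc (0 : ℝ) 1) {μ ν : Measure X} (hνμ : ν ≤ μ) (f : Lp G 2 μ) :
    lpCutoff hχ hχ01 hνμ f =ᵐ[ν] fun x => (χ x : ℂ) • f x :=
  coeFn_lpMapOfPointwise _ _ _ _ _ f

/-- Multiplication of functions with a bounded measurable form. -/
def lpSMulForm {w : X → EuclideanSpace ℂ (Fin m)} (hw : Measurable w) {c : ℝ≥0}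
    (hc : ∀ x, ‖w x‖ ≤ c) {μ ν : Measure X} (hνμ : ν ≤ μ) :
    Lp ℂ 2 μ →L[ℂ] Lp (EuclideanSpace ℂ (Fin m)) 2 ν :=
  lpMapOfPointwise hνμ
    { toFun := fun f x => f x • w x
      map_add' := fun f g => by ext; simp [add_mul]
      map_smul' := fun c f => by ext; simp [mul_assoc] } c
    (fun f hf => hf.smul hw.aestronglyMeasurable) fun f x => by
      simp only [LinearMap.coe_mk, AddHom.coe_mk, norm_smul]
      rw [mul_comm]
      exact mul_le_mul_of_nonneg_right (hc x) (norm_nonneg _)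

theorem coeFn_lpSMulForm {w : X → EuclideanSpace ℂ (Fin m)} (hw : Measurable w) {c : ℝ≥0}
    (hc : ∀ x, ‖w x‖ ≤ c) {μ ν : Measure X} (hνμ : ν ≤ μ) (f : Lp ℂ 2 μ) :
    lpSMulForm hw hc hνμ f =ᵐ[ν] fun x => f x • w x :=
  coeFn_lpMapOfPointwise _ _ _ _ _ f

variable [IsRiemannianManifold (𝓡 m) X]

/-- Multiplication with a Lipschitz cut-off function which vanishes on `S`, followed by the
restriction to the complement of `S`, maps `H¹₀(V)` into `H¹₀(X ∖ S)`. -/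
theorem exists_sobolevCutoff (hS : IsClosed S) {K : ℝ≥0} (hχ : LipschitzWith K χ)
    (hχ01 : ∀ x, χ x ∈ Icc (0 : ℝ) 1) (hχS : ∀ x ∈ S, χ x = 0) (hSV : Sᶜ ⊆ V) :
    ∃ T : sobolevZero m V →L[ℂ] sobolevZero m Sᶜ, ∀ u,
      sobolevInclusion m Sᶜ (T u) =ᵐ[(riemannianVolume m).restrict Sᶜ]
        (fun x => (χ x : ℂ) * sobolevInclusion m V u x) ∧
      sobolevDifferential m Sᶜ (T u) =ᵐ[(riemannianVolume m).restrict Sᶜ]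
        fun x => (χ x : ℂ) • sobolevDifferential m V u x +
          sobolevInclusion m V u x • realDifferential m χ x := by
  have hle : (riemannianVolume m).restrict Sᶜ ≤ (riemannianVolume m).restrict V :=
    Measure.restrict_mono hSV le_rfl
  -- Boundedness of `dχ` makes `u ↦ u dχ` a bounded operator on `L²`. The Leibniz formula is then
  -- continuous on pairs, and membership in `H¹₀` needs checking only on test pairs.
  have hbound : ∀ x, ‖realDifferential m χ x‖ ≤ (⟨√m * K, by positivity⟩ : ℝ≥0) :=
    hχ.ofReal_complex.norm_differentialComponents_le m
  have hmeas : Measurable (realDifferential m χ) := measurable_differentialComponents m _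
  set M₀ : L2 m V →L[ℂ] L2 m Sᶜ := lpCutoff hχ.continuous hχ01 hle
  set M₁ : L2Form m V →L[ℂ] L2Form m Sᶜ := lpCutoff hχ.continuous hχ01 hle
  set M₂ : L2 m V →L[ℂ] L2Form m Sᶜ := lpSMulForm hmeas hbound hle
  have h0 : ∀ u : L2 m V, M₀ u =ᵐ[(riemannianVolume m).restrict Sᶜ] fun x => (χ x : ℂ) * u x :=
    coeFn_lpCutoff hχ.continuous hχ01 hle
  have h1 : ∀ z : L2Pair m V, (M₁ z.snd + M₂ z.fst : L2Form m Sᶜ)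
      =ᵐ[(riemannianVolume m).restrict Sᶜ]
      fun x => (χ x : ℂ) • z.snd x + z.fst x • realDifferential m χ x := fun z =>
    (Lp.coeFn_add _ _).trans ((coeFn_lpCutoff hχ.continuous hχ01 hle z.snd).add
      (coeFn_lpSMulForm hmeas hbound hle z.fst))
  refine ⟨sobolevMap (M₀.comp (WithLp.fstL 2 ℂ (L2 m V) (L2Form m V)))
    (M₁.comp (WithLp.sndL 2 ℂ (L2 m V) (L2Form m V)) +
      M₂.comp (WithLp.fstL 2 ℂ (L2 m V) (L2Form m V))) ?_, fun u => ⟨h0 _, h1 _⟩⟩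
  rintro z ⟨φ, hφ, hz1, hz2⟩
  obtain ⟨z', hz', hz1', hz2'⟩ := memSobolevZero_cutoff_mul hS hχ hχ01 hχS hφ
  have hz1 := ae_restrict_of_ae_restrict_of_subset hSV hz1
  have hz2 := ae_restrict_of_ae_restrict_of_subset hSV hz2
  have e1 : z'.fst = M₀ z.fst := by
    refine Lp.ext (hz1'.trans (EventuallyEq.trans ?_ (h0 z.fst).symm))
    filter_upwards [hz1] with x hx
    rw [hx]
  have e2 : z'.snd = M₁ z.snd + M₂ z.fst := by
    refine Lp.ext (hz2'.trans (EventuallyEq.trans ?_ (h1 z).symm))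
    filter_upwards [hz1, hz2] with x hx hx'
    rw [hx, hx']
  have e : WithLp.toLp 2 (M₀ z.fst, M₁ z.snd + M₂ z.fst) = z' := by
    rw [← e1, ← e2]
    rfl
  exact e ▸ hz'

end SobolevMaps

/-! ### The annulus and the supremum norm of the differential of the cut-off function -/

section Cutoff

set_option linter.unusedSectionVars false

variable {m : ℕ} {X : Type*} [EMetricSpace X] [ChartedSpace (EuclideanSpace ℝ (Fin m)) X]
  [IsManifold (𝓡 m) ∞ X] [RiemannianBundle (fun x : X => TangentSpace (𝓡 m) x)]
  [IsContinuousRiemannianBundle (EuclideanSpace ℝ (Fin m)) (fun x : X => TangentSpace (𝓡 m) x)]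
  [SecondCountableTopology X] [MeasurableSpace X] [BorelSpace X] {S : Set X} {χ : X → ℝ}

theorem measurableSet_annulus (hS : IsClosed S) : MeasurableSet (annulus m S χ) :=
  Measure.isClosed_support.measurableSet.diff hS.measurableSet

/-- By second countability the complement of the support of a measure is null for that measure. -/
theorem ae_realDifferential_eq_zero :
    ∀ᵐ x ∂(riemannianVolume m), x ∉ differentialSupport m χ → realDifferential m χ x = 0 := by
  have h : ((riemannianVolume m).restrict {x | realDifferential m χ x ≠ 0})
      (differentialSupport m χ)ᶜ = 0 := Measure.measure_compl_support
  have hm : MeasurableSet (differentialSupport m χ)ᶜ :=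
    (Measure.isClosed_support (μ := (riemannianVolume m).restrict _)).measurableSet.compl
  rw [Measure.restrict_apply hm] at h
  refine measure_mono_null (fun x hx => ?_) h
  simpa using hx

/-- The Lipschitz property makes the essential supremum finite, so that its conversion to a real
number does not produce the default value zero. -/
theorem ae_norm_realDifferential_le [IsRiemannianManifold (𝓡 m) X] {K : ℝ≥0}
    (hχ : LipschitzWith K χ) :
    ∀ᵐ x ∂(riemannianVolume m), ‖realDifferential m χ x‖ ≤ differentialSupNorm m χ := by
  have hb : ∀ x, ‖realDifferential m χ x‖ ≤ √m * K :=
    hχ.ofReal_complex.norm_differentialComponents_le m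
  have hfin : eLpNorm (realDifferential m χ) ⊤ (riemannianVolume m) ≠ ⊤ :=
    (memLp_top_of_bound (measurable_differentialComponents m _).aestronglyMeasurable _
      (Eventually.of_forall hb)).2.ne
  filter_upwards [ae_le_eLpNormEssSup (f := realDifferential m χ) (μ := riemannianVolume m)]
    with x hx
  rw [differentialSupNorm, ← toReal_enorm]
  exact ENNReal.toReal_mono hfin (by rwa [eLpNorm_exponent_top])

end Cutoff

theorem Lp_norm_le_of_eLpNorm_le {α G : Type*} [MeasurableSpace α] {μ : Measure α}
    [NormedAddCommGroup G] {p : ℝ≥0∞} {f : Lp G p μ} {g : α → G} {c : ℝ} (hfg : f =ᵐ[μ] g)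
    (hc : 0 ≤ c) (h : eLpNorm g p μ ≤ ENNReal.ofReal c) : ‖f‖ ≤ c := by
  rw [Lp.norm_def, eLpNorm_congr_ae hfg]
  exact ENNReal.toReal_le_of_le_ofReal hc h

end

/-! ### Quasi-unitary equivalence of the Dirichlet forms -/

theorem mainTheorem3 (m : ℕ) {X : Type*} [EMetricSpace X]
    [ChartedSpace (EuclideanSpace ℝ (Fin m)) X] [IsManifold (𝓡 m) ∞ X]
    [RiemannianBundle (fun x : X => TangentSpace (𝓡 m) x)]
    [IsContMDiffRiemannianBundle (𝓡 m) ∞ (EuclideanSpace ℝ (Fin m))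
      (fun x : X => TangentSpace (𝓡 m) x)]
    [IsRiemannianManifold (𝓡 m) X] [SecondCountableTopology X] [MeasurableSpace X] [BorelSpace X]
    (ε₀ : ℝ) (B : ℝ → Set X) (S : Set X) (χ : ℝ → X → ℝ) (δ' δ'' δbar : ℝ → ℝ) (C : ℝ)
    (hB : IsDirichletSolidifying m ε₀ B S χ δ' δ'' δbar C) :
    ∀ ε ∈ Set.Ioc 0 ε₀,
      QuasiUnitarilyEquivalentOfOrderTwo (dirichletForm m Sᶜ) (dirichletForm m (B ε)ᶜ)
        (max (δbar ε) (max (δ' ε)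
          (C * (δ'' ε + δ' ε * δ'' ε * differentialSupNorm m (χ ε))))) := by
  intro ε hε
  set μ : Measure X := riemannianVolume m
  set A := annulus m S (χ ε)
  set N := differentialSupNorm m (χ ε)
  set δ := max (δbar ε) (max (δ' ε) (C * (δ'' ε + δ' ε * δ'' ε * N)))
  obtain ⟨hδ', hδ''⟩ := hB.rate_nonneg ε hε
  have hC : 0 ≤ C := zero_le_one.trans hB.one_le_const
  have hN : 0 ≤ N := ENNReal.toReal_nonneg
  have hδ1 : δbar ε ≤ δ := le_max_left _ _
  have hδ2 : δ' ε ≤ δ := (le_max_left _ _).trans (le_max_right _ _)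
  have hδ3 : C * (δ'' ε + δ' ε * δ'' ε * N) ≤ δ := (le_max_right _ _).trans (le_max_right _ _)
  -- The sign of `δbar` is not prescribed; non-negativity of the maximum comes from `δ'`.
  have hδ : 0 ≤ δ := hδ'.trans hδ2
  have : IsContinuousRiemannianBundle (EuclideanSpace ℝ (Fin m))
      (fun x : X => TangentSpace (𝓡 m) x) := by
    obtain ⟨g, hg, hgi⟩ := IsContMDiffRiemannianBundle.exists_contMDiff (IB := 𝓡 m) (n := ∞)
      (F := EuclideanSpace ℝ (Fin m)) (E := fun x : X => TangentSpace (𝓡 m) x)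
    exact ⟨g, hg.continuous, hgi⟩
  have hS := hB.isClosed_limit
  have hSm : MeasurableSet S := hS.measurableSet
  have hSU : MeasurableSet Sᶜ := hSm.compl
  have hUV : Sᶜ ⊆ (B ε)ᶜ := compl_subset_compl.2 (hB.obstacle_subset ε hε)
  have hle : μ.restrict Sᶜ ≤ μ.restrict (B ε)ᶜ := Measure.restrict_mono hUV le_rfl
  have hA : MeasurableSet A := measurableSet_annulus hS
  have hAU : A ⊆ Sᶜ := fun x hx => hx.2
  obtain ⟨K, hK⟩ := hB.lipschitz ε hε
  have hχ01 := hB.range_cutoff ε hε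
  have hχ1 : ∀ x ∈ Sᶜ, x ∉ A → χ ε x = 1 := hB.cutoff_eq_one ε hε
  obtain ⟨T, hT⟩ := exists_sobolevCutoff (m := m) hS hK hχ01 (hB.cutoff_eq_zero ε hε) hUV
  have hann : ∀ u : sobolevZero m (B ε)ᶜ,
      eLpNorm (sobolevInclusion m _ u) 2 (μ.restrict A) ≤ ENNReal.ofReal (δ' ε * ‖u‖) :=
    hB.nonConcentrating ε hε
  have hsolid : ∀ u : sobolevZero m (B ε)ᶜ,
      eLpNorm (sobolevInclusion m _ u) 2 (μ.restrict (S \ B ε)) ≤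
        ENNReal.ofReal (δbar ε * ‖u‖) := by
    intro u
    -- The two sets differ by part of `frontier S \ B ε`, which is null by hypothesis.
    have h : (S \ B ε : Set X) =ᵐ[μ] (interior S \ B ε : Set X) := by
      refine ae_eq_set.2 ⟨measure_mono_null ?_ (hB.null_boundary ε hε), ?_⟩
      · rintro x ⟨⟨hxS, hxB⟩, hx⟩
        exact ⟨⟨subset_closure hxS, fun hi => hx ⟨hi, hxB⟩⟩, hxB⟩
      · rw [sdiff_eq_empty.2 (sdiff_subset_sdiff_left interior_subset), measure_empty]
    rw [Measure.restrict_congr_set h]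
    exact hB.spectral ε hε u
  have helliptic : ∀ (f : sobolevZero m Sᶜ) (h : L2 m Sᶜ),
      (dirichletForm m Sᶜ).IsOperatorValue f h →
      eLpNorm (sobolevDifferential m Sᶜ f) 2 (μ.restrict A) ≤
        ENNReal.ofReal (δ'' ε * (C * ‖h + sobolevInclusion m Sᶜ f‖)) := by
    intro f h hf
    obtain ⟨w, t, hwt, hle⟩ := hB.ellipticallyRegular f h hf
    -- Elliptic regularity provides some weak differential `w`; uniqueness of weak derivatives
    -- identifies it with the one entering the form.
    have h1 : sobolevDifferential m Sᶜ f =ᵐ[μ.restrict Sᶜ] fun x => covectorComponents m x (w x) :=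
      snd_eq_covectorComponents_of_hasWeakPartial hS.isOpen_compl f.2 fun p => (hwt.1 p).1
    rw [eLpNorm_congr_ae (ae_restrict_of_ae_restrict_of_subset hAU h1), ENNReal.ofReal_mul hδ'']
    exact (hB.nonConcentrating_two ε hε _ w t hwt).trans (mul_le_mul_right hle _)
  refine ⟨hδ, lpExtend hSU hUV, lpRestrict hle, sobolevExtend m hSU hUV, T, ?_, ?_, ?_, ?_, ?_, ?_,
    ?_⟩
  · intro f
    refine (norm_lpExtend_le hSU hUV f).trans ?_
    nlinarith [norm_nonneg f]
  · intro f u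
    rw [inner_lpExtend_left, sub_self, norm_zero]
    positivity
  · intro f
    rw [lpRestrict_lpExtend, sub_self, norm_zero]
    positivity
  · intro u
    set v : L2 m (B ε)ᶜ := (dirichletForm m (B ε)ᶜ).ι u
    have h : (v - lpExtend hSU hUV (lpRestrict hle v) : L2 m (B ε)ᶜ) =ᵐ[μ.restrict (B ε)ᶜ]
        S.indicator v := by
      filter_upwards [Lp.coeFn_sub v (lpExtend hSU hUV (lpRestrict hle v)),
        coeFn_lpExtend hSU hUV (coeFn_lpRestrict hle v)] with x hx hx'
      rw [hx, Pi.sub_apply, hx']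
      by_cases hxS : x ∈ S <;> simp [hxS]
    refine Lp_norm_le_of_eLpNorm_le h (by positivity) ?_
    rw [eLpNorm_indicator_eq_eLpNorm_restrict hSm, Measure.restrict_restrict hSm]
    exact (hsolid u).trans (ENNReal.ofReal_le_ofReal
      (mul_le_mul_of_nonneg_right hδ1 (norm_nonneg _)))
  · intro f
    have h : (dirichletForm m (B ε)ᶜ).ι (sobolevExtend m hSU hUV f) =
      lpExtend hSU hUV ((dirichletForm m Sᶜ).ι f) := rfl
    rw [h, sub_self, norm_zero]
    positivity
  · intro u
    set v : L2 m (B ε)ᶜ := (dirichletForm m (B ε)ᶜ).ι u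
    have h : ((dirichletForm m Sᶜ).ι (T u) - lpRestrict hle v : L2 m Sᶜ) =ᵐ[μ.restrict Sᶜ]
        fun x => ((χ ε x - 1 : ℝ) : ℂ) * v x := by
      filter_upwards [Lp.coeFn_sub ((dirichletForm m Sᶜ).ι (T u)) (lpRestrict hle v), (hT u).1,
        coeFn_lpRestrict hle v] with x hx hx' hx''
      rw [hx, Pi.sub_apply, hx'', Complex.ofReal_sub, sub_mul, Complex.ofReal_one, one_mul]
      exact congrArg (· - v x) hx'
    refine Lp_norm_le_of_eLpNorm_le h (by positivity) ?_
    calc eLpNorm (fun x => ((χ ε x - 1 : ℝ) : ℂ) * v x) 2 (μ.restrict Sᶜ)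
        ≤ eLpNorm (A.indicator v) 2 (μ.restrict Sᶜ) := by
          refine eLpNorm_mono_ae ?_
          filter_upwards [ae_restrict_mem hSU] with x hx
          by_cases hxA : x ∈ A
          · rw [indicator_of_mem hxA, norm_mul, Complex.norm_real, Real.norm_eq_abs]
            refine mul_le_of_le_one_left (norm_nonneg _) (abs_le.2 ⟨?_, ?_⟩) <;>
              linarith [(hχ01 x).1, (hχ01 x).2]
          · simp [hχ1 x hx hxA]
      _ = eLpNorm v 2 (μ.restrict A) := by
          rw [eLpNorm_indicator_eq_eLpNorm_restrict hA, Measure.restrict_restrict hA,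
            inter_eq_left.2 hAU]
      _ ≤ _ := (hann u).trans (ENNReal.ofReal_le_ofReal
          (mul_le_mul_of_nonneg_right hδ2 (norm_nonneg _)))
  · intro f h hf u
    set df : L2Form m Sᶜ := sobolevDifferential m Sᶜ f
    set du : L2Form m (B ε)ᶜ := sobolevDifferential m (B ε)ᶜ u
    set v : L2 m (B ε)ᶜ := sobolevInclusion m (B ε)ᶜ u
    set R : L2Form m Sᶜ := lpRestrict hle du - sobolevDifferential m Sᶜ (T u)
    -- Extension by zero commutes with the differential on `H¹₀`, so adjointness collects both forms
    -- into one inner product over the complement of `S`.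
    have hform : (dirichletForm m (B ε)ᶜ).form (sobolevExtend m hSU hUV f) u -
        (dirichletForm m Sᶜ).form f (T u) = inner ℂ df R := by
      have h1 : (dirichletForm m (B ε)ᶜ).form (sobolevExtend m hSU hUV f) u =
        inner ℂ (lpExtend hSU hUV df) du := rfl
      have h2 : (dirichletForm m Sᶜ).form f (T u) =
        inner ℂ df (sobolevDifferential m Sᶜ (T u)) := rfl
      rw [h1, h2, inner_lpExtend_left, ← inner_sub_right]
    have hR : R =ᵐ[μ.restrict Sᶜ] fun x => ((1 - χ ε x : ℝ) : ℂ) • du x -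
        v x • realDifferential m (χ ε) x := by
      filter_upwards [Lp.coeFn_sub (lpRestrict hle du) (sobolevDifferential m Sᶜ (T u)), (hT u).2,
        coeFn_lpRestrict hle du] with x hx hx' hx''
      rw [hx, Pi.sub_apply, hx'', hx', Complex.ofReal_sub, sub_smul, Complex.ofReal_one, one_smul,
        sub_sub]
    have hR0 : ∀ᵐ x ∂(μ.restrict Sᶜ), x ∉ A → R x = 0 := by
      filter_upwards [hR, ae_restrict_mem hSU,
        ae_restrict_of_ae (ae_realDifferential_eq_zero (m := m) (χ := χ ε))] with x hx hxS hx0 hxA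
      rw [hx, hχ1 x hxS hxA, hx0 fun hs => hxA ⟨hs, hxS⟩]
      simp
    -- The summand `1` bounds `(1 - χ) du`, and `δ' ε * N` bounds `u dχ` by non-concentration of `u`
    -- on `A`.
    have hRn : (eLpNorm R 2 (μ.restrict A)).toReal ≤ (1 + δ' ε * N) * ‖u‖ := by
      refine ENNReal.toReal_le_of_le_ofReal (by positivity) ?_
      rw [eLpNorm_congr_ae (ae_restrict_of_ae_restrict_of_subset hAU hR)]
      have hleA : μ.restrict A ≤ μ.restrict (B ε)ᶜ :=
        (Measure.restrict_mono hAU le_rfl).trans hle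
      have hm1 : AEStronglyMeasurable (fun x => ((1 - χ ε x : ℝ) : ℂ) • du x) (μ.restrict A) :=
        (Complex.continuous_ofReal.comp
          (continuous_const.sub hK.continuous)).aestronglyMeasurable.smul
          ((Lp.aestronglyMeasurable du).mono_measure hleA)
      have hm2 : AEStronglyMeasurable (fun x => v x • realDifferential m (χ ε) x)
          (μ.restrict A) :=
        ((Lp.aestronglyMeasurable v).mono_measure hleA).smul
          (measurable_differentialComponents m _).aestronglyMeasurable
      have e1 : eLpNorm (fun x => ((1 - χ ε x : ℝ) : ℂ) • du x) 2 (μ.restrict A) ≤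
          ENNReal.ofReal ‖u‖ := by
        refine (eLpNorm_mono (g := du) fun x => ?_).trans
          ((eLpNorm_mono_measure _ hleA).trans ?_)
        · rw [norm_smul, Complex.norm_real, Real.norm_eq_abs]
          refine mul_le_of_le_one_left (norm_nonneg _) (abs_le.2 ⟨?_, ?_⟩) <;>
            linarith [(hχ01 x).1, (hχ01 x).2]
        · rw [← ENNReal.ofReal_toReal (Lp.eLpNorm_ne_top du), ← Lp.norm_def]
          exact ENNReal.ofReal_le_ofReal (norm_sobolevDifferential_le u)
      have e2 : eLpNorm (fun x => v x • realDifferential m (χ ε) x) 2 (μ.restrict A) ≤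
          ENNReal.ofReal (N * (δ' ε * ‖u‖)) := by
        refine (eLpNorm_le_mul_eLpNorm_of_ae_le_mul (g := v) (c := N) ?_ 2).trans ?_
        · filter_upwards [ae_restrict_of_ae (ae_norm_realDifferential_le (m := m) hK)] with x hx
          rw [norm_smul, mul_comm]
          exact mul_le_mul_of_nonneg_right hx (norm_nonneg _)
        · rw [ENNReal.ofReal_mul hN]
          exact mul_le_mul_right (hann u) _
      refine (eLpNorm_sub_le hm1 hm2 (by norm_num)).trans ((add_le_add e1 e2).trans ?_)
      rw [← ENNReal.ofReal_add (norm_nonneg _) (by positivity)]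
      exact ENNReal.ofReal_le_ofReal (le_of_eq (by ring))
    have hdf : (eLpNorm df 2 (μ.restrict A)).toReal ≤
        δ'' ε * (C * ‖h + sobolevInclusion m Sᶜ f‖) :=
      ENNReal.toReal_le_of_le_ofReal (by positivity) (helliptic f h hf)
    rw [hform]
    calc ‖inner ℂ df R‖ ≤ (δ'' ε * (C * ‖h + sobolevInclusion m Sᶜ f‖)) *
          ((1 + δ' ε * N) * ‖u‖) :=
          (norm_inner_le_of_eq_zero hA hAU df R hR0).trans
            (mul_le_mul hdf hRn ENNReal.toReal_nonneg (by positivity))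
      _ = C * (δ'' ε + δ' ε * δ'' ε * N) * ‖h + sobolevInclusion m Sᶜ f‖ * ‖u‖ := by ring
      _ ≤ δ * ‖h + sobolevInclusion m Sᶜ f‖ * ‖u‖ := by gcongr
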